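/- An (unoriented) tied link diagram is a non-empty link diagram on the sphere $S^2$, considered up to isotopy of $S^2$, together with ties between points of its curves; only the partition of the set of components that the ties generate matters, two components being \emph{tied together} if they lie in the same block of this partition. Write $\bigcirc$ for the crossingless diagram of the unknot, $D\sqcup\bigcirc$ for the disjoint union of $D$ with a crossingless circle that is not tied to any component of $D$, and $D\,\widetilde{\sqcup}\,\bigcirc$ for the disjoint union of $D$ with a crossingless circle together with a tie between this circle and (a component of) $D$. For a crossing of a diagram, let $D_+$ and $D_-$ be two tied link diagrams that are identical except in a small disc, where they show the two crossings of the same two strands, the over-strand having positive slope in $D_+$ and negative slope in $D_-$; let $D_e$ and $D_f$ be the diagrams obtained from them by putting into the disc two vertical arcs $)($, respectively two horizontal arcs $\asymp$, with a tie between the two arcs. Let $\widetilde D_+$ be $D_+$ with a tie between the two strands in the disc (equivalently, a diagram $D_+$ in which the two strands belong to the same component or to components that are tied together). The disc may be turned in the plane. Theorem. There is a unique function $$\langle\langle\ \cdot\ \rangle\rangle:\{\text{unoriented tied link diagrams}\}\to\mathbb Z[A^{\pm1},c]$$ that satisfies the following rules: (i) $\langle\langle \bigcirc\rangle\rangle=1$;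 (ii) $\langle\langle D\sqcup\bigcirc\rangle\rangle=c\,\langle\langle D\rangle\rangle$; (iii) $\langle\langle D\,\widetilde{\sqcup}\,\bigcirc\rangle\rangle=-(A^2+A^{-2})\,\langle\langle D\rangle\rangle$; (iv) $\langle\langle\ \cdot\ \rangle\rangle$ is invariant under the Reidemeister moves II and III; (v) $\langle\langle \widetilde D_+\rangle\rangle=A\,\langle\langle D_e\rangle\rangle+A^{-1}\,\langle\langle D_f\rangle\rangle$ (so that, turning the disc by a right angle, $\langle\langle \widetilde D_-\rangle\rangle=A\,\langle\langle D_f\rangle\rangle+A^{-1}\,\langle\langle D_e\rangle\rangle$); (vi) $\langle\langle D_+\rangle\rangle+\langle\langle D_-\rangle\rangle=(A+A^{-1})\bigl(\langle\langle D_e\rangle\rangle+\langle\langle D_f\rangle\rangle\bigr)$. -/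

import Mathlib

/-!
Unoriented tied link diagrams on the sphere, in Morse position.

A generic link diagram in the plane is cut by horizontal lines, read from bottom to top, into
slices each of which holds exactly one elementary piece (a local minimum, a local maximum or a
crossing) between vertical strands.  Planar isotopy of diagrams is generated by the exchange of
heights of two elementary pieces, the creation of a minimum and a maximum on a strand, and the
passage of a strand of a crossing through a horizontal tangent.  Isotopy of diagrams on the
sphere allows moreover an arc to pass through the point at infinity.
-/

namespace TiedLink

/-- The elementary pieces.  In `cross true` the over-strand goes from bottom left to top right,
in `cross false` from bottom right to top left. -/
inductive Piece : Type
  | cup : Piece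
  | cap : Piece
  | cross (b : Bool) : Piece

/-- Number of ends at the bottom. -/
def Piece.dom : Piece → ℕ
  | .cup => 0
  | .cap => 2
  | .cross _ => 2

/-- Number of ends at the top. -/
def Piece.cod : Piece → ℕ
  | .cup => 2
  | .cap => 0
  | .cross _ => 2

/-- An elementary piece with `left` vertical strands on its left and `right` vertical strands on
its right. -/
structure Slice where
  left : ℕ
  piece : Piece
  right : ℕ

def Slice.dom (s : Slice) : ℕ := s.left + s.piece.dom + s.right

def Slice.cod (s : Slice) : ℕ := s.left + s.piece.cod + s.right

/-- The slices of `w`, stacked from bottom to top, fit together to a tangle diagram with `m` ends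
at the bottom and `n` ends at the top. -/
def IsTangle : ℕ → List Slice → ℕ → Prop
  | m, [], n => m = n
  | m, s :: w, n => s.dom = m ∧ IsTangle s.cod w n

/-- Number of strands that meet the level `k` (the horizontal line above the first `k` slices). -/
def widthAt : ℕ → List Slice → ℕ → ℕ
  | m, _, 0 => m
  | m, [], _ + 1 => m
  | _, s :: w, k + 1 => widthAt s.cod w k

/-- The points in which the levels meet the curves of a link diagram: `(k, i)` is the `i`-th point,
from the left and counted from `0`, on the level `k`. -/
def Point (w : List Slice) : Type :=
  {p : ℕ × ℕ // p.1 ≤ w.length ∧ p.2 < widthAt 0 w p.1}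

/-- Two points are the ends of one arc of a slice. -/
inductive Joined (w : List Slice) : ℕ × ℕ → ℕ × ℕ → Prop
  | leftStrand (k : ℕ) (s : Slice) (i : ℕ) : w[k]? = some s → i < s.left →
      Joined w (k, i) (k + 1, i)
  | rightStrand (k : ℕ) (s : Slice) (i : ℕ) : w[k]? = some s → i < s.right →
      Joined w (k, s.left + s.piece.dom + i) (k + 1, s.left + s.piece.cod + i)
  | cup (k l r : ℕ) : w[k]? = some ⟨l, .cup, r⟩ → Joined w (k + 1, l) (k + 1, l + 1)
  | cap (k l r : ℕ) : w[k]? = some ⟨l, .cap, r⟩ → Joined w (k, l) (k, l + 1)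
  | crossRising (k l r : ℕ) (b : Bool) : w[k]? = some ⟨l, .cross b, r⟩ →
      Joined w (k, l) (k + 1, l + 1)
  | crossFalling (k l r : ℕ) (b : Bool) : w[k]? = some ⟨l, .cross b, r⟩ →
      Joined w (k, l + 1) (k + 1, l)

/-- A (non-empty) unoriented tied link diagram in Morse position.  The ties enter through the
partition of the set of components that they define: `tied p q` says that the components
through `p` and `q` coincide or are tied together. -/
structure MorseDiagram where
  word : List Slice
  closed : IsTangle 0 word 0
  nonempty : word ≠ []
  tied : Setoid (Point word)
  tied_of_joined : ∀ p q : Point word, Joined word p.1 q.1 → tied p q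

namespace MorseDiagram

abbrev Pt (D : MorseDiagram) : Type := Point D.word

/-- The diagram with one more tie, between the points `p` and `q`. -/
def addTie (D : MorseDiagram) (p q : D.Pt) : MorseDiagram where
  word := D.word
  closed := D.closed
  nonempty := D.nonempty
  tied := D.tied ⊔ Relation.EqvGen.setoid (fun x y => x = p ∧ y = q)
  tied_of_joined x y h :=
    (le_sup_left : D.tied ≤ D.tied ⊔ Relation.EqvGen.setoid (fun x y => x = p ∧ y = q))
      (D.tied_of_joined x y h)

/-- The ties of two diagrams define the same partition, as far as points are concerned that
correspond to each other under `R`. -/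
def TiesAgree (R : ℕ × ℕ → ℕ × ℕ → Prop) (D D' : MorseDiagram) : Prop :=
  ∀ (p q : D.Pt) (p' q' : D'.Pt), R p.1 p'.1 → R q.1 q'.1 → (D.tied p q ↔ D'.tied p' q')

/-- Correspondence between the points of `u ++ a ++ v` and of `u ++ b ++ v` that are not strictly
inside `a`, `b`; here `n`, `i`, `j` are the lengths of `u`, `a`, `b`. -/
def outside (n i j : ℕ) (p p' : ℕ × ℕ) : Prop :=
  (p.1 ≤ n ∧ p' = p) ∨ ∃ k x, p = (n + i + k, x) ∧ p' = (n + j + k, x)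

/-- `D` and `D'` are identical outside of a horizontal strip, in which they look like `a` and `b`
respectively, and the ties outside of the strip define the same partition. -/
def Replace (u a b v : List Slice) (D D' : MorseDiagram) : Prop :=
  D.word = u ++ a ++ v ∧ D'.word = u ++ b ++ v ∧
    TiesAgree (outside u.length a.length b.length) D D'

end MorseDiagram

open MorseDiagram

/-- The local planar isotopies. -/
inductive PlanarMove : List Slice → List Slice → Prop
  /-- exchange of the heights of two elementary pieces side by side -/
  | exchange (l m r : ℕ) (g h : Piece) :
      PlanarMove [⟨l, g, m + h.dom + r⟩, ⟨l + g.cod + m, h, r⟩]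
        [⟨l + g.dom + m, h, r⟩, ⟨l, g, m + h.cod + r⟩]
  | zigzagLeft (l r : ℕ) : PlanarMove [⟨l, .cup, r + 1⟩, ⟨l + 1, .cap, r⟩] []
  | zigzagRight (l r : ℕ) : PlanarMove [⟨l + 1, .cup, r⟩, ⟨l, .cap, r + 1⟩] []
  /-- a strand passes a crossing through a local maximum -/
  | crossCap (l r : ℕ) (b : Bool) :
      PlanarMove [⟨l + 1, .cross b, r⟩, ⟨l, .cap, r + 1⟩]
        [⟨l, .cross (!b), r + 1⟩, ⟨l + 1, .cap, r⟩]
  /-- a strand passes a crossing through a local minimum -/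
  | cupCross (l r : ℕ) (b : Bool) :
      PlanarMove [⟨l, .cup, r + 1⟩, ⟨l + 1, .cross b, r⟩]
        [⟨l + 1, .cup, r⟩, ⟨l, .cross (!b), r + 1⟩]

/-- The tangle diagram with a further vertical strand on its left. -/
def addLeft (w : List Slice) : List Slice := w.map fun s => ⟨s.left + 1, s.piece, s.right⟩

/-- The tangle diagram with a further vertical strand on its right. -/
def addRight (w : List Slice) : List Slice := w.map fun s => ⟨s.left, s.piece, s.right + 1⟩

/-- The closure of a tangle diagram with one end at the bottom and one at the top by an arc on its
right. -/
def rightClosure (w : List Slice) : List Slice :=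
  [⟨0, .cup, 0⟩] ++ addRight w ++ [⟨0, .cap, 0⟩]

/-- The closure by an arc on its left. -/
def leftClosure (w : List Slice) : List Slice :=
  [⟨0, .cup, 0⟩] ++ addLeft w ++ [⟨0, .cap, 0⟩]

/-- Correspondence between the points of `rightClosure w` and of `leftClosure w`: on each level the
last point, which lies on the closing arc, becomes the first one. -/
def throughInfinity (w : List Slice) (p p' : ℕ × ℕ) : Prop :=
  (p.2 + 1 < widthAt 0 (rightClosure w) p.1 ∧ p' = (p.1, p.2 + 1)) ∨
    (p.2 + 1 = widthAt 0 (rightClosure w) p.1 ∧ p' = (p.1, 0))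

/-- The elementary isotopies of tied link diagrams on the sphere. -/
inductive Isotopy : MorseDiagram → MorseDiagram → Prop
  | planar (u a b v : List Slice) (D D' : MorseDiagram) :
      PlanarMove a b → Replace u a b v D D' → Isotopy D D'
  /-- an arc passes through the point at infinity -/
  | infinity (w : List Slice) (D D' : MorseDiagram) : IsTangle 1 w 1 →
      D.word = rightClosure w → D'.word = leftClosure w →
      TiesAgree (throughInfinity w) D D' → Isotopy D D'

/-- Unoriented tied link diagrams on the sphere, up to isotopy of the sphere. -/
def Diagram : Type := Quot Isotopy

/-- The tied link diagram with a given Morse position. -/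
def MorseDiagram.toDiagram (D : MorseDiagram) : Diagram := Quot.mk Isotopy D

/-- Reidemeister moves II and III.  In the third move the three crossings are those of the pairs
(first, second), (first, third) and (second, third) of the strands, numbered at the bottom from the
left; the condition says that one of the three strands lies above both others. -/
inductive ReidemeisterMove : List Slice → List Slice → Prop
  | two (l r : ℕ) (b : Bool) :
      ReidemeisterMove [⟨l, .cross b, r⟩, ⟨l, .cross (!b), r⟩] []
  | three (l r : ℕ) (b₁₂ b₁₃ b₂₃ : Bool) : b₁₂ = b₁₃ ∨ b₁₃ = b₂₃ →
      ReidemeisterMove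
        [⟨l, .cross b₁₂, r + 1⟩, ⟨l + 1, .cross b₁₃, r⟩, ⟨l, .cross b₂₃, r + 1⟩]
        [⟨l + 1, .cross b₂₃, r⟩, ⟨l, .cross b₁₃, r + 1⟩, ⟨l + 1, .cross b₁₂, r⟩]

/-- `D'` is obtained from `D` by one Reidemeister move II or III. -/
def Reidemeister (D D' : MorseDiagram) : Prop :=
  ∃ u a b v, ReidemeisterMove a b ∧ Replace u a b v D D'

/-- The slices of a small circle between `l` strands on the left and `r` strands on the right. -/
def circle (l r : ℕ) : List Slice := [⟨l, .cup, r⟩, ⟨l, .cap, r⟩]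

/-- `D'` is the disjoint union of `D` and a crossingless circle, inserted in one of the regions
of `D` and not tied to any component of `D`. -/
def UntiedCircle (D D' : MorseDiagram) : Prop :=
  ∃ u v l r, Replace u (circle l r) [] v D' D ∧
    ∀ p q : D'.Pt, p.1 = (u.length + 1, l) → D'.tied p q →
      q.1 = (u.length + 1, l) ∨ q.1 = (u.length + 1, l + 1)

/-- `D'` is the disjoint union of `D` and a crossingless circle, inserted in one of the regions
of `D`, with a tie between the circle and (some component of) `D`. -/
def TiedCircle (D D' : MorseDiagram) : Prop :=
  ∃ u v l r, Replace u (circle l r) [] v D' D ∧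
    ∃ p q : D'.Pt, p.1 = (u.length + 1, l) ∧ D'.tied p q ∧
      q.1 ≠ (u.length + 1, l) ∧ q.1 ≠ (u.length + 1, l + 1)

/-- `D` has a crossing of the kind `b` in which the two strands belong to the same component or
to tied components.  `E` and `F` are identical with `D` except that
this crossing is replaced by two vertical arcs and by two horizontal arcs respectively; these arcs
are tied. -/
def TiedSkein (b : Bool) (D E F : MorseDiagram) : Prop :=
  ∃ u v l r,
    Replace u [⟨l, .cross b, r⟩] [] v D E ∧
    Replace u [⟨l, .cross b, r⟩] [⟨l, .cap, r⟩, ⟨l, .cup, r⟩] v D F ∧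
    ∃ p q : D.Pt, p.1 = (u.length, l) ∧ q.1 = (u.length, l + 1) ∧ D.tied p q

/-- `D`, `D'`, `E`, `F` are identical except in a disc, in which `D` and `D'` have the two kinds of
crossings, `E` has two vertical and `F` two horizontal arcs.  In `E` and `F` there is moreover a
tie between the two arcs in the disc. -/
def Skein (D D' E F : MorseDiagram) : Prop :=
  ∃ u v l r,
    Replace u [⟨l, .cross true, r⟩] [⟨l, .cross false, r⟩] v D D' ∧
    ∃ p q : D.Pt, p.1 = (u.length, l) ∧ q.1 = (u.length, l + 1) ∧
      Replace u [⟨l, .cross true, r⟩] [] v (D.addTie p q) E ∧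
      Replace u [⟨l, .cross true, r⟩] [⟨l, .cap, r⟩, ⟨l, .cup, r⟩] v (D.addTie p q) F

/-- The ring `ℤ[A, A⁻¹, c]`. -/
abbrev Coeff : Type := Polynomial (LaurentPolynomial ℤ)

/-- The element `A ^ n`, for an integer `n`. -/
noncomputable def A (n : ℤ) : Coeff := Polynomial.C (LaurentPolynomial.T n)

/-- The variable `c`. -/
noncomputable def c : Coeff := Polynomial.X

/-- The defining rules of the bracket. -/
structure IsBracket (B : Diagram → Coeff) : Prop where
  unknot : ∀ D : MorseDiagram, D.word = circle 0 0 → B D.toDiagram = 1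
  untiedCircle : ∀ D D' : MorseDiagram, UntiedCircle D D' →
    B D'.toDiagram = c * B D.toDiagram
  tiedCircle : ∀ D D' : MorseDiagram, TiedCircle D D' →
    B D'.toDiagram = -(A 2 + A (-2)) * B D.toDiagram
  reidemeister : ∀ D D' : MorseDiagram, Reidemeister D D' → B D.toDiagram = B D'.toDiagram
  /-- The region swept out by the over-strand when it is turned counterclockwise is opened in the
  diagram with the coefficient `A`: vertical arcs for `cross true`, ... -/
  tiedSkein_true : ∀ D E F : MorseDiagram, TiedSkein true D E F →
    B D.toDiagram = A 1 * B E.toDiagram + A (-1) * B F.toDiagram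
  /-- ... and horizontal arcs for `cross false`, the same picture turned by a right angle. -/
  tiedSkein_false : ∀ D E F : MorseDiagram, TiedSkein false D E F →
    B D.toDiagram = A 1 * B F.toDiagram + A (-1) * B E.toDiagram
  skein : ∀ D D' E F : MorseDiagram, Skein D D' E F →
    B D.toDiagram + B D'.toDiagram =
      (A 1 + A (-1)) * (B E.toDiagram + B F.toDiagram)

end TiedLink

/-! Existence and uniqueness rest on one reduction: if a function of Morse diagrams with values in a
commutative ring obeys the rules, the coefficients acting through a ring homomorphism φ from
`Coeff`, then its value on every diagram is φ p times the value of the unknot, for some p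
(`IsEvaluation.exists_coeff`).

Reduction. Colour the components so that equal colours mean tied, and induct on the number of
colours. Rule (v) removes the crossings of a chosen colour c with itself. Rule (vi) switches a
crossing of two different colours at the cost of diagrams in which these colours are merged, hence
of diagrams with fewer colours. So c may be put on top of all other colours. Planar isotopies and
the moves II and III then slide it to the right of the rest (`Sim.shuffle_word`), where it forms a
crossingless diagram, which zigzags and the circle rules remove (`Hereditary.append_crossingless`).
What remains avoids c.

Uniqueness. Two brackets together are an evaluation in `Coeff × Coeff` with φ diagonal and unknot
value (1, 1), so all their values are diagonal pairs.

Existence. For q + 1 colours, sum over all colourings of the tie classes. A crossing of equal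
colours is expanded as in the Kauffman bracket, realised by a spin model; at a crossing of different
colours the strands pass through each other, with the sign -1 exactly when the over-strand has the
smaller colour. Switching such a crossing changes the sign, so in the sum over D₊ and D₋ only the
colourings survive that give both strands the same colour, and these are the colourings of the tied
diagrams in rule (vi). The planar moves and the moves II and III are local operator identities. The
passage of an arc through infinity holds because all operators commute with a raising operator,
which forces the diagonal of a one-strand tangle to be constant (`pull_diagonal`).

With δ = -(A² + A⁻²), an untied circle contributes (q + 1)δ and a tied one δ, so c acts as (q + 1)δ.
By the reduction, the state sums of D for all q are the values p((q + 1)δ) of one polynomial p,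
times the state sums of the unknot. A polynomial over a domain is determined by infinitely many
values, so p is unique. It is the bracket of D, and it inherits the rules from the state sums. -/

namespace TiedLink

open MorseDiagram

/-! ### Levels and points of words -/

theorem isTangle_append {m n : ℕ} {u v : List Slice} :
    IsTangle m (u ++ v) n ↔ ∃ k, IsTangle m u k ∧ IsTangle k v n := by
  induction u generalizing m with
  | nil => simp [IsTangle]
  | cons s u ih => simp [IsTangle, ih, and_assoc]

theorem widthAt_zero (m : ℕ) (w : List Slice) : widthAt m w 0 = m := by
  cases w <;> rfl

theorem widthAt_append_left {m : ℕ} {u v : List Slice} {k : ℕ} (hk : k ≤ u.length) :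
    widthAt m (u ++ v) k = widthAt m u k := by
  induction u generalizing m k with
  | nil => obtain rfl : k = 0 := by simpa using hk
           simp [widthAt_zero]
  | cons s u ih =>
    cases k with
    | zero => rfl
    | succ k => exact ih (by simpa using hk)

theorem widthAt_append_right {m n : ℕ} {u v : List Slice} (h : IsTangle m u n) (k : ℕ) :
    widthAt m (u ++ v) (u.length + k) = widthAt n v k := by
  induction u generalizing m with
  | nil => obtain rfl : m = n := h
           simp
  | cons s u ih =>
    have := ih h.2
    simpa [widthAt, Nat.add_right_comm] using this

theorem widthAt_length {m n : ℕ} {w : List Slice} (h : IsTangle m w n) :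
    widthAt m w w.length = n := by
  simpa [widthAt_zero] using widthAt_append_right (v := []) h 0

theorem widthAt_of_getElem? {m n : ℕ} {w : List Slice} (h : IsTangle m w n) {k : ℕ} {s : Slice}
    (hs : w[k]? = some s) : widthAt m w k = s.dom ∧ widthAt m w (k + 1) = s.cod := by
  induction w generalizing m k with
  | nil => simp at hs
  | cons t w ih =>
    cases k with
    | zero =>
      obtain rfl : t = s := by simpa using hs
      exact ⟨h.1.symm, widthAt_zero _ w⟩
    | succ k => exact ih h.2 (by simpa using hs)

/-- `(k, i)` is a point of the word. -/
def IsPoint (w : List Slice) (p : ℕ × ℕ) : Prop := p.1 ≤ w.length ∧ p.2 < widthAt 0 w p.1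

theorem Joined.isPoint {w : List Slice} (h : IsTangle 0 w 0) {p q : ℕ × ℕ} (hj : Joined w p q) :
    IsPoint w p ∧ IsPoint w q := by
  have key : ∀ k s, w[k]? = some s →
      k + 1 ≤ w.length ∧ widthAt 0 w k = s.dom ∧ widthAt 0 w (k + 1) = s.cod := fun k s hs =>
    ⟨(List.getElem?_eq_some_iff.1 hs).1, widthAt_of_getElem? h hs⟩
  cases hj with
  | leftStrand k s i hs hi =>
    obtain ⟨h1, h2, h3⟩ := key k s hs
    simp only [IsPoint, h2, h3, Slice.dom, Slice.cod]; omega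
  | rightStrand k s i hs hi =>
    obtain ⟨h1, h2, h3⟩ := key k s hs
    simp only [IsPoint, h2, h3, Slice.dom, Slice.cod]; omega
  | cup k l r hs =>
    obtain ⟨h1, h2, h3⟩ := key k _ hs
    simp only [IsPoint, h3, Slice.cod, Piece.cod]; omega
  | cap k l r hs =>
    obtain ⟨h1, h2, h3⟩ := key k _ hs
    simp only [IsPoint, h2, Slice.dom, Piece.dom]; omega
  | crossRising k l r b hs =>
    obtain ⟨h1, h2, h3⟩ := key k _ hs
    simp only [IsPoint, h2, h3, Slice.dom, Slice.cod, Piece.dom, Piece.cod]; omega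
  | crossFalling k l r b hs =>
    obtain ⟨h1, h2, h3⟩ := key k _ hs
    simp only [IsPoint, h2, h3, Slice.dom, Slice.cod, Piece.dom, Piece.cod]; omega

theorem Joined.cons {s : Slice} {w : List Slice} {p q : ℕ × ℕ} (h : Joined w p q) :
    Joined (s :: w) (p.1 + 1, p.2) (q.1 + 1, q.2) := by
  cases h with
  | leftStrand k t i ht hi => exact .leftStrand _ t _ (by simpa using ht) hi
  | rightStrand k t i ht hi => exact .rightStrand _ t _ (by simpa using ht) hi
  | cup k l r ht => exact .cup _ l r (by simpa using ht)
  | cap k l r ht => exact .cap _ l r (by simpa using ht)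
  | crossRising k l r b ht => exact .crossRising _ l r b (by simpa using ht)
  | crossFalling k l r b ht => exact .crossFalling _ l r b (by simpa using ht)

theorem Joined.append_left {u w : List Slice} {p q : ℕ × ℕ} (h : Joined w p q) :
    Joined (u ++ w) (u.length + p.1, p.2) (u.length + q.1, q.2) := by
  induction u with
  | nil => simpa using h
  | cons s u ih => simpa [Nat.add_right_comm] using ih.cons (s := s)

theorem Joined.append_right {w v : List Slice} {p q : ℕ × ℕ} (h : Joined w p q) :
    Joined (w ++ v) p q := by
  have key : ∀ {k : ℕ} {s : Slice}, w[k]? = some s → (w ++ v)[k]? = some s := fun {k s} hs => by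
    rw [List.getElem?_append_left (List.getElem?_eq_some_iff.1 hs).1, hs]
  cases h with
  | leftStrand k t i ht hi => exact .leftStrand _ t _ (key ht) hi
  | rightStrand k t i ht hi => exact .rightStrand _ t _ (key ht) hi
  | cup k l r ht => exact .cup _ l r (key ht)
  | cap k l r ht => exact .cap _ l r (key ht)
  | crossRising k l r b ht => exact .crossRising _ l r b (key ht)
  | crossFalling k l r b ht => exact .crossFalling _ l r b (key ht)

/-- A colouring of the points of a word that is constant on the arcs. -/
def Consistent {S : Type} (g : ℕ → ℕ → S) (w : List Slice) : Prop :=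
  ∀ p q, Joined w p q → g p.1 p.2 = g q.1 q.2

theorem Consistent.tail {S : Type} {g : ℕ → ℕ → S} {s : Slice} {w : List Slice}
    (h : Consistent g (s :: w)) : Consistent (fun k => g (k + 1)) w :=
  fun _ _ hj => h _ _ hj.cons

theorem Consistent.append_right {S : Type} {g : ℕ → ℕ → S} {u w : List Slice}
    (h : Consistent g (u ++ w)) : Consistent (fun k => g (u.length + k)) w :=
  fun _ _ hj => h _ _ hj.append_left

theorem Consistent.append_left {S : Type} {g : ℕ → ℕ → S} {w v : List Slice}
    (h : Consistent g (w ++ v)) : Consistent g w :=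
  fun _ _ hj => h _ _ hj.append_right

/-- The class of a point modulo ties. -/
noncomputable def MorseDiagram.class? (D : MorseDiagram) (k i : ℕ) :
    Option (Quotient D.tied) :=
  open Classical in
  if h : IsPoint D.word (k, i) then some (Quotient.mk _ ⟨(k, i), h⟩) else none

theorem MorseDiagram.consistent_class? (D : MorseDiagram) : Consistent D.class? D.word := by
  intro p q hj
  obtain ⟨hp, hq⟩ := hj.isPoint D.closed
  simp only [MorseDiagram.class?, dif_pos hp, dif_pos hq, Option.some.injEq]
  exact Quotient.sound (D.tied_of_joined ⟨p, hp⟩ ⟨q, hq⟩ hj)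

/-- Points are compared by their coordinates, because the two types of points differ until the words
are identified. -/
theorem MorseDiagram.ext_of_tied {D D' : MorseDiagram} (hw : D.word = D'.word)
    (h : ∀ (p q : D.Pt) (p' q' : D'.Pt), p.1 = p'.1 → q.1 = q'.1 →
      (D.tied p q ↔ D'.tied p' q')) : D = D' := by
  obtain ⟨w, _, _, t, _⟩ := D
  obtain ⟨w', _, _, t', _⟩ := D'
  obtain rfl : w = w' := hw
  obtain rfl : t = t' := Setoid.ext fun p q => h p q p q rfl rfl
  rfl

/-- Hence there are finitely many tie classes. They serve as the finite set of colours in the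
induction and as the domain of the colourings in the state sum. -/
instance finite_point (w : List Slice) : Finite (Point w) :=
  Finite.of_injective
    (β := Σ k : Fin (w.length + 1), Fin (widthAt 0 w k))
    (fun p => ⟨⟨p.1.1, Nat.lt_succ_of_le p.2.1⟩, ⟨p.1.2, p.2.2⟩⟩) (by
      rintro ⟨⟨k, i⟩, hp⟩ ⟨⟨k', i'⟩, hq⟩ h
      simp only [Sigma.mk.injEq, Fin.mk.injEq] at h
      obtain ⟨rfl, h⟩ := h
      obtain rfl : i = i' := by simpa using h
      rfl)

end TiedLink

namespace TiedLink

open MorseDiagram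

/-! ### Coloured words -/

/-- An elementary piece with a colour on each of its arcs. -/
inductive CPiece (S : Type) : Type
  | cup (c : S) : CPiece S
  | cap (c : S) : CPiece S
  | cross (b : Bool) (c d : S) : CPiece S

namespace CPiece

variable {S T : Type}

def dom : CPiece S → List S
  | cup _ => []
  | cap c => [c, c]
  | cross _ c d => [c, d]

def cod : CPiece S → List S
  | cup c => [c, c]
  | cap _ => []
  | cross _ c d => [d, c]

def forget : CPiece S → Piece
  | cup _ => .cup
  | cap _ => .cap
  | cross b _ _ => .cross b

def map (f : S → T) : CPiece S → CPiece T
  | cup c => cup (f c)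
  | cap c => cap (f c)
  | cross b c d => cross b (f c) (f d)

@[simp] theorem dom_cup (c : S) : (cup c).dom = [] := rfl
@[simp] theorem dom_cap (c : S) : (cap c).dom = [c, c] := rfl
@[simp] theorem dom_cross (b : Bool) (c d : S) : (cross b c d).dom = [c, d] := rfl
@[simp] theorem cod_cup (c : S) : (cup c).cod = [c, c] := rfl
@[simp] theorem cod_cap (c : S) : (cap c).cod = [] := rfl
@[simp] theorem cod_cross (b : Bool) (c d : S) : (cross b c d).cod = [d, c] := rfl
@[simp] theorem forget_cup (c : S) : (cup c).forget = .cup := rfl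
@[simp] theorem forget_cap (c : S) : (cap c).forget = .cap := rfl
@[simp] theorem forget_cross (b : Bool) (c d : S) : (cross b c d).forget = .cross b := rfl
@[simp] theorem map_cup (f : S → T) (c : S) : (cup c).map f = cup (f c) := rfl
@[simp] theorem map_cap (f : S → T) (c : S) : (cap c).map f = cap (f c) := rfl
@[simp] theorem map_cross (f : S → T) (b : Bool) (c d : S) :
    (cross b c d).map f = cross b (f c) (f d) := rfl

@[simp] theorem length_dom (p : CPiece S) : p.dom.length = p.forget.dom := by cases p <;> rfl
@[simp] theorem length_cod (p : CPiece S) : p.cod.length = p.forget.cod := by cases p <;> rfl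
@[simp] theorem dom_map (f : S → T) (p : CPiece S) : (p.map f).dom = p.dom.map f := by
  cases p <;> rfl
@[simp] theorem cod_map (f : S → T) (p : CPiece S) : (p.map f).cod = p.cod.map f := by
  cases p <;> rfl
@[simp] theorem forget_map (f : S → T) (p : CPiece S) : (p.map f).forget = p.forget := by
  cases p <;> rfl

end CPiece

/-- A slice with a colour on each of its arcs. -/
structure CSlice (S : Type) where
  left : List S
  piece : CPiece S
  right : List S

namespace CSlice

variable {S T : Type}

def dom (s : CSlice S) : List S := s.left ++ s.piece.dom ++ s.right

def cod (s : CSlice S) : List S := s.left ++ s.piece.cod ++ s.right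

def forget (s : CSlice S) : Slice := ⟨s.left.length, s.piece.forget, s.right.length⟩

def map (f : S → T) (s : CSlice S) : CSlice T := ⟨s.left.map f, s.piece.map f, s.right.map f⟩

theorem length_dom (s : CSlice S) : s.dom.length = s.forget.dom := by
  simp [dom, forget, Slice.dom, Nat.add_assoc]

theorem length_cod (s : CSlice S) : s.cod.length = s.forget.cod := by
  simp [cod, forget, Slice.cod, Nat.add_assoc]

@[simp] theorem dom_map (f : S → T) (s : CSlice S) : (s.map f).dom = s.dom.map f := by
  simp [dom, map]

@[simp] theorem cod_map (f : S → T) (s : CSlice S) : (s.map f).cod = s.cod.map f := by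
  simp [cod, map]

@[simp] theorem forget_map (f : S → T) (s : CSlice S) : (s.map f).forget = s.forget := by
  simp [forget, map]

end CSlice

section

variable {S T : Type}

/-- A coloured tangle diagram, with the colours of its ends at the bottom and at the top. -/
def CTangle : List S → List (CSlice S) → List S → Prop
  | x, [], y => x = y
  | x, s :: w, y => s.dom = x ∧ CTangle s.cod w y

@[simp] theorem cTangle_nil {x y : List S} : CTangle x [] y ↔ x = y := Iff.rfl

@[simp] theorem cTangle_cons {x y : List S} {s : CSlice S} {w : List (CSlice S)} :
    CTangle x (s :: w) y ↔ s.dom = x ∧ CTangle s.cod w y := Iff.rfl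

theorem cTangle_append {x y : List S} {u v : List (CSlice S)} :
    CTangle x (u ++ v) y ↔ ∃ z, CTangle x u z ∧ CTangle z v y := by
  induction u generalizing x with
  | nil => simp
  | cons s u ih => simp [ih, and_assoc]

theorem CTangle.append {x y z : List S} {u v : List (CSlice S)} (hu : CTangle x u y)
    (hv : CTangle y v z) : CTangle x (u ++ v) z := cTangle_append.2 ⟨y, hu, hv⟩

theorem CTangle.map (f : S → T) {x y : List S} {w : List (CSlice S)} (h : CTangle x w y) :
    CTangle (x.map f) (w.map (CSlice.map f)) (y.map f) := by
  induction w generalizing x with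
  | nil => simpa using congrArg (List.map f) h
  | cons s w ih =>
    obtain ⟨rfl, h⟩ := h
    exact ⟨by simp, by simpa using ih h⟩

theorem CTangle.forget {x y : List S} {w : List (CSlice S)} (h : CTangle x w y) :
    IsTangle x.length (w.map CSlice.forget) y.length := by
  induction w generalizing x with
  | nil => exact congrArg List.length h
  | cons s w ih =>
    obtain ⟨rfl, h⟩ := h
    exact ⟨s.length_dom.symm, s.length_cod ▸ ih h⟩

/-- The colours on the level `k`. -/
def level : List S → List (CSlice S) → ℕ → List S
  | x, _, 0 => x
  | x, [], _ + 1 => x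
  | _, s :: w, k + 1 => level s.cod w k

@[simp] theorem level_zero (x : List S) (w : List (CSlice S)) : level x w 0 = x := by
  cases w <;> rfl

theorem length_level (x : List S) (w : List (CSlice S)) (k : ℕ) :
    (level x w k).length = widthAt x.length (w.map CSlice.forget) k := by
  induction w generalizing x k with
  | nil => cases k <;> rfl
  | cons s w ih =>
    cases k with
    | zero => rfl
    | succ k => simpa [level, widthAt, s.length_cod] using ih s.cod k

theorem level_map (f : S → T) (x : List S) (w : List (CSlice S)) (k : ℕ) :
    level (x.map f) (w.map (CSlice.map f)) k = (level x w k).map f := by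
  induction w generalizing x k with
  | nil => cases k <;> rfl
  | cons s w ih =>
    cases k with
    | zero => rfl
    | succ k => simpa [level] using ih s.cod k

theorem level_append_left (x : List S) {u v : List (CSlice S)} {k : ℕ} (hk : k ≤ u.length) :
    level x (u ++ v) k = level x u k := by
  induction u generalizing x k with
  | nil => obtain rfl : k = 0 := by simpa using hk
           simp
  | cons s u ih =>
    cases k with
    | zero => rfl
    | succ k => exact ih s.cod (by simpa using hk)

theorem level_append_right {x y : List S} {u v : List (CSlice S)} (h : CTangle x u y) (k : ℕ) :
    level x (u ++ v) (u.length + k) = level y v k := by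
  induction u generalizing x with
  | nil => obtain rfl : x = y := h
           simp
  | cons s u ih => simpa [level, Nat.add_right_comm] using ih h.2

theorem CTangle.level_of_getElem? {x y : List S} {w : List (CSlice S)} (h : CTangle x w y)
    {k : ℕ} {s : CSlice S} (hs : w[k]? = some s) :
    level x w k = s.dom ∧ level x w (k + 1) = s.cod := by
  induction w generalizing x k with
  | nil => simp at hs
  | cons t w ih =>
    cases k with
    | zero =>
      obtain rfl : t = s := by simpa using hs
      exact ⟨h.1.symm, level_zero _ w⟩
    | succ k => exact ih h.2 (by simpa using hs)

/-- The colour of a point of a closed coloured word. -/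
def colour (w : List (CSlice S)) (p : ℕ × ℕ) : Option S := (level [] w p.1)[p.2]?

theorem colour_eq_of_joined {w : List (CSlice S)} (h : CTangle [] w []) {p q : ℕ × ℕ}
    (hj : Joined (w.map CSlice.forget) p q) : colour w p = colour w q := by
  have key : ∀ {k : ℕ} {t : Slice}, (w.map CSlice.forget)[k]? = some t →
      ∃ s : CSlice S, s.forget = t ∧ level [] w k = s.left ++ (s.piece.dom ++ s.right) ∧
        level [] w (k + 1) = s.left ++ (s.piece.cod ++ s.right) := by
    intro k t ht
    simp only [List.getElem?_map, Option.map_eq_some_iff] at ht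
    obtain ⟨s, hs, rfl⟩ := ht
    obtain ⟨h1, h2⟩ := h.level_of_getElem? hs
    exact ⟨s, rfl, by simp [h1, CSlice.dom], by simp [h2, CSlice.cod]⟩
  cases hj with
  | leftStrand k t i ht hi =>
    obtain ⟨s, rfl, h1, h2⟩ := key ht
    have hi' : i < s.left.length := hi
    simp [colour, h1, h2, List.getElem?_append_left hi']
  | rightStrand k t i ht hi =>
    obtain ⟨s, rfl, h1, h2⟩ := key ht
    have e1 : s.forget.left + s.forget.piece.dom + i = s.left.length + (s.piece.dom.length + i) := by
      simp [CSlice.forget, Nat.add_assoc]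
    have e2 : s.forget.left + s.forget.piece.cod + i = s.left.length + (s.piece.cod.length + i) := by
      simp [CSlice.forget, Nat.add_assoc]
    simp only [colour, h1, h2, e1, e2]
    rw [List.getElem?_append_right (by simp), List.getElem?_append_right (by simp),
      List.getElem?_append_right (by simp), List.getElem?_append_right (by simp)]
    simp
  | cup k l r ht =>
    obtain ⟨⟨L, p, R⟩, hs, h1, h2⟩ := key ht
    cases p <;> simp [CSlice.forget] at hs
    obtain ⟨rfl, rfl⟩ := hs
    simp [colour, h2]
  | cap k l r ht =>
    obtain ⟨⟨L, p, R⟩, hs, h1, h2⟩ := key ht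
    cases p <;> simp [CSlice.forget] at hs
    obtain ⟨rfl, rfl⟩ := hs
    simp [colour, h1]
  | crossRising k l r b ht =>
    obtain ⟨⟨L, p, R⟩, hs, h1, h2⟩ := key ht
    cases p <;> simp [CSlice.forget] at hs
    obtain ⟨rfl, rfl, rfl⟩ := hs
    simp [colour, h1, h2]
  | crossFalling k l r b ht =>
    obtain ⟨⟨L, p, R⟩, hs, h1, h2⟩ := key ht
    cases p <;> simp [CSlice.forget] at hs
    obtain ⟨rfl, rfl, rfl⟩ := hs
    simp [colour, h1, h2]

/-- The tied link diagram of a closed coloured word: points of the same colour are tied. -/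
def toMorse (w : List (CSlice S)) (h : CTangle [] w []) (hne : w ≠ []) : MorseDiagram where
  word := w.map CSlice.forget
  closed := h.forget
  nonempty := by simpa using hne
  tied := Setoid.comap (fun p => colour w p.1) ⊥
  tied_of_joined _ _ hj := colour_eq_of_joined h hj

theorem toMorse_tied {w : List (CSlice S)} {h : CTangle [] w []} {hne : w ≠ []}
    (p q : (toMorse w h hne).Pt) : (toMorse w h hne).tied p q ↔ colour w p.1 = colour w q.1 :=
  Iff.rfl

theorem colour_isSome {w : List (CSlice S)} {p : ℕ × ℕ}
    (hp : IsPoint (w.map CSlice.forget) p) : ∃ c, colour w p = some c := by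
  have := hp.2
  have h := length_level ([] : List S) w p.1
  simp only [List.length_nil] at h
  exact ⟨_, List.getElem?_eq_getElem (by omega)⟩

theorem colour_map (f : S → T) (w : List (CSlice S)) (p : ℕ × ℕ) :
    colour (w.map (CSlice.map f)) p = (colour w p).map f := by
  have := level_map f [] w p.1
  simp only [List.map_nil] at this
  simp [colour, this]

/-- All colours of the word satisfy `P`. -/
def ColoursIn (P : S → Prop) (w : List (CSlice S)) : Prop :=
  ∀ s ∈ w, (∀ c ∈ s.dom, P c) ∧ ∀ c ∈ s.cod, P c

theorem ColoursIn.level {P : S → Prop} {w : List (CSlice S)} (h : ColoursIn P w) {x : List S}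
    (hx : ∀ c ∈ x, P c) (k : ℕ) : ∀ c ∈ level x w k, P c := by
  induction w generalizing x k with
  | nil => cases k <;> exact hx
  | cons s w ih =>
    cases k with
    | zero => exact hx
    | succ k =>
      exact ih (fun t ht => h t (List.mem_cons_of_mem _ ht)) (h s List.mem_cons_self).2 k

/-- Only the partition by colours enters the diagram, so a recolouring that is injective on the
colours in use changes nothing. Thereby a word that avoids a colour becomes a word over a smaller
set of colours. -/
theorem toMorse_map (f : S → T) {P : S → Prop} (hf : Set.InjOn f {c | P c})
    {w : List (CSlice S)} (hP : ColoursIn P w) (h : CTangle [] w []) (hne : w ≠ [])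
    (h' : CTangle [] (w.map (CSlice.map f)) []) (hne' : w.map (CSlice.map f) ≠ []) :
    toMorse (w.map (CSlice.map f)) h' hne' = toMorse w h hne := by
  refine ext_of_tied (by simp [toMorse, Function.comp_def]) fun p q p' q' hp hq => ?_
  rw [toMorse_tied, toMorse_tied, colour_map, colour_map, hp, hq]
  obtain ⟨c, hc⟩ := colour_isSome (w := w) p'.2
  obtain ⟨d, hd⟩ := colour_isSome (w := w) q'.2
  have hcP : P c := hP.level (x := []) (by simp) _ c (List.mem_of_getElem? hc)
  have hdP : P d := hP.level (x := []) (by simp) _ d (List.mem_of_getElem? hd)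
  rw [hc, hd]
  simpa using hf.eq_iff hcP hdP

/-- Two diagrams with the same coloured outside. -/
theorem replace_toMorse {x y : List S} {u a b v : List (CSlice S)} (hu : CTangle [] u x)
    (ha : CTangle x a y) (hb : CTangle x b y) (h₁ : CTangle [] (u ++ a ++ v) [])
    (h₂ : CTangle [] (u ++ b ++ v) []) (hne₁ : u ++ a ++ v ≠ []) (hne₂ : u ++ b ++ v ≠ []) :
    Replace (u.map CSlice.forget) (a.map CSlice.forget) (b.map CSlice.forget)
      (v.map CSlice.forget) (toMorse _ h₁ hne₁) (toMorse _ h₂ hne₂) := by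
  refine ⟨by simp [toMorse], by simp [toMorse], fun p q p' q' hp hq => ?_⟩
  have key : ∀ {p p' : ℕ × ℕ}, outside (u.map CSlice.forget).length
      (a.map CSlice.forget).length (b.map CSlice.forget).length p p' →
      colour (u ++ a ++ v) p = colour (u ++ b ++ v) p' := by
    rintro ⟨k, i⟩ p' (⟨hk, rfl⟩ | ⟨k, i, h, rfl⟩)
    · simp only [List.length_map] at hk
      simp only [colour, List.append_assoc, level_append_left _ hk]
    · cases h
      simp only [colour, List.length_map, List.append_assoc, Nat.add_assoc,
        level_append_right hu, level_append_right ha, level_append_right hb]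
  rw [toMorse_tied, toMorse_tied, key hp, key hq]

/-! ### Every diagram is the diagram of a coloured word -/

/-- The piece with colours from its ends. -/
def paintPiece (g g' : ℕ → S) (l : ℕ) : Piece → CPiece S
  | .cup => .cup (g' l)
  | .cap => .cap (g l)
  | .cross b => .cross b (g l) (g (l + 1))

/-- The word coloured by a colouring of its points. -/
def paint : (ℕ → ℕ → S) → List Slice → List (CSlice S)
  | _, [] => []
  | g, s :: w => ⟨(List.range s.left).map (g 0), paintPiece (g 0) (g 1) s.left s.piece,
      (List.range s.right).map fun i => g 0 (s.left + s.piece.dom + i)⟩ ::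
      paint (fun k => g (k + 1)) w

theorem forget_paint (g : ℕ → ℕ → S) (w : List Slice) :
    (paint g w).map CSlice.forget = w := by
  induction w generalizing g with
  | nil => rfl
  | cons s w ih =>
    obtain ⟨l, p, r⟩ := s
    simp only [paint, List.map_cons, ih, List.cons.injEq, and_true]
    cases p <;> simp [CSlice.forget, paintPiece]

theorem map_range_add (f : ℕ → S) (m n : ℕ) :
    (List.range (m + n)).map f =
      (List.range m).map f ++ (List.range n).map fun i => f (m + i) := by
  rw [List.range_add]; simp [Function.comp_def]

/-- Constancy along the arcs makes the colours on top of a painted slice agree with those at the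
bottom of the next one. -/
theorem cTangle_paint {g : ℕ → ℕ → S} {w : List Slice} (hg : Consistent g w) {m n : ℕ}
    (h : IsTangle m w n) :
    CTangle ((List.range m).map (g 0)) (paint g w) ((List.range n).map (g w.length)) := by
  induction w generalizing g m with
  | nil => obtain rfl : m = n := h
           rfl
  | cons s w ih =>
    obtain ⟨rfl, h⟩ := h
    refine ⟨?_, ?_⟩
    · obtain ⟨l, p, r⟩ := s
      cases p with
      | cup => simp [CSlice.dom, Slice.dom, paintPiece, map_range_add, Piece.dom]
      | cap =>
        have := hg _ _ (.cap 0 l r rfl)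
        simp only at this
        simp [CSlice.dom, Slice.dom, paintPiece, map_range_add, Piece.dom, List.range_succ, this]
      | cross b =>
        simp [CSlice.dom, Slice.dom, paintPiece, map_range_add, Piece.dom, List.range_succ]
    · have e : CSlice.cod ⟨(List.range s.left).map (g 0), paintPiece (g 0) (g 1) s.left s.piece,
          (List.range s.right).map fun i => g 0 (s.left + s.piece.dom + i)⟩ =
          (List.range s.cod).map (g 1) := by
        have e1 : (List.range s.left).map (g 0) = (List.range s.left).map (g 1) :=
          List.map_congr_left fun i hi => hg _ _ (.leftStrand 0 s i rfl (by simpa using hi))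
        have e2 : ((List.range s.right).map fun i => g 0 (s.left + s.piece.dom + i)) =
            (List.range s.right).map fun i => g 1 (s.left + s.piece.cod + i) :=
          List.map_congr_left fun i hi => hg _ _ (.rightStrand 0 s i rfl (by simpa using hi))
        rw [e1, e2]
        obtain ⟨l, p, r⟩ := s
        cases p with
        | cup =>
          have := hg _ _ (.cup 0 l r rfl)
          simp only [Nat.zero_add] at this
          simp [CSlice.cod, Slice.cod, paintPiece, map_range_add, Piece.cod, List.range_succ, this]
        | cap => simp [CSlice.cod, Slice.cod, paintPiece, map_range_add, Piece.cod]
        | cross b =>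
          have h1 := hg _ _ (.crossRising 0 l r b rfl)
          have h2 := hg _ _ (.crossFalling 0 l r b rfl)
          simp only [Nat.zero_add] at h1 h2
          simp [CSlice.cod, Slice.cod, paintPiece, map_range_add, Piece.cod, List.range_succ, h1,
            h2]
      rw [e]
      exact ih hg.tail h

theorem level_paint {g : ℕ → ℕ → S} {w : List Slice} (hg : Consistent g w) {m n : ℕ}
    (h : IsTangle m w n) {k : ℕ} (hk : k ≤ w.length) :
    level ((List.range m).map (g 0)) (paint g w) k = (List.range (widthAt m w k)).map (g k) := by
  induction w generalizing g m k with
  | nil => obtain rfl : k = 0 := by simpa using hk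
           simp [widthAt]
  | cons s w ih =>
    cases k with
    | zero => simp [widthAt]
    | succ k =>
      have h1 := (cTangle_paint hg h).2
      have h2 := cTangle_paint hg.tail h.2
      have e : CSlice.cod ⟨(List.range s.left).map (g 0), paintPiece (g 0) (g 1) s.left s.piece,
          (List.range s.right).map fun i => g 0 (s.left + s.piece.dom + i)⟩ =
          (List.range s.cod).map (g 1) := by
        cases w with
        | nil =>
          have := h.2
          obtain rfl : s.cod = n := this
          exact h1
        | cons t w => exact h1.1.symm.trans h2.1
      have := ih hg.tail h.2 (k := k) (by simpa using hk)
      simp only [paint, level, widthAt, e]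
      exact this

/-- The colours are the tie classes themselves; `none` is the colour that `class?` gives to pairs
that are not points. -/
theorem exists_toMorse (D : MorseDiagram) : ∃ (S : Type) (_ : Finite S) (w : List (CSlice S))
    (h : CTangle [] w []) (hne : w ≠ []), toMorse w h hne = D := by
  have hw := forget_paint D.class? D.word
  refine ⟨Option (Quotient D.tied), inferInstance, paint D.class? D.word,
    by simpa using cTangle_paint D.consistent_class? D.closed, fun h => D.nonempty ?_, ?_⟩
  · rw [← hw, h]; rfl
  refine ext_of_tied hw fun p q p' q' hp hq => ?_
  have key : ∀ p : D.Pt,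
      colour (paint D.class? D.word) p.1 = some (some (Quotient.mk _ p)) := by
    intro p
    have hpp : p.1.2 < widthAt 0 D.word p.1.1 := p.2.2
    have := level_paint D.consistent_class? D.closed p.2.1
    simp only [List.range_zero, List.map_nil] at this
    simp only [colour, this, List.getElem?_map, List.getElem?_range hpp, Option.map_some,
      Option.some.injEq]
    simp only [class?]
    rw [dif_pos (show IsPoint D.word (p.1.1, p.1.2) from p.2)]
    rfl
  rw [toMorse_tied, hp, hq, key, key]
  simpa using Quotient.eq (r := D.tied)

end

end TiedLink

namespace TiedLink

open MorseDiagram CPiece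

/-! ### Equivalence of coloured tangles -/

section

variable {S : Type}

/-- The local planar isotopies and the Reidemeister moves II and III of coloured words. -/
inductive CMove : List (CSlice S) → List (CSlice S) → Prop
  | exchange (l m r : List S) (g h : CPiece S) :
      CMove [⟨l, g, m ++ h.dom ++ r⟩, ⟨l ++ g.cod ++ m, h, r⟩]
        [⟨l ++ g.dom ++ m, h, r⟩, ⟨l, g, m ++ h.cod ++ r⟩]
  | zigzagLeft (l r : List S) (c : S) : CMove [⟨l, cup c, c :: r⟩, ⟨l ++ [c], cap c, r⟩] []
  | zigzagRight (l r : List S) (c : S) : CMove [⟨l ++ [c], cup c, r⟩, ⟨l, cap c, c :: r⟩] []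
  | crossCap (l r : List S) (b : Bool) (c d : S) :
      CMove [⟨l ++ [c], cross b d c, r⟩, ⟨l, cap c, d :: r⟩]
        [⟨l, cross (!b) c d, c :: r⟩, ⟨l ++ [d], cap c, r⟩]
  | cupCross (l r : List S) (b : Bool) (c d : S) :
      CMove [⟨l, cup c, d :: r⟩, ⟨l ++ [c], cross b c d, r⟩]
        [⟨l ++ [d], cup c, r⟩, ⟨l, cross (!b) d c, c :: r⟩]
  | two (l r : List S) (b : Bool) (c d : S) :
      CMove [⟨l, cross b c d, r⟩, ⟨l, cross (!b) d c, r⟩] []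
  | three (l r : List S) (b₁₂ b₁₃ b₂₃ : Bool) (c d e : S) : b₁₂ = b₁₃ ∨ b₁₃ = b₂₃ →
      CMove
        [⟨l, cross b₁₂ c d, e :: r⟩, ⟨l ++ [d], cross b₁₃ c e, r⟩, ⟨l, cross b₂₃ d e, c :: r⟩]
        [⟨l ++ [c], cross b₂₃ d e, r⟩, ⟨l, cross b₁₃ c e, d :: r⟩, ⟨l ++ [e], cross b₁₂ c d, r⟩]

theorem CMove.forget {a b : List (CSlice S)} (h : CMove a b) :
    PlanarMove (a.map CSlice.forget) (b.map CSlice.forget) ∨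
      ReidemeisterMove (a.map CSlice.forget) (b.map CSlice.forget) := by
  cases h with
  | exchange l m r g h =>
    left
    simpa [CSlice.forget, Nat.add_assoc] using
      PlanarMove.exchange l.length m.length r.length g.forget h.forget
  | zigzagLeft l r c => left; simpa [CSlice.forget] using .zigzagLeft l.length r.length
  | zigzagRight l r c => left; simpa [CSlice.forget] using .zigzagRight l.length r.length
  | crossCap l r b c d => left; simpa [CSlice.forget] using .crossCap l.length r.length b
  | cupCross l r b c d => left; simpa [CSlice.forget] using .cupCross l.length r.length b
  | two l r b c d => right; simpa [CSlice.forget] using .two l.length r.length b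
  | three l r b₁₂ b₁₃ b₂₃ c d e hb =>
    right; simpa [CSlice.forget] using .three l.length r.length b₁₂ b₁₃ b₂₃ hb

/-- A property of coloured words that is compatible with the moves, and inherited from the
diagrams that the rules of the bracket express a word by. -/
structure Hereditary (P : List (CSlice S) → Prop) : Prop where
  move : ∀ {x y : List S} {u a b v : List (CSlice S)}, CMove a b → CTangle [] u x →
    CTangle x a y → CTangle x b y → CTangle y v [] → (P (u ++ a ++ v) ↔ P (u ++ b ++ v))
  -- Only for different colours, and in both directions: rule (vi) expresses the sum of the two
  -- values by words in which the two colours are merged.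
  change : ∀ {u v : List (CSlice S)} {l r : List S} {c d : S}, c ≠ d →
    CTangle [] u (l ++ [c, d] ++ r) → CTangle (l ++ [d, c] ++ r) v [] →
    (P (u ++ [⟨l, cross true c d, r⟩] ++ v) ↔ P (u ++ [⟨l, cross false c d, r⟩] ++ v))
  smooth : ∀ {u v : List (CSlice S)} {l r : List S} {b : Bool} {c : S},
    CTangle [] u (l ++ [c, c] ++ r) → CTangle (l ++ [c, c] ++ r) v [] → P (u ++ [] ++ v) →
    P (u ++ [⟨l, cap c, r⟩, ⟨l, cup c, r⟩] ++ v) → P (u ++ [⟨l, cross b c c, r⟩] ++ v)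
  circle : ∀ {u v : List (CSlice S)} {l r : List S} {c : S},
    CTangle [] u (l ++ r) → CTangle (l ++ r) v [] → P (u ++ [] ++ v) →
    P (u ++ [⟨l, cup c, r⟩, ⟨l, cap c, r⟩] ++ v)

/-- The word with further strands on both sides. -/
def whisk (l : List S) (w : List (CSlice S)) (r : List S) : List (CSlice S) :=
  w.map fun s => ⟨l ++ s.left, s.piece, s.right ++ r⟩

@[simp] theorem whisk_nil (l r : List S) : whisk l [] r = [] := rfl

@[simp] theorem whisk_cons (l r : List S) (s : CSlice S) (w : List (CSlice S)) :
    whisk l (s :: w) r = ⟨l ++ s.left, s.piece, s.right ++ r⟩ :: whisk l w r := rfl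

@[simp] theorem whisk_append (l r : List S) (u w : List (CSlice S)) :
    whisk l (u ++ w) r = whisk l u r ++ whisk l w r := by simp [whisk]

@[simp] theorem whisk_whisk (l l' r r' : List S) (w : List (CSlice S)) :
    whisk l (whisk l' w r') r = whisk (l ++ l') w (r' ++ r) := by
  simp [whisk, Function.comp_def]

@[simp] theorem whisk_nil_nil (w : List (CSlice S)) : whisk [] w [] = w := by
  simp [whisk]

theorem CTangle.whisk {x y : List S} {w : List (CSlice S)} (h : CTangle x w y) (l r : List S) :
    CTangle (l ++ x ++ r) (whisk l w r) (l ++ y ++ r) := by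
  induction w generalizing x with
  | nil => obtain rfl : x = y := h
           rfl
  | cons s w ih =>
    obtain ⟨rfl, h⟩ := h
    refine ⟨by simp [CSlice.dom], ?_⟩
    simpa [CSlice.cod, TiedLink.whisk] using ih h

theorem CTangle.whiskLeft {x y : List S} {w : List (CSlice S)} (h : CTangle x w y) (l : List S) :
    CTangle (l ++ x) (TiedLink.whisk l w []) (l ++ y) := by
  simpa only [List.append_nil] using h.whisk l []

theorem CTangle.whiskRight {x y : List S} {w : List (CSlice S)} (h : CTangle x w y) (r : List S) :
    CTangle (x ++ r) (TiedLink.whisk [] w r) (y ++ r) := by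
  simpa only [List.nil_append] using h.whisk [] r

/-- The coloured tangles `a` and `b` are interchangeable as far as `P` is concerned. -/
structure Sim (P : List (CSlice S) → Prop) (x y : List S) (a b : List (CSlice S)) : Prop where
  left : CTangle x a y
  right : CTangle x b y
  iff : ∀ {l r : List S} {u v : List (CSlice S)}, CTangle [] u (l ++ x ++ r) →
    CTangle (l ++ y ++ r) v [] → (P (u ++ whisk l a r ++ v) ↔ P (u ++ whisk l b r ++ v))

variable {P : List (CSlice S) → Prop}

namespace Sim

variable {x y z : List S} {a b a' b' : List (CSlice S)}

theorem refl (h : CTangle x a y) : Sim P x y a a := ⟨h, h, fun _ _ => Iff.rfl⟩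

theorem symm (h : Sim P x y a b) : Sim P x y b a :=
  ⟨h.right, h.left, fun hu hv => (h.iff hu hv).symm⟩

theorem trans (h : Sim P x y a b) (h' : Sim P x y b a') : Sim P x y a a' :=
  ⟨h.left, h'.right, fun hu hv => (h.iff hu hv).trans (h'.iff hu hv)⟩

theorem append (h : Sim P x y a b) (h' : Sim P y z a' b') :
    Sim P x z (a ++ a') (b ++ b') := by
  refine ⟨h.left.append h'.left, h.right.append h'.right, fun {l r u v} hu hv => ?_⟩
  have h1 := h.iff (l := l) (r := r) (u := u) (v := TiedLink.whisk l a' r ++ v) hu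
    ((h'.left.whisk l r).append hv)
  have h2 := h'.iff (l := l) (r := r) (u := u ++ TiedLink.whisk l b r) (v := v)
    (hu.append (h.right.whisk l r)) hv
  simp only [whisk_append, List.append_assoc] at h1 h2 ⊢
  exact h1.trans h2

theorem append_left (ha : CTangle x a y) (h' : Sim P y z a' b') :
    Sim P x z (a ++ a') (a ++ b') := (refl ha).append h'

theorem append_right (h : Sim P x y a b) (ha' : CTangle y a' z) :
    Sim P x z (a ++ a') (b ++ a') := h.append (refl ha')

theorem whisk (h : Sim P x y a b) (l r : List S) :
    Sim P (l ++ x ++ r) (l ++ y ++ r) (whisk l a r) (whisk l b r) := by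
  refine ⟨h.left.whisk l r, h.right.whisk l r, fun {l' r' u v} hu hv => ?_⟩
  have := h.iff (l := l' ++ l) (r := r ++ r') (u := u) (v := v) (by simpa using hu)
    (by simpa using hv)
  simpa using this

theorem iff_closed (h : Sim P [] [] a b) : P a ↔ P b := by
  simpa using h.iff (l := []) (r := []) (u := []) (v := []) rfl rfl

variable (hP : Hereditary P)
include hP

theorem of_move (ha : CTangle x a y) (hb : CTangle x b y)
    (h : ∀ l r, CMove (TiedLink.whisk l a r) (TiedLink.whisk l b r)) : Sim P x y a b :=
  ⟨ha, hb, fun {l r _ _} hu hv => hP.move (h l r) hu (ha.whisk l r) (hb.whisk l r) hv⟩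

theorem exchange (m : List S) (g h : CPiece S) :
    Sim P (g.dom ++ m ++ h.dom) (g.cod ++ m ++ h.cod)
      [⟨[], g, m ++ h.dom⟩, ⟨g.cod ++ m, h, []⟩] [⟨g.dom ++ m, h, []⟩, ⟨[], g, m ++ h.cod⟩] :=
  of_move hP (by simp [CSlice.dom, CSlice.cod]) (by simp [CSlice.dom, CSlice.cod])
    fun l r => by simpa using CMove.exchange l m r g h

theorem crossCap (b : Bool) (c d : S) :
    Sim P [c, d, c] [d] [⟨[c], cross b d c, []⟩, ⟨[], cap c, [d]⟩]
      [⟨[], cross (!b) c d, [c]⟩, ⟨[d], cap c, []⟩] :=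
  of_move hP (by simp [CSlice.dom, CSlice.cod]) (by simp [CSlice.dom, CSlice.cod])
    fun l r => by simpa using CMove.crossCap l r b c d

theorem cupCross (b : Bool) (c d : S) :
    Sim P [d] [c, d, c] [⟨[], cup c, [d]⟩, ⟨[c], cross b c d, []⟩]
      [⟨[d], cup c, []⟩, ⟨[], cross (!b) d c, [c]⟩] :=
  of_move hP (by simp [CSlice.dom, CSlice.cod]) (by simp [CSlice.dom, CSlice.cod])
    fun l r => by simpa using CMove.cupCross l r b c d

theorem two (b : Bool) (c d : S) :
    Sim P [c, d] [c, d] [⟨[], cross b c d, []⟩, ⟨[], cross (!b) d c, []⟩] [] :=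
  of_move hP (by simp [CSlice.dom, CSlice.cod]) rfl
    fun l r => by simpa using CMove.two l r b c d

theorem three (b₁₂ b₁₃ b₂₃ : Bool) (c d e : S) (hb : b₁₂ = b₁₃ ∨ b₁₃ = b₂₃) :
    Sim P [c, d, e] [e, d, c]
      [⟨[], cross b₁₂ c d, [e]⟩, ⟨[d], cross b₁₃ c e, []⟩, ⟨[], cross b₂₃ d e, [c]⟩]
      [⟨[c], cross b₂₃ d e, []⟩, ⟨[], cross b₁₃ c e, [d]⟩, ⟨[e], cross b₁₂ c d, []⟩] :=
  of_move hP (by simp [CSlice.dom, CSlice.cod]) (by simp [CSlice.dom, CSlice.cod])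
    fun l r => by simpa using CMove.three l r b₁₂ b₁₃ b₂₃ c d e hb

theorem change (b b' : Bool) {c d : S} (hcd : c ≠ d) :
    Sim P [c, d] [d, c] [⟨[], cross b c d, []⟩] [⟨[], cross b' c d, []⟩] := by
  have key : Sim P [c, d] [d, c] [⟨[], cross true c d, []⟩] [⟨[], cross false c d, []⟩] :=
    ⟨by simp [CSlice.dom, CSlice.cod], by simp [CSlice.dom, CSlice.cod], fun {l r u v} hu hv => by
      simpa using hP.change hcd hu hv⟩
  cases b <;> cases b'
  · exact refl key.right
  · exact key.symm
  · exact key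
  · exact refl key.left

/-- Words side by side commute. -/
theorem interchange {x₁ y₁ x₂ y₂ : List S} {w₁ w₂ : List (CSlice S)} (h₁ : CTangle x₁ w₁ y₁)
    (h₂ : CTangle x₂ w₂ y₂) :
    Sim P (x₁ ++ x₂) (y₁ ++ y₂) (TiedLink.whisk [] w₁ x₂ ++ TiedLink.whisk y₁ w₂ [])
      (TiedLink.whisk x₁ w₂ [] ++ TiedLink.whisk [] w₁ y₂) := by
  -- The exchange of two pieces, with further strands added, exchanges two slices; `row` takes a
  -- slice past a word; the induction on `w₁` takes a word past a word.
  have slice : ∀ s t : CSlice S, Sim P (s.dom ++ t.dom) (s.cod ++ t.cod)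
      (TiedLink.whisk [] [s] t.dom ++ TiedLink.whisk s.cod [t] [])
      (TiedLink.whisk s.dom [t] [] ++ TiedLink.whisk [] [s] t.cod) := by
    rintro ⟨l, g, r⟩ ⟨l', h, r'⟩
    have := (exchange hP (r ++ l') g h).whisk l r'
    simpa [CSlice.dom, CSlice.cod] using this
  have row : ∀ (s : CSlice S) {x y : List S} {w : List (CSlice S)}, CTangle x w y →
      Sim P (s.dom ++ x) (s.cod ++ y)
      (TiedLink.whisk [] [s] x ++ TiedLink.whisk s.cod w [])
      (TiedLink.whisk s.dom w [] ++ TiedLink.whisk [] [s] y) := by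
    intro s x y w hw
    have hs : CTangle s.dom [s] s.cod := ⟨rfl, rfl⟩
    induction w generalizing x with
    | nil =>
      obtain rfl : x = y := hw
      simpa using refl (P := P) (hs.whisk [] x)
    | cons t w ih =>
      obtain ⟨rfl, hw⟩ := hw
      have ht : CTangle t.dom [t] t.cod := ⟨rfl, rfl⟩
      have h1 := (slice s t).append_right (hw.whiskLeft s.cod)
      have h2 := append_left (ht.whiskLeft s.dom) (ih hw)
      simp only [List.append_assoc] at h1 h2
      exact h1.trans h2
  induction w₁ generalizing x₁ with
  | nil =>
    obtain rfl : x₁ = y₁ := h₁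
    simpa using refl (P := P) (h₂.whisk x₁ [])
  | cons s w ih =>
    obtain ⟨rfl, h₁⟩ := h₁
    have hs : CTangle s.dom [s] s.cod := ⟨rfl, rfl⟩
    have h1 := append_left (hs.whiskRight x₂) (ih h₁)
    have h2 := (row s h₂).append_right (h₁.whiskRight y₂)
    simp only [List.append_assoc] at h1 h2
    exact h1.trans h2

end Sim

end

end TiedLink

namespace TiedLink

open MorseDiagram CPiece

/-! ### Separation of a colour from the others -/

section

variable {S : Type} {P : List (CSlice S) → Prop}

/-- A strand of colour `c` passes over the strands `y` from the left to the right. -/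
def pass (c : S) : List S → List (CSlice S)
  | [] => []
  | d :: y => ⟨[], cross true c d, y⟩ :: whisk [d] (pass c y) []

theorem cTangle_pass (c : S) (y : List S) : CTangle (c :: y) (pass c y) (y ++ [c]) := by
  induction y with
  | nil => rfl
  | cons d y ih => exact ⟨rfl, ih.whiskLeft [d]⟩

theorem pass_append (c : S) (y z : List S) :
    pass c (y ++ z) = whisk [] (pass c y) z ++ whisk y (pass c z) [] := by
  induction y with
  | nil => simp [pass]
  | cons d y ih => simp [pass, ih]

namespace Sim

variable (hP : Hereditary P)
include hP

/-- An over-strand crosses a minimum or a maximum by sliding one of its crossings through the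
turning point and cancelling by move II. It crosses a crossing by move III, which is allowed since
it lies above both other strands. -/
theorem pass_piece (c : S) (p : CPiece S) :
    Sim P (c :: p.dom) (p.cod ++ [c]) ([⟨[c], p, []⟩] ++ pass c p.cod)
      (pass c p.dom ++ [⟨[], p, [c]⟩]) := by
  cases p with
  | cup d =>
    have h1 := ((cupCross hP false d c).symm).append_right (a' := [⟨[d], cross true c d, []⟩])
      (z := [d, d, c]) (by simp [CSlice.dom, CSlice.cod])
    have h2 := append_left (P := P) (x := [c]) (a := [⟨[], cup d, [c]⟩])
      (by simp [CSlice.dom, CSlice.cod]) ((two hP false d c).whisk [d] [])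
    simpa [pass] using h1.trans (by simpa using h2)
  | cap d =>
    have h1 := append_left (P := P) (x := [c, d, d]) (a := [⟨[], cross true c d, [d]⟩])
      (by simp [CSlice.dom, CSlice.cod]) (crossCap hP true d c)
    have h2 := ((two hP true c d).whisk [] [d]).append_right (a' := [⟨[c], cap d, []⟩])
      (z := [c]) (by simp [CSlice.dom, CSlice.cod])
    have := h1.trans (by simpa using h2)
    simpa [pass] using this.symm
  | cross b d e =>
    simpa [pass] using (three hP true true b c d e (.inl rfl)).symm

/-- The strand passes the left strands, the piece and the right strands in turn. Beside the piece
this is an interchange of words lying side by side. -/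
theorem pass_slice (c : S) (s : CSlice S) :
    Sim P (c :: s.dom) (s.cod ++ [c]) (TiedLink.whisk [c] [s] [] ++ pass c s.cod)
      (pass c s.dom ++ TiedLink.whisk [] [s] [c]) := by
  obtain ⟨l, p, r⟩ := s
  have t1 : CTangle (p.dom ++ r) [⟨[], p, r⟩] (p.cod ++ r) := by
    simp [CSlice.dom, CSlice.cod]
  have t2 : CTangle (l ++ p.dom) [⟨l, p, []⟩] (l ++ p.cod) := by
    simp [CSlice.dom, CSlice.cod]
  have h1 := (interchange hP (cTangle_pass c l) t1).symm
  have h2 := (pass_piece hP c p).whisk l r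
  have h3 := interchange hP t2 (cTangle_pass c r)
  have k1 := h1.append_right (a' := TiedLink.whisk l (pass c p.cod) r ++
    TiedLink.whisk (l ++ p.cod) (pass c r) []) (z := l ++ p.cod ++ r ++ [c]) (by
      refine CTangle.append (y := l ++ p.cod ++ [c] ++ r) ?_ ?_
      · simpa using (cTangle_pass c p.cod).whisk l r
      · simpa using (cTangle_pass c r).whiskLeft (l ++ p.cod))
  have k2 := (h2.append_right (a' := TiedLink.whisk (l ++ p.cod) (pass c r) [])
    (z := l ++ p.cod ++ r ++ [c]) (by
      simpa using (cTangle_pass c r).whiskLeft (l ++ p.cod)))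
  have k2' := append_left (P := P) (x := c :: l ++ p.dom ++ r)
    (a := TiedLink.whisk [] (pass c l) (p.dom ++ r))
    (by simpa using (cTangle_pass c l).whiskRight (p.dom ++ r)) (by simpa using k2)
  have k3 := append_left (P := P) (x := c :: l ++ p.dom ++ r)
    (a := TiedLink.whisk [] (pass c l) (p.dom ++ r) ++ TiedLink.whisk l (pass c p.dom) r)
    (by
      refine CTangle.append (y := l ++ [c] ++ p.dom ++ r) (z := l ++ p.dom ++ [c] ++ r) ?_ ?_
      · simpa using (cTangle_pass c l).whiskRight (p.dom ++ r)
      · simpa using (cTangle_pass c p.dom).whisk l r) (by simpa using h3)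
  have := (k1.trans (by simpa using k2')).trans (by simpa using k3)
  simpa [CSlice.dom, CSlice.cod, pass_append] using this

theorem pass_word (c : S) {x y : List S} {w : List (CSlice S)} (hw : CTangle x w y) :
    Sim P (c :: x) (y ++ [c]) (TiedLink.whisk [c] w [] ++ pass c y)
      (pass c x ++ TiedLink.whisk [] w [c]) := by
  induction w generalizing x with
  | nil =>
    obtain rfl : x = y := hw
    simpa using refl (P := P) (cTangle_pass c x)
  | cons s w ih =>
    obtain ⟨rfl, hw⟩ := hw
    have hs : CTangle s.dom [s] s.cod := ⟨rfl, rfl⟩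
    have h1 := append_left (hs.whiskLeft [c]) (ih hw)
    have h2 := (pass_slice hP c s).append_right (hw.whiskRight [c])
    simp only [List.append_assoc] at h1 h2
    exact h1.trans h2

/-- Pulling both legs of a minimum over `y` amounts to creating the minimum beyond `y`. For a single
strand, one crossing slides through the minimum and then cancels the other by move II. -/
theorem cup_pass (c : S) (y : List S) :
    Sim P y (y ++ [c, c]) ([⟨[], cup c, y⟩] ++ TiedLink.whisk [c] (pass c y) [] ++
      TiedLink.whisk [] (pass c y) [c]) [⟨y, cup c, []⟩] := by
  induction y with
  | nil => simpa [pass] using refl (P := P) (by simp [CSlice.dom, CSlice.cod])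
  | cons d y ih =>
    have core : Sim P [d] [d, c, c] [⟨[], cup c, [d]⟩, ⟨[c], cross true c d, []⟩,
        ⟨[], cross true c d, [c]⟩] [⟨[d], cup c, []⟩] := by
      have h1 := (cupCross hP true c d).append_right (a' := [⟨[], cross true c d, [c]⟩])
        (z := [d, c, c]) (by simp [CSlice.dom, CSlice.cod])
      have h2 := append_left (P := P) (x := [d]) (a := [⟨[d], cup c, []⟩])
        (by simp [CSlice.dom, CSlice.cod]) ((two hP false d c).whisk [] [c])
      exact h1.trans (by simpa using h2)
    have t : CTangle [c, d] [⟨[], cross true c d, []⟩] [d, c] := by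
      simp [CSlice.dom, CSlice.cod]
    have h1 := append_left (P := P) (x := d :: y)
      (a := [⟨[], cup c, d :: y⟩, ⟨[c], cross true c d, y⟩])
      (by simp [CSlice.dom, CSlice.cod]) (interchange hP t (cTangle_pass c y)).symm
    have tp : CTangle (d :: c :: y ++ [c]) (TiedLink.whisk [d] (pass c y) [c])
      (d :: y ++ [c, c]) := by simpa using (cTangle_pass c y).whisk [d] [c]
    have h1' := h1.append_right (by simpa using tp)
    have h2 := (core.whisk [] y).append_right (a' := TiedLink.whisk [d, c] (pass c y) [] ++
      TiedLink.whisk [d] (pass c y) [c]) (z := d :: y ++ [c, c]) (by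
        refine CTangle.append (y := d :: c :: y ++ [c]) ?_ tp
        simpa using (cTangle_pass c y).whiskLeft [d, c])
    have h3 := ih.whisk [d] []
    have h12 := h1'.trans (by simpa using h2)
    have := h12.trans (by simpa using h3)
    simpa [pass] using this

/-- The picture of `cup_pass` upside down: a maximum may be formed before its legs pass over `y`. -/
theorem cap_pass (c : S) (y : List S) :
    Sim P (c :: c :: y) y (TiedLink.whisk [c] (pass c y) [] ++ TiedLink.whisk [] (pass c y) [c] ++
      [⟨y, cap c, []⟩]) [⟨[], cap c, y⟩] := by
  induction y with
  | nil => simpa [pass] using refl (P := P) (by simp [CSlice.dom, CSlice.cod])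
  | cons d y ih =>
    have core : Sim P [c, c, d] [d] [⟨[c], cross true c d, []⟩, ⟨[], cross true c d, [c]⟩,
        ⟨[d], cap c, []⟩] [⟨[], cap c, [d]⟩] := by
      have h1 := append_left (P := P) (x := [c, c, d]) (a := [⟨[c], cross true c d, []⟩])
        (by simp [CSlice.dom, CSlice.cod]) (crossCap hP false c d).symm
      have h2 := ((two hP true c d).whisk [c] []).append_right (a' := [⟨[], cap c, [d]⟩])
        (z := [d]) (by simp [CSlice.dom, CSlice.cod])
      exact h1.trans (by simpa using h2)
    have t : CTangle [c, d] [⟨[], cross true c d, []⟩] [d, c] := by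
      simp [CSlice.dom, CSlice.cod]
    have h1 := append_left (P := P) (x := c :: c :: d :: y)
      (a := [⟨[c], cross true c d, y⟩])
      (by simp [CSlice.dom, CSlice.cod]) (interchange hP t (cTangle_pass c y)).symm
    have tp : CTangle (d :: c :: y ++ [c]) (TiedLink.whisk [d] (pass c y) [c])
      (d :: y ++ [c, c]) := by simpa using (cTangle_pass c y).whisk [d] [c]
    have tc : CTangle (d :: y ++ [c, c]) [⟨d :: y, cap c, []⟩] (d :: y) := by
      simp [CSlice.dom, CSlice.cod]
    have h1' := h1.append_right (by simpa using tp.append tc)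
    have h2 := append_left (P := P) (x := c :: c :: d :: y) (y := d :: c :: c :: y)
      (a := [⟨[c], cross true c d, y⟩, ⟨[], cross true c d, c :: y⟩])
      (by simp [CSlice.dom, CSlice.cod]) (by simpa using ih.whisk [d] [])
    have h3 := core.whisk [] y
    have h12 := h1'.trans (by simpa using h2)
    have := h12.trans (by simpa using h3)
    simpa [pass] using this

end Sim

/-! ### Sorting the strands of levels and slices into one colour and the rest. -/

variable [DecidableEq S]

/-- The colours different from `c`. -/
def off (c : S) (x : List S) : List S := x.filter (· ≠ c)

/-- The colours equal to `c`. -/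
def on (c : S) (x : List S) : List S := x.filter (· = c)

section

variable {c d : S}

@[simp] theorem off_nil : off c [] = [] := rfl
@[simp] theorem on_nil : on c [] = [] := rfl
@[simp] theorem off_append (x y : List S) : off c (x ++ y) = off c x ++ off c y := by simp [off]
@[simp] theorem on_append (x y : List S) : on c (x ++ y) = on c x ++ on c y := by simp [on]
@[simp] theorem off_cons_self (x : List S) : off c (c :: x) = off c x := by simp [off]
@[simp] theorem on_cons_self (x : List S) : on c (c :: x) = c :: on c x := by simp [on]
theorem off_cons_of_ne (h : d ≠ c) (x : List S) : off c (d :: x) = d :: off c x := by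
  simp [off, h]
theorem on_cons_of_ne (h : d ≠ c) (x : List S) : on c (d :: x) = on c x := by
  simp [on, h]
theorem mem_off {x : List S} : d ∈ off c x ↔ d ∈ x ∧ d ≠ c := by simp [off]
end

/-- The strands of colour `c` pass over the others to the right. -/
def shuffle (c : S) : List S → List (CSlice S)
  | [] => []
  | a :: x => whisk [a] (shuffle c x) [] ++
      if a = c then whisk [] (pass c (off c x)) (on c x) else []

theorem shuffle_cons_self (c : S) (x : List S) : shuffle c (c :: x) =
    whisk [c] (shuffle c x) [] ++ whisk [] (pass c (off c x)) (on c x) := by simp [shuffle]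

theorem shuffle_cons_of_ne {c d : S} (h : d ≠ c) (x : List S) :
    shuffle c (d :: x) = whisk [d] (shuffle c x) [] := by simp [shuffle, h]

theorem cTangle_shuffle (c : S) (x : List S) :
    CTangle x (shuffle c x) (off c x ++ on c x) := by
  induction x with
  | nil => rfl
  | cons a x ih =>
    by_cases h : a = c
    · subst h
      rw [shuffle_cons_self]
      refine (ih.whiskLeft [a]).append ?_
      simpa using (cTangle_pass a (off a x)).whiskRight (on a x)
    · rw [shuffle_cons_of_ne h, off_cons_of_ne h, on_cons_of_ne h]
      exact ih.whiskLeft [a]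

/-- The part of a slice in the colours different from `c`. -/
def offSlice (c : S) : CSlice S → List (CSlice S)
  | ⟨l, cup d, r⟩ => if d = c then [] else [⟨off c l, cup d, off c r⟩]
  | ⟨l, cap d, r⟩ => if d = c then [] else [⟨off c l, cap d, off c r⟩]
  | ⟨l, cross b d e, r⟩ =>
    if d = c then [] else if e = c then [] else [⟨off c l, cross b d e, off c r⟩]

/-- The part of a slice in the colour `c`. -/
def onSlice (c : S) : CSlice S → List (CSlice S)
  | ⟨l, cup d, r⟩ => if d = c then [⟨on c l, cup c, on c r⟩] else []
  | ⟨l, cap d, r⟩ => if d = c then [⟨on c l, cap c, on c r⟩] else []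
  | ⟨_, cross _ _ _, _⟩ => []

theorem cTangle_offSlice (c : S) (s : CSlice S) :
    CTangle (off c s.dom) (offSlice c s) (off c s.cod) := by
  obtain ⟨l, p, r⟩ := s
  cases p with
  | cup d =>
    by_cases h : d = c
    · subst h; simp [offSlice, CSlice.dom, CSlice.cod]
    · simp [offSlice, CSlice.dom, CSlice.cod, h, off_cons_of_ne]
  | cap d =>
    by_cases h : d = c
    · subst h; simp [offSlice, CSlice.dom, CSlice.cod]
    · simp [offSlice, CSlice.dom, CSlice.cod, h, off_cons_of_ne]
  | cross b d e =>
    by_cases h : d = c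
    · subst h
      by_cases h' : e = d
      · subst h'; simp [offSlice, CSlice.dom, CSlice.cod]
      · simp [offSlice, CSlice.dom, CSlice.cod, h', off_cons_of_ne]
    · by_cases h' : e = c
      · subst h'; simp [offSlice, CSlice.dom, CSlice.cod, h, off_cons_of_ne]
      · simp [offSlice, CSlice.dom, CSlice.cod, h, h', off_cons_of_ne]

theorem cTangle_onSlice (c : S) (s : CSlice S) :
    CTangle (on c s.dom) (onSlice c s) (on c s.cod) := by
  obtain ⟨l, p, r⟩ := s
  cases p with
  | cup d =>
    by_cases h : d = c
    · subst h; simp [onSlice, CSlice.dom, CSlice.cod]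
    · simp [onSlice, CSlice.dom, CSlice.cod, h, on_cons_of_ne]
  | cap d =>
    by_cases h : d = c
    · subst h; simp [onSlice, CSlice.dom, CSlice.cod]
    · simp [onSlice, CSlice.dom, CSlice.cod, h, on_cons_of_ne]
  | cross b d e =>
    by_cases h : d = c
    · subst h
      by_cases h' : e = d
      · subst h'; simp [onSlice, CSlice.dom, CSlice.cod]
      · simp [onSlice, CSlice.dom, CSlice.cod, h', on_cons_of_ne]
    · by_cases h' : e = c
      · subst h'; simp [onSlice, CSlice.dom, CSlice.cod, h, on_cons_of_ne]
      · simp [onSlice, CSlice.dom, CSlice.cod, h, h', on_cons_of_ne]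

theorem offSlice_cons_of_ne {a c : S} (h : a ≠ c) (l r : List S) (p : CPiece S) :
    offSlice c ⟨a :: l, p, r⟩ = whisk [a] (offSlice c ⟨l, p, r⟩) [] := by
  cases p <;> simp only [offSlice, off_cons_of_ne h] <;> split_ifs <;> simp

theorem offSlice_cons_self (c : S) (l r : List S) (p : CPiece S) :
    offSlice c ⟨c :: l, p, r⟩ = offSlice c ⟨l, p, r⟩ := by
  cases p <;> simp [offSlice]

theorem onSlice_cons_of_ne {a c : S} (h : a ≠ c) (l r : List S) (p : CPiece S) :
    onSlice c ⟨a :: l, p, r⟩ = onSlice c ⟨l, p, r⟩ := by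
  cases p <;> simp [onSlice, on_cons_of_ne h]

theorem onSlice_cons_self (c : S) (l r : List S) (p : CPiece S) :
    onSlice c ⟨c :: l, p, r⟩ = whisk [c] (onSlice c ⟨l, p, r⟩) [] := by
  cases p <;> simp only [onSlice, on_cons_self] <;> try split_ifs
  all_goals simp

/-- The slice with the colour `c` separated from the others. -/
def sepSlice (c : S) (s : CSlice S) : List (CSlice S) :=
  whisk [] (offSlice c s) (on c s.dom) ++ whisk (off c s.cod) (onSlice c s) []

namespace Sim

variable (hP : Hereditary P)
include hP

/-- A minimum or maximum of colour `c` is treated by `cup_pass` or `cap_pass`. At a crossing of `c`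
with another colour, `change` first puts `c` on top; the crossing is then absorbed by the shuffle or
cancelled against it. A crossing of `c` with itself has no counterpart in `sepSlice` and has to be
excluded. -/
theorem shuffle_slice_base (c : S) (p : CPiece S) (r : List S) (hp : ∀ b, p ≠ cross b c c) :
    Sim P (p.dom ++ r) (off c (p.cod ++ r) ++ on c (p.cod ++ r))
      ([⟨[], p, r⟩] ++ shuffle c (p.cod ++ r))
      (shuffle c (p.dom ++ r) ++ sepSlice c ⟨[], p, r⟩) := by
  have t : CTangle p.dom [⟨[], p, []⟩] p.cod := by simp [CSlice.dom, CSlice.cod]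
  have h0 := interchange hP t (cTangle_shuffle c r)
  have tp := fun x z : List S => (cTangle_pass c x).whiskRight z
  cases p with
  | cup d =>
    by_cases h : d = c
    · subst h
      have h1 := h0.append_right (a' := TiedLink.whisk [d] (TiedLink.whisk [] (pass d (off d r))
          (on d r)) [] ++ TiedLink.whisk [] (pass d (off d r)) (d :: on d r))
          (z := off d r ++ d :: d :: on d r) (by
        refine CTangle.append (y := d :: off d r ++ d :: on d r) ?_ ?_
        · simpa using (cTangle_pass d (off d r)).whisk [d] (on d r)
        · simpa using tp (off d r) (d :: on d r))
      have h2 := append_left (cTangle_shuffle d r) ((cup_pass hP d (off d r)).whisk [] (on d r))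
      have := h1.trans (by simpa using h2)
      simpa [shuffle_cons_self, sepSlice, offSlice, onSlice, CSlice.dom, CSlice.cod] using this
    · simpa [shuffle_cons_of_ne h, sepSlice, offSlice, onSlice, CSlice.dom, CSlice.cod, h,
        off_cons_of_ne, on_cons_of_ne] using h0
  | cap d =>
    by_cases h : d = c
    · subst h
      have h2 := append_left (P := P) (by simpa using (cTangle_shuffle d r).whiskLeft [d, d])
        ((cap_pass hP d (off d r)).whisk [] (on d r)).symm
      have := h0.trans (by simpa using h2)
      simpa [shuffle_cons_self, sepSlice, offSlice, onSlice, CSlice.dom, CSlice.cod] using this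
    · simpa [shuffle_cons_of_ne h, sepSlice, offSlice, onSlice, CSlice.dom, CSlice.cod, h,
        off_cons_of_ne, on_cons_of_ne] using h0
  | cross b d e =>
    by_cases h : d = c
    · subst h
      have h' : e ≠ d := fun h' => hp b (by rw [h'])
      have tx : CTangle (e :: d :: off d r ++ on d r)
          (TiedLink.whisk [e] (TiedLink.whisk [] (pass d (off d r)) (on d r)) [])
          (e :: off d r ++ d :: on d r) := by
        simpa using (cTangle_pass d (off d r)).whisk [e] (on d r)
      have h1 := h0.append_right (by simpa using tx)
      have h2 := append_left (P := P) (by simpa using (cTangle_shuffle d r).whiskLeft [d, e])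
        (((change hP b true h'.symm).whisk [] (off d r ++ on d r)).append_right
          (by simpa using tx))
      have := h1.trans (by simpa using h2)
      simpa [shuffle_cons_self, shuffle_cons_of_ne h', sepSlice, offSlice, onSlice, CSlice.dom,
        CSlice.cod, off_cons_of_ne h', on_cons_of_ne h', pass] using this
    · by_cases h' : e = c
      · subst h'
        have tx : CTangle (d :: e :: off e r ++ on e r)
            (TiedLink.whisk [d] (TiedLink.whisk [] (pass e (off e r)) (on e r)) [])
            (d :: off e r ++ e :: on e r) := by
          simpa using (cTangle_pass e (off e r)).whisk [d] (on e r)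
        -- In `cross false` the over-strand starts at the bottom right, which here puts the
        -- separated colour `e` on top; its passage back over `d` then cancels by move II.
        have k : Sim P [d, e] [d, e] [⟨[], cross b d e, []⟩, ⟨[], cross true e d, []⟩] [] := by
          have := (change hP b false h).append_right (a' := [⟨[], cross true e d, []⟩])
            (z := [d, e]) (by simp [CSlice.dom, CSlice.cod])
          exact this.trans (two hP false d e)
        have h1 := h0.append_right (a' := ⟨[], cross true e d, off e r ++ on e r⟩ ::
          TiedLink.whisk [d] (TiedLink.whisk [] (pass e (off e r)) (on e r)) [])
          (z := d :: off e r ++ e :: on e r) (by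
            simpa [CSlice.dom, CSlice.cod] using tx)
        have h2 := append_left (P := P) (by simpa using (cTangle_shuffle e r).whiskLeft [d, e])
          ((k.whisk [] (off e r ++ on e r)).append_right (by simpa using tx))
        have := h1.trans (by simpa using h2)
        simpa [shuffle_cons_self, shuffle_cons_of_ne h, sepSlice, offSlice, onSlice, CSlice.dom,
          CSlice.cod, off_cons_of_ne h, on_cons_of_ne h, pass, h] using this
      · simpa [shuffle_cons_of_ne h, shuffle_cons_of_ne h', sepSlice, offSlice, onSlice,
          CSlice.dom, CSlice.cod, h, h', off_cons_of_ne, on_cons_of_ne] using h0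

/-- Induction on the strands to the left. A new leftmost strand of another colour is a spectator.
One of colour `c` has to be taken over the off-part of the slice, by `pass_word`, and past its
on-part, by `interchange`. -/
theorem shuffle_slice (c : S) (s : CSlice S) (hs : ∀ b, s.piece ≠ cross b c c) :
    Sim P s.dom (off c s.cod ++ on c s.cod) ([s] ++ shuffle c s.cod)
      (shuffle c s.dom ++ sepSlice c s) := by
  obtain ⟨l, p, r⟩ := s
  induction l with
  | nil => simpa [CSlice.dom, CSlice.cod] using shuffle_slice_base hP c p r hs
  | cons a l ih =>
    replace ih := ih hs
    have ed : CSlice.dom ⟨a :: l, p, r⟩ = a :: CSlice.dom ⟨l, p, r⟩ := rfl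
    have ec : CSlice.cod ⟨a :: l, p, r⟩ = a :: CSlice.cod ⟨l, p, r⟩ := rfl
    have ew : [⟨a :: l, p, r⟩] = TiedLink.whisk [a] [⟨l, p, r⟩] [] := by simp
    have hO := cTangle_offSlice c ⟨l, p, r⟩
    have hN := cTangle_onSlice c ⟨l, p, r⟩
    have hd := cTangle_shuffle c (CSlice.dom ⟨l, p, r⟩)
    by_cases h : a = c
    · subst h
      have h1 := (ih.whisk [a] []).append_right
        (a' := TiedLink.whisk [] (pass a (off a (CSlice.cod ⟨l, p, r⟩)))
          (on a (CSlice.cod ⟨l, p, r⟩)))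
        (by simpa using (cTangle_pass a _).whiskRight _)
      rw [ed, ec, ew, shuffle_cons_self, shuffle_cons_self, sepSlice, ed, ec, offSlice_cons_self,
        onSlice_cons_self, off_cons_self, on_cons_self, on_cons_self]
      rw [sepSlice] at h1
      generalize offSlice a ⟨l, p, r⟩ = O at *
      generalize onSlice a ⟨l, p, r⟩ = N at *
      generalize CSlice.dom ⟨l, p, r⟩ = x at *
      generalize CSlice.cod ⟨l, p, r⟩ = y at *
      have h2 := append_left (P := P) (a := TiedLink.whisk [a] (shuffle a x) [] ++
        TiedLink.whisk [a] O (on a x)) ((hd.whiskLeft [a]).append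
          (by simpa using hO.whisk [a] (on a x)))
        (by simpa using (interchange hP (cTangle_pass a (off a y)) hN).symm)
      have h3 := append_left (P := P) (a := TiedLink.whisk [a] (shuffle a x) [])
        (hd.whiskLeft [a])
        (((pass_word hP a hO).whisk [] (on a x)).append_right
          (by simpa using hN.whiskLeft (off a y ++ [a])))
      have h12 := h1.trans (by simpa using h2)
      have := h12.trans (by simpa using h3)
      simpa using this
    · have h1 := ih.whisk [a] []
      rw [ed, ec, ew, shuffle_cons_of_ne h, shuffle_cons_of_ne h, sepSlice, ed, ec,
        offSlice_cons_of_ne h, onSlice_cons_of_ne h, off_cons_of_ne h, on_cons_of_ne h,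
        on_cons_of_ne h]
      simpa [sepSlice] using h1

/-- For a closed word both shuffles are empty, so the word becomes its off-part followed by its
on-part, two closed words without crossings between them. -/
theorem shuffle_word (c : S) {x y : List S} {w : List (CSlice S)} (hw : CTangle x w y)
    (hc : ∀ s ∈ w, ∀ b, s.piece ≠ cross b c c) :
    CTangle (off c x) (w.flatMap (offSlice c)) (off c y) ∧
    CTangle (on c x) (w.flatMap (onSlice c)) (on c y) ∧
    Sim P x (off c y ++ on c y) (w ++ shuffle c y)
      (shuffle c x ++ (TiedLink.whisk [] (w.flatMap (offSlice c)) (on c x) ++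
        TiedLink.whisk (off c y) (w.flatMap (onSlice c)) [])) := by
  induction w generalizing x with
  | nil =>
    obtain rfl : x = y := hw
    exact ⟨rfl, rfl, by simpa using refl (P := P) (cTangle_shuffle c x)⟩
  | cons s w ih =>
    obtain ⟨rfl, hw⟩ := hw
    obtain ⟨i1, i2, i3⟩ := ih hw fun t ht => hc t (List.mem_cons_of_mem _ ht)
    have hO := cTangle_offSlice c s
    have hN := cTangle_onSlice c s
    have hs : CTangle s.dom [s] s.cod := ⟨rfl, rfl⟩
    refine ⟨hO.append i1, hN.append i2, ?_⟩
    have h1 := append_left hs i3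
    have h2 := (shuffle_slice hP c s (hc s List.mem_cons_self)).append_right
      ((i1.whiskRight (on c s.cod)).append (i2.whiskLeft (off c y)))
    have h3 := append_left (P := P) (cTangle_shuffle c s.dom) (append_left
      (hO.whiskRight (on c s.dom)) ((interchange hP i1 hN).symm.append_right
        (i2.whiskLeft (off c y))))
    have h12 := h1.trans (by simpa using h2)
    have := h12.trans (by simpa [sepSlice] using h3)
    simpa using this

end Sim

end

end TiedLink

namespace TiedLink

open MorseDiagram CPiece

/-! ### Removal of a colour -/

section

variable {S : Type} {P : List (CSlice S) → Prop}

/-- The slice is a minimum. -/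
def CSlice.IsCup (s : CSlice S) : Prop := ∃ c, s.piece = cup c

/-- The slice is a maximum. -/
def CSlice.IsCap (s : CSlice S) : Prop := ∃ c, s.piece = cap c

/-- The pair of ends of a minimum and the pair that the next maximum closes coincide, share one
strand on either side, or are disjoint in one of two orders. The five cases yield a circle, the two
zigzags and two exchanges of heights. -/
theorem append_cons_cons_cases {l r l' r' : List S} {d e : S}
    (h : l ++ d :: d :: r = l' ++ e :: e :: r') :
    (l' = l ∧ e = d ∧ r' = r) ∨ (l' = l ++ [d] ∧ e = d ∧ r = d :: r') ∨
      (l = l' ++ [d] ∧ e = d ∧ r' = d :: r) ∨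
      (∃ m, l' = l ++ d :: d :: m ∧ r = m ++ e :: e :: r') ∨
      ∃ m, l = l' ++ e :: e :: m ∧ r' = m ++ d :: d :: r := by
  rcases List.append_eq_append_iff.1 h with ⟨a, rfl, h2⟩ | ⟨a, rfl, h2⟩
  · rcases a with _ | ⟨x, _ | ⟨y, m⟩⟩
    · simp only [List.nil_append, List.cons.injEq] at h2
      obtain ⟨rfl, -, rfl⟩ := h2
      simp
    · simp only [List.cons_append, List.nil_append, List.cons.injEq] at h2
      obtain ⟨rfl, rfl, rfl⟩ := h2
      simp
    · simp only [List.cons_append, List.cons.injEq] at h2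
      obtain ⟨rfl, rfl, rfl⟩ := h2
      exact .inr (.inr (.inr (.inl ⟨m, rfl, rfl⟩)))
  · rcases a with _ | ⟨x, _ | ⟨y, m⟩⟩
    · simp only [List.nil_append, List.cons.injEq] at h2
      obtain ⟨rfl, -, rfl⟩ := h2
      simp
    · simp only [List.cons_append, List.nil_append, List.cons.injEq] at h2
      obtain ⟨rfl, rfl, rfl⟩ := h2
      simp
    · simp only [List.cons_append, List.cons.injEq] at h2
      obtain ⟨rfl, rfl, rfl⟩ := h2
      exact .inr (.inr (.inr (.inr ⟨m, rfl, rfl⟩)))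

namespace Hereditary

variable (hP : Hereditary P)
include hP

/-- The first maximum `t` is pushed down through the minima `q` until it meets one with which it
shares a strand. Then a circle or a zigzag disappears, and `ih` applies to a word with two slices
fewer. The meeting must occur, since at the very bottom there is no strand to close. -/
theorem cups_cap {u : List (CSlice S)} (hu : CTangle [] u []) (n : ℕ)
    (ih : ∀ w : List (CSlice S), w.length < n → CTangle [] w [] →
      (∀ s ∈ w, s.IsCup ∨ s.IsCap) → P (u ++ w))
    (q : List (CSlice S)) (hq : ∀ s ∈ q, s.IsCup) (t : CSlice S) (ht : t.IsCap)
    (v : List (CSlice S)) (hv : ∀ s ∈ v, s.IsCup ∨ s.IsCap)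
    (hw : CTangle [] (q ++ t :: v) []) (hn : (q ++ t :: v).length = n) :
    P (u ++ (q ++ t :: v)) := by
  induction q using List.reverseRecOn generalizing t v with
  | nil =>
    obtain ⟨l, p, r⟩ := t
    obtain ⟨e, rfl⟩ := ht
    simp [CSlice.dom] at hw
  | append_singleton q s ihq =>
    have hq' : ∀ s ∈ q, s.IsCup := fun x hx => hq x (by simp [hx])
    have hcup : ∀ x ∈ q, x.IsCup ∨ x.IsCap := fun x hx => .inl (hq' x hx)
    obtain ⟨l, p, r⟩ := s
    obtain ⟨d, rfl⟩ : ∃ d, p = cup d := hq ⟨l, p, r⟩ (by simp)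
    obtain ⟨l', p', r'⟩ := t
    obtain ⟨e, rfl⟩ := ht
    obtain ⟨z, hqz, hz⟩ := cTangle_append.1 hw
    obtain ⟨z, hqz', hz'⟩ := cTangle_append.1 hqz
    simp only [CSlice.dom, CSlice.cod, cTangle_cons, cTangle_nil, dom_cup, cod_cup,
      List.append_nil, List.append_assoc, List.cons_append, List.nil_append, dom_cap,
      cod_cap] at hz hz'
    obtain ⟨rfl, rfl⟩ := hz'
    obtain ⟨he, hv'⟩ := hz
    have huq := hu.append hqz'
    have hn' : (q ++ v).length < n ∧ q.length + v.length + 2 = n := by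
      simp at hn ⊢; omega
    have hsmall : ∀ (_ : CTangle (l ++ r) v []), P ((u ++ q) ++ [] ++ v) := fun hv' => by
      simpa using ih (q ++ v) hn'.1 (hqz'.append hv') fun x hx =>
        (List.mem_append.1 hx).elim (hcup x) (hv x)
    rcases append_cons_cons_cases he.symm with ⟨rfl, rfl, rfl⟩ | ⟨rfl, rfl, rfl⟩ |
      ⟨rfl, rfl, rfl⟩ | ⟨m, rfl, rfl⟩ | ⟨m, rfl, rfl⟩
    · simpa using hP.circle (c := e) huq hv' (hsmall hv')
    · have := (hP.move (CMove.zigzagLeft l r' e) huq (y := l ++ e :: r')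
        (by simp [CSlice.dom, CSlice.cod]) rfl (by simpa using hv')).2
        (hsmall (by simpa using hv'))
      simpa using this
    · have := (hP.move (CMove.zigzagRight l' r e) huq (y := l' ++ e :: r)
        (by simp [CSlice.dom, CSlice.cod]) (by simp) (by simpa using hv')).2
        (hsmall (by simpa using hv'))
      simpa using this
    -- The two arcs are disjoint: after the exchange of their heights the run of minima below the
    -- maximum is shorter by one, and the total length is the same.
    · have key := ihq hq' ⟨l ++ m, cap e, r'⟩ ⟨e, rfl⟩ (⟨l, cup d, m ++ r'⟩ :: v)
        (by simpa [CSlice.IsCup] using hv) (hqz'.append (by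
          simpa [CSlice.dom, CSlice.cod] using hv')) (by simp; omega)
      have := (hP.move (u := u ++ q) (v := v) (CMove.exchange l m r' (cup d) (cap e))
        (by simpa using huq) (y := l ++ d :: d :: m ++ r')
        (by simp [CSlice.dom, CSlice.cod]) (by simp [CSlice.dom, CSlice.cod])
        (by simpa using hv')).2 (by simpa using key)
      simpa using this
    · have key := ihq hq' ⟨l', cap e, m ++ r⟩ ⟨e, rfl⟩ (⟨l' ++ m, cup d, r⟩ :: v)
        (by simpa [CSlice.IsCup] using hv) (hqz'.append (by
          simpa [CSlice.dom, CSlice.cod] using hv')) (by simp; omega)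
      have := (hP.move (u := u ++ q) (v := v) (CMove.exchange l' m r (cap e) (cup d))
        (by simpa using huq) (y := l' ++ m ++ d :: d :: r)
        (by simp [CSlice.dom, CSlice.cod]) (by simp [CSlice.dom, CSlice.cod])
        (by simpa using hv')).1 (by simpa using key)
      simpa using this

theorem append_crossingless {u : List (CSlice S)} (hu : CTangle [] u []) (h : P u)
    (w : List (CSlice S)) (hw : CTangle [] w []) (hc : ∀ s ∈ w, s.IsCup ∨ s.IsCap) :
    P (u ++ w) := by
  classical
  induction hn : w.length using Nat.strong_induction_on generalizing w with
  | _ n ih =>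
  have hsplit := List.takeWhile_append_dropWhile (p := fun s : CSlice S => s.IsCup) (l := w)
  have hq : ∀ s ∈ w.takeWhile (fun s : CSlice S => s.IsCup), s.IsCup := fun s hs => by
    simpa using List.mem_takeWhile_imp hs
  have hd := List.head?_dropWhile_not (fun s : CSlice S => decide s.IsCup) w
  generalize w.takeWhile (fun s : CSlice S => s.IsCup) = q at *
  generalize w.dropWhile (fun s : CSlice S => s.IsCup) = v at *
  subst hsplit
  cases v with
  | nil =>
    rcases List.eq_nil_or_concat q with rfl | ⟨q, s, rfl⟩
    · simpa using h
    -- A word of minima alone is not closed: the last one leaves two ends on top.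
    · exfalso
      obtain ⟨l, p, r⟩ := s
      obtain ⟨d, rfl⟩ : ∃ d, p = cup d := hq ⟨l, p, r⟩ (by simp)
      simp [cTangle_append, CSlice.cod] at hw
  | cons t v =>
    have ht : t.IsCap := (hc t (by simp)).resolve_left (by simpa using hd)
    exact hP.cups_cap hu n (fun w hl hw hc => ih _ hl w hw hc rfl) q hq t ht v
      (fun s hs => hc s (by simp [hs])) hw hn

variable [DecidableEq S]

/-- If `c` never crosses itself, `shuffle_word` replaces the word by its off-part, which `hrec`
covers, followed by a crossingless on-part, which `append_crossingless` covers. -/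
theorem of_separated (c : S)
    (hrec : ∀ w : List (CSlice S), CTangle [] w [] → ColoursIn (· ≠ c) w → P w)
    (w : List (CSlice S)) (hw : CTangle [] w [])
    (hc : ∀ s ∈ w, ∀ b, s.piece ≠ cross b c c) : P w := by
  obtain ⟨h1, h2, h3⟩ := Sim.shuffle_word hP c hw hc
  have hon : ∀ s ∈ w.flatMap (onSlice c), s.IsCup ∨ s.IsCap := by
    intro s hs
    obtain ⟨⟨l, p, r⟩, -, ht⟩ := List.mem_flatMap.1 hs
    cases p with
    | cup d =>
      simp only [onSlice] at ht
      split_ifs at ht <;> simp at ht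
      exact .inl ⟨c, by rw [ht]⟩
    | cap d =>
      simp only [onSlice] at ht
      split_ifs at ht <;> simp at ht
      exact .inr ⟨c, by rw [ht]⟩
    | cross b d e => simp [onSlice] at ht
  have hoff : ColoursIn (· ≠ c) (w.flatMap (offSlice c)) := by
    intro s hs
    obtain ⟨⟨l, p, r⟩, -, ht⟩ := List.mem_flatMap.1 hs
    cases p with
    | cup d =>
      simp only [offSlice] at ht
      split_ifs at ht with h <;> simp at ht
      subst ht
      simp only [CSlice.dom, CSlice.cod, List.mem_append, mem_off, dom_cup, cod_cup]
      grind
    | cap d =>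
      simp only [offSlice] at ht
      split_ifs at ht with h <;> simp at ht
      subst ht
      simp only [CSlice.dom, CSlice.cod, List.mem_append, mem_off, dom_cap, cod_cap]
      grind
    | cross b d e =>
      simp only [offSlice] at ht
      split_ifs at ht with h h' <;> simp at ht
      subst ht
      simp only [CSlice.dom, CSlice.cod, List.mem_append, mem_off, dom_cross, cod_cross]
      grind
  simp only [shuffle, off_nil, on_nil, List.append_nil, List.nil_append, whisk_nil_nil] at h1 h2 h3
  exact h3.iff_closed.2 (hP.append_crossingless h1 (hrec _ h1 hoff) _ h2 hon)

/-- The slice is a crossing of the colour `c` with itself. -/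
def selfCross (c : S) (s : CSlice S) : Bool :=
  match s.piece with
  | cross _ d e => d = c && e = c
  | _ => false

omit hP in
theorem selfCross_eq_true {c : S} {s : CSlice S} :
    selfCross c s = true ↔ ∃ b, s.piece = cross b c c := by
  obtain ⟨l, p, r⟩ := s
  cases p <;> simp [selfCross]

/-- Induction on the number of crossings of `c` with itself: each of the two smoothings has one
fewer. -/
theorem of_removed (c : S)
    (hrec : ∀ w : List (CSlice S), CTangle [] w [] → ColoursIn (· ≠ c) w → P w)
    (w : List (CSlice S)) (hw : CTangle [] w []) : P w := by
  induction hn : w.countP (selfCross c) using Nat.strong_induction_on generalizing w with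
  | _ n ih =>
  by_cases h : ∃ s ∈ w, ∃ b, s.piece = cross b c c
  · obtain ⟨⟨l, p, r⟩, hs, b, hp⟩ := h
    obtain ⟨u, v, rfl⟩ := List.append_of_mem hs
    obtain rfl : p = cross b c c := hp
    obtain ⟨z, hu, rfl, hv⟩ := cTangle_append.1 hw
    simp only [CSlice.dom, CSlice.cod, dom_cross, cod_cross] at hu hv
    have hcount : u.countP (selfCross c) + v.countP (selfCross c) + 1 = n := by
      rw [← hn, List.countP_append, List.countP_cons_of_pos (selfCross_eq_true.2 ⟨b, rfl⟩)]
      omega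
    have := hP.smooth (b := b) hu hv
      (ih _ (by simp only [List.append_nil, List.countP_append]; omega) _
        (by simpa using hu.append hv) rfl)
      (ih (u.countP (selfCross c) + v.countP (selfCross c)) (by omega) _
        (by
          have t : CTangle (l ++ [c, c] ++ r) [⟨l, cap c, r⟩, ⟨l, cup c, r⟩]
              (l ++ [c, c] ++ r) := by simp [CSlice.dom, CSlice.cod]
          exact (hu.append t).append hv)
        (by simp [List.countP_append, selfCross]))
    simpa using this
  · exact of_separated hP c hrec w hw fun s hs b hb => h ⟨s, hs, b, hb⟩

end Hereditary

end

end TiedLink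

namespace TiedLink

open MorseDiagram CPiece

/-! ### Every diagram is a multiple of the unknot -/

section

/-- The rules of the bracket for a function with values in an algebra, and `e` for the unknot. -/
structure IsEvaluation {R : Type} [CommRing R] (φ : Coeff →+* R) (B : MorseDiagram → R) (e : R) :
    Prop where
  isotopy : ∀ D D', Isotopy D D' → B D = B D'
  unknot : ∀ D : MorseDiagram, D.word = circle 0 0 → B D = e
  untiedCircle : ∀ D D' : MorseDiagram, UntiedCircle D D' → B D' = φ c * B D
  tiedCircle : ∀ D D' : MorseDiagram, TiedCircle D D' → B D' = φ (-(A 2 + A (-2))) * B D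
  reidemeister : ∀ D D' : MorseDiagram, Reidemeister D D' → B D = B D'
  tiedSkein_true : ∀ D E F : MorseDiagram, TiedSkein true D E F →
    B D = φ (A 1) * B E + φ (A (-1)) * B F
  tiedSkein_false : ∀ D E F : MorseDiagram, TiedSkein false D E F →
    B D = φ (A 1) * B F + φ (A (-1)) * B E
  skein : ∀ D D' E F : MorseDiagram, Skein D D' E F →
    B D + B D' = φ (A 1 + A (-1)) * (B E + B F)

variable {R : Type} [CommRing R] {φ : Coeff →+* R} {B : MorseDiagram → R} {e : R} {S T : Type}

/-- The value of the diagram of the word is a multiple of the value of the unknot. -/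
def IsMultiple (φ : Coeff →+* R) (B : MorseDiagram → R) (e : R) (w : List (CSlice S)) : Prop :=
  ∀ h hne, ∃ p, B (toMorse w h hne) = φ p * e

/-- A new tie between the colours `c` and `d` is the same as a recolouring that identifies these two
and nothing else. This turns the tied smoothings of rule (vi) into words with fewer colours. -/
theorem addTie_toMorse {w : List (CSlice S)} (h : CTangle [] w []) (hne : w ≠ []) {c d : S}
    {f : S → T} (hf : ∀ x y, f x = f y ↔ x = y ∨ ((x = c ∨ x = d) ∧ (y = c ∨ y = d)))
    (p q : (toMorse w h hne).Pt) (hp : colour w p.1 = some c) (hq : colour w q.1 = some d)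
    (h' : CTangle [] (w.map (CSlice.map f)) []) (hne' : w.map (CSlice.map f) ≠ []) :
    (toMorse w h hne).addTie p q = toMorse (w.map (CSlice.map f)) h' hne' := by
  refine ext_of_tied (by simp [toMorse, addTie, Function.comp_def]) fun x y x' y' hx hy => ?_
  rw [toMorse_tied, colour_map, colour_map, ← hx, ← hy]
  change ((toMorse w h hne).tied ⊔ Relation.EqvGen.setoid fun x y => x = p ∧ y = q) x y ↔ _
  set s := (toMorse w h hne).tied ⊔ Relation.EqvGen.setoid fun x y => x = p ∧ y = q with hs
  have hcol : ∀ a b : (toMorse w h hne).Pt, colour w a.1 = colour w b.1 → s a b := fun a b hab =>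
    (le_sup_left : _ ≤ s) hab
  have hpq : s p q := (le_sup_right : _ ≤ s) (Relation.EqvGen.rel _ _ ⟨rfl, rfl⟩)
  constructor
  · have hle : s ≤ Setoid.comap
        (fun x : (toMorse w h hne).Pt => (colour w x.1).map f) ⊥ := by
      refine sup_le (fun a b hab => congrArg (Option.map f) hab) (Setoid.eqvGen_le ?_)
      rintro a b ⟨rfl, rfl⟩
      change (colour w a.1).map f = (colour w b.1).map f
      rw [hp, hq, Option.map_some, Option.map_some, (hf c d).2 (.inr ⟨.inl rfl, .inr rfl⟩)]
    exact fun hxy => hle hxy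
  · obtain ⟨a, ha⟩ := colour_isSome x.2
    obtain ⟨b, hb⟩ := colour_isSome y.2
    have hto : ∀ (z : (toMorse w h hne).Pt) (a : S), colour w z.1 = some a → a = c ∨ a = d →
        s p z := by
      rintro z a hz (rfl | rfl)
      · exact hcol _ _ (hp.trans hz.symm)
      · exact s.trans hpq (hcol _ _ (hq.trans hz.symm))
    rw [ha, hb]
    intro hab
    rcases (hf a b).1 (by simpa using hab) with rfl | ⟨h1, h2⟩
    · exact hcol _ _ (ha.trans hb.symm)
    · exact s.trans (s.symm (hto x a ha h1)) (hto y b hb h2)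

theorem isPoint_of_level {u v : List (CSlice S)} {x : List S} (hu : CTangle [] u x) {i : ℕ} {a : S}
    (hi : x[i]? = some a) : IsPoint ((u ++ v).map CSlice.forget) (u.length, i) ∧
      colour (u ++ v) (u.length, i) = some a := by
  have h1 : level [] (u ++ v) u.length = x := by simpa using level_append_right (v := v) hu 0
  have h2 := length_level [] (u ++ v) u.length
  simp only [List.length_nil, h1] at h2
  refine ⟨⟨by simp, ?_⟩, by simp [colour, h1, hi]⟩
  simp only [← h2]
  exact (List.getElem?_eq_some_iff.1 hi).1

namespace IsEvaluation

variable (hB : IsEvaluation φ B e)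
include hB

theorem move_eq {x y : List S} {u a b v : List (CSlice S)} (hab : CMove a b)
    (hu : CTangle [] u x) (ha : CTangle x a y) (hb : CTangle x b y)
    (h₁ : CTangle [] (u ++ a ++ v) []) (h₂ : CTangle [] (u ++ b ++ v) [])
    (hne₁ : u ++ a ++ v ≠ []) (hne₂ : u ++ b ++ v ≠ []) :
    B (toMorse _ h₁ hne₁) = B (toMorse _ h₂ hne₂) := by
  have hr := replace_toMorse hu ha hb h₁ h₂ hne₁ hne₂
  rcases hab.forget with h | h
  · exact hB.isotopy _ _ (.planar _ _ _ _ _ _ h hr)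
  · exact hB.reidemeister _ _ ⟨_, _, _, _, h, hr⟩

/-- The hypothesis `hmerge` is what the induction on the number of colours provides: all words are
known once two colours have been merged. -/
theorem hereditary (hmerge : ∀ c d : S, c ≠ d → ∃ (T : Type) (f : S → T),
    (∀ x y, f x = f y ↔ x = y ∨ ((x = c ∨ x = d) ∧ (y = c ∨ y = d))) ∧
    ∀ w : List (CSlice T), IsMultiple φ B e w) :
    Hereditary (IsMultiple (S := S) φ B e) where
  move {x y u a b v} hab hu ha hb hv := by
    constructor
    · intro H h hne
      have h' := (hu.append ha).append hv
      have hne' : u ++ a ++ v ≠ [] := by cases hab <;> simp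
      obtain ⟨p, hp⟩ := H h' hne'
      exact ⟨p, by rw [← hp, hB.move_eq hab hu ha hb h' h hne' hne]⟩
    · intro H h hne
      have h' := (hu.append hb).append hv
      -- The moves with empty `b`, the zigzags and move II, act on at least one strand, so there is
      -- something below them and the diagram stays non-empty.
      have hne' : u ++ b ++ v ≠ [] := by
        intro h0
        simp only [List.append_eq_nil_iff] at h0
        obtain ⟨⟨rfl, rfl⟩, rfl⟩ := h0
        obtain rfl : [] = x := hu
        cases hab <;> simp [CSlice.dom] at ha
      obtain ⟨p, hp⟩ := H h' hne'
      exact ⟨p, by rw [← hp, hB.move_eq hab hu ha hb h h' hne hne']⟩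
  smooth {u v l r b c} hu hv := by
    intro H₁ H₂ h hne
    have hue : u ≠ [] := by rintro rfl; simp at hu
    have tE : CTangle (l ++ [c, c] ++ r) [] (l ++ [c, c] ++ r) := rfl
    have tD : CTangle (l ++ [c, c] ++ r) [⟨l, cross b c c, r⟩] (l ++ [c, c] ++ r) := by
      simp [CSlice.dom, CSlice.cod]
    have tF : CTangle (l ++ [c, c] ++ r) [⟨l, cap c, r⟩, ⟨l, cup c, r⟩] (l ++ [c, c] ++ r) := by
      simp [CSlice.dom, CSlice.cod]
    have hE := (hu.append tE).append hv
    have hF := (hu.append tF).append hv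
    obtain ⟨p, hp⟩ := H₁ hE (by simp [hue])
    obtain ⟨q, hq⟩ := H₂ hF (by simp [hue])
    obtain ⟨i1, c1⟩ := isPoint_of_level (v := [⟨l, cross b c c, r⟩] ++ v) (i := l.length)
      (a := c) hu (by simp)
    obtain ⟨i2, c2⟩ := isPoint_of_level (v := [⟨l, cross b c c, r⟩] ++ v) (i := l.length + 1)
      (a := c) hu (by simp)
    rw [← List.append_assoc] at i1 c1 i2 c2
    have key : TiedSkein b (toMorse _ h hne) (toMorse _ hE (by simp [hue]))
        (toMorse _ hF (by simp [hue])) := by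
      refine ⟨u.map CSlice.forget, v.map CSlice.forget, l.length, r.length,
        replace_toMorse hu tD tE _ _ _ _, replace_toMorse hu tD tF _ _ _ _,
        ⟨_, i1⟩, ⟨_, i2⟩, by simp, by simp, ?_⟩
      exact c1.trans c2.symm
    cases b with
    | true =>
      refine ⟨A 1 * p + A (-1) * q, ?_⟩
      rw [hB.tiedSkein_true _ _ _ key, hp, hq, map_add, map_mul, map_mul]; ring
    | false =>
      refine ⟨A 1 * q + A (-1) * p, ?_⟩
      rw [hB.tiedSkein_false _ _ _ key, hp, hq, map_add, map_mul, map_mul]; ring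
  change {u v l r c d} hcd hu hv := by
    obtain ⟨T, f, hf, hT⟩ := hmerge c d hcd
    have hue : u ≠ [] := by rintro rfl; simp at hu
    have hfc : f d = f c := (hf d c).2 (.inr ⟨.inr rfl, .inl rfl⟩)
    have tD : ∀ b, CTangle (l ++ [c, d] ++ r) [⟨l, cross b c d, r⟩] (l ++ [d, c] ++ r) := by
      simp [CSlice.dom, CSlice.cod]
    have hD := fun b => (hu.append (tD b)).append hv
    have hu' := hu.map f
    have hv' := hv.map f
    have tE : CTangle ((l ++ [c, d] ++ r).map f) [] ((l ++ [d, c] ++ r).map f) := by simp [hfc]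
    have tF : CTangle ((l ++ [c, d] ++ r).map f)
        [⟨l.map f, cap (f c), r.map f⟩, ⟨l.map f, cup (f c), r.map f⟩]
        ((l ++ [d, c] ++ r).map f) := by simp [hfc, CSlice.dom, CSlice.cod]
    have hE := (hu'.append tE).append hv'
    have hF := (hu'.append tF).append hv'
    have hneD : ∀ b, u ++ [⟨l, cross b c d, r⟩] ++ v ≠ [] := by simp
    have hneE : u.map (CSlice.map f) ++ [] ++ v.map (CSlice.map f) ≠ [] := by simp [hue]
    have hneF : u.map (CSlice.map f) ++ [⟨l.map f, cap (f c), r.map f⟩,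
      ⟨l.map f, cup (f c), r.map f⟩] ++ v.map (CSlice.map f) ≠ [] := by simp
    obtain ⟨p, hp⟩ := hT _ hE hneE
    obtain ⟨q, hq⟩ := hT _ hF hneF
    obtain ⟨i1, c1⟩ := isPoint_of_level (v := [⟨l, cross true c d, r⟩] ++ v) (i := l.length)
      (a := c) hu (by simp)
    obtain ⟨i2, c2⟩ := isPoint_of_level (v := [⟨l, cross true c d, r⟩] ++ v)
      (i := l.length + 1) (a := d) hu (by simp)
    rw [← List.append_assoc] at i1 c1 i2 c2
    let p₁ : (toMorse _ (hD true) (hneD true)).Pt :=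
      ⟨(u.length, l.length), i1⟩
    let p₂ : (toMorse _ (hD true) (hneD true)).Pt :=
      ⟨(u.length, l.length + 1), i2⟩
    have key : Skein (toMorse _ (hD true) (hneD true)) (toMorse _ (hD false) (hneD false))
        (toMorse _ hE hneE) (toMorse _ hF hneF) := by
      refine ⟨u.map CSlice.forget, v.map CSlice.forget, l.length, r.length,
        replace_toMorse hu (tD true) (tD false) _ _ _ _, p₁, p₂, by simp [p₁], by simp [p₂], ?_⟩
      have hm := (hD true).map f
      have hnem : List.map (CSlice.map f) (u ++ [⟨l, cross true c d, r⟩] ++ v) ≠ [] := by simp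
      rw [addTie_toMorse (hD true) (hneD true) hf p₁ p₂ c1 c2 hm hnem]
      have tD' := (tD true).map f
      have e1 : List.map (CSlice.map f) (u ++ [⟨l, cross true c d, r⟩] ++ v) =
        u.map (CSlice.map f) ++ List.map (CSlice.map f) [⟨l, cross true c d, r⟩] ++
          v.map (CSlice.map f) := by simp
      have rE := replace_toMorse hu' tD' tE (e1 ▸ hm) hE (e1 ▸ hnem) hneE
      have rF := replace_toMorse hu' tD' tF (e1 ▸ hm) hF (e1 ▸ hnem) hneF
      simp only [← e1] at rE rF
      have e2 : ∀ x : List (CSlice S), (x.map (CSlice.map f)).map CSlice.forget =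
        x.map CSlice.forget := by simp [Function.comp_def]
      rw [e2, e2, e2] at rE rF
      simp only [List.map_cons, List.map_nil, CSlice.forget, forget_cross, forget_cap, forget_cup,
        List.length_map] at rE rF
      exact ⟨rE, rF⟩
    -- The two values add up to a known multiple of `e`, so one of them is a multiple if and only if
    -- the other is.
    have hsum := hB.skein _ _ _ _ key
    rw [hp, hq] at hsum
    constructor
    · intro H h hne
      obtain ⟨s, hs⟩ := H (hD true) (hneD true)
      refine ⟨(A 1 + A (-1)) * (p + q) - s, ?_⟩
      rw [hs] at hsum
      rw [map_sub, map_mul, map_add φ p q]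
      linear_combination hsum
    · intro H h hne
      obtain ⟨s, hs⟩ := H (hD false) (hneD false)
      refine ⟨(A 1 + A (-1)) * (p + q) - s, ?_⟩
      rw [hs] at hsum
      rw [map_sub, map_mul, map_add φ p q]
      linear_combination hsum
  circle {u v l r d} hu hv := by
    intro H h hne
    have tE : CTangle (l ++ r) [] (l ++ r) := rfl
    have tD : CTangle (l ++ r) [⟨l, cup d, r⟩, ⟨l, cap d, r⟩] (l ++ r) := by
      simp [CSlice.dom, CSlice.cod]
    have hE := (hu.append tE).append hv
    -- `IsMultiple` says nothing about the empty word, so the last circle cannot be removed; but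
    -- then the diagram is the unknot, with coefficient 1.
    by_cases h0 : u ++ [] ++ v = []
    · obtain ⟨rfl, rfl⟩ : u = [] ∧ v = [] := by simpa using h0
      obtain ⟨rfl, rfl⟩ : l = [] ∧ r = [] := by simpa using (show [] = l ++ r from hu).symm
      exact ⟨1, by rw [map_one, one_mul]; exact hB.unknot _ rfl⟩
    have hr := replace_toMorse hu tD tE h hE hne h0
    obtain ⟨p, hp⟩ := H hE h0
    -- A circle that is not tied to any point off itself is untied, so the two circle rules cover
    -- all cases.
    by_cases ht : TiedCircle (toMorse _ hE h0) (toMorse _ h hne)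
    · refine ⟨-(A 2 + A (-2)) * p, ?_⟩
      rw [hB.tiedCircle _ _ ht, hp, map_mul]; ring
    · have hut : UntiedCircle (toMorse _ hE h0) (toMorse _ h hne) := by
        refine ⟨_, _, l.length, r.length, hr, fun p q hp hpq => ?_⟩
        by_contra hq
        rw [not_or] at hq
        exact ht ⟨_, _, l.length, r.length, hr, p, q, hp, hpq, hq⟩
      refine ⟨c * p, ?_⟩
      rw [hB.untiedCircle _ _ hut, hp, map_mul]; ring

/-- Strong induction on the number of colours. Merging `d` into `c` and avoiding `c` both lead to
the colours different from one given colour. -/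
theorem isMultiple (n : ℕ) : ∀ (S : Type) [Finite S], Nat.card S = n →
    ∀ w : List (CSlice S), IsMultiple φ B e w := by
  classical
  induction n using Nat.strong_induction_on with
  | _ n ih =>
  intro S _ hS w
  have hcard : ∀ c : S, Nat.card {x // x ≠ c} < n := fun c => by
    rw [← hS]
    exact Finite.card_subtype_lt (x := c) (by simp)
  have hP : Hereditary (IsMultiple (S := S) φ B e) := by
    refine hB.hereditary fun c d hcd => ⟨{x // x ≠ d},
      fun x => if hx : x = d then ⟨c, hcd⟩ else ⟨x, hx⟩, fun x y => ?_,
      ih _ (hcard d) _ rfl⟩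
    by_cases hx : x = d <;> by_cases hy : y = d <;> simp [hx, hy] <;> grind
  intro h hne
  obtain ⟨s, w', rfl⟩ := List.exists_cons_of_ne_nil hne
  obtain ⟨c⟩ : Nonempty S := by
    obtain ⟨l, p, r⟩ := s
    cases p with
    | cup c => exact ⟨c⟩
    | cap c => exact ⟨c⟩
    | cross b c d => exact ⟨c⟩
  refine hP.of_removed c (fun w hw hc h hne => ?_) _ h h hne
  -- The word is not empty, hence it has some colour other than `c`. This colour only serves as the
  -- value of `g` at the unused colour `c`.
  obtain ⟨d, hd⟩ : ∃ d, d ≠ c := by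
    obtain ⟨⟨l, p, r⟩, w', rfl⟩ := List.exists_cons_of_ne_nil hne
    obtain ⟨h1, h2⟩ := hc _ List.mem_cons_self
    cases p with
    | cup d => exact ⟨d, h2 d (by simp [CSlice.cod])⟩
    | cap d => exact ⟨d, h1 d (by simp [CSlice.dom])⟩
    | cross b d e => exact ⟨d, h1 d (by simp [CSlice.dom])⟩
  let g : S → {x // x ≠ c} := fun x => if hx : x = c then ⟨d, hd⟩ else ⟨x, hx⟩
  have hg : Set.InjOn g {x | x ≠ c} := by
    intro x hx y hy hxy
    simp only [Set.mem_ofPred_eq] at hx hy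
    simpa [g, hx, hy] using hxy
  have h' := h.map g
  have hne' : w.map (CSlice.map g) ≠ [] := by simpa using hne
  rw [← toMorse_map g hg hc h hne h' hne']
  exact ih _ (hcard c) _ rfl _ h' hne'

theorem exists_coeff (D : MorseDiagram) : ∃ p, B D = φ p * e := by
  obtain ⟨S, _, w, h, hne, rfl⟩ := exists_toMorse D
  exact hB.isMultiple _ S rfl w h hne

end IsEvaluation

end

end TiedLink

namespace TiedLink

/-! ### The spin model -/

section

variable {K : Type} [Field K] {C : Type} [LinearOrder C]

/-- The operators of tangles act on the functions of the spins of the strands. -/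
abbrev Op (K : Type) : Type := (List Bool → K) → List Bool → K

/-- The operator with further strands on the left. -/
def lift : ℕ → Op K → Op K
  | 0, O => O
  | n + 1, O => fun ψ x =>
    match x with
    | [] => 0
    | s :: x => lift n O (fun y => ψ (s :: y)) x

/-- The two ends of a turning arc have opposite spins. The weights -a², 1 here and 1, -a⁻² in
`capOp` make the relevant products in both zigzags equal to 1 and give the circle the value -(a² +
a⁻²), without a square root of -1. -/
def cupOp (a : K) : Op K := fun ψ x =>
  -a ^ 2 * ψ (false :: true :: x) + ψ (true :: false :: x)

def capOp (a : K) : Op K := fun ψ x =>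
  match x with
  | false :: true :: x => ψ x
  | true :: false :: x => -(a ^ 2)⁻¹ * ψ x
  | _ => 0

def swapOp : Op K := fun ψ x =>
  match x with
  | s :: t :: x => ψ (t :: s :: x)
  | _ => 0

/-- The sign of a crossing of two different colours. -/
def crossSign (K : Type) [Field K] (b : Bool) (c d : C) : K :=
  if (bif b then c else d) < (bif b then d else c) then -1 else 1

/-- Equal colours: the Kauffman expansion, with `capOp a ∘ cupOp a` for the horizontal arcs.
Different colours: the spins pass through each other, and the sign is -1 exactly when the
over-strand has the smaller colour, so the two kinds of crossing have opposite signs. -/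
def crossOp (a : K) (b : Bool) (c d : C) : Op K := fun ψ x =>
  if c = d then
    bif b then a * ψ x + a⁻¹ * capOp a (cupOp a ψ) x
    else a * capOp a (cupOp a ψ) x + a⁻¹ * ψ x
  else crossSign K b c d * swapOp ψ x

/-- The operator of a piece, where `c`, `d` are the colours of the ends at the bottom. -/
def pieceOp (a : K) (p : Piece) (c d : C) : Op K :=
  match p with
  | .cup => cupOp a
  | .cap => capOp a
  | .cross b => crossOp a b c d

/-- The operator of a tangle diagram whose points are coloured by `g`. -/
def pull (a : K) : (ℕ → ℕ → C) → List Slice → Op K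
  | _, [] => id
  -- Functions of the spins on top are pulled back to functions of the spins at the bottom, so the
  -- lowest slice is applied last.
  | g, s :: w => fun ψ => lift s.left (pieceOp a s.piece (g 0 s.left) (g 0 (s.left + 1)))
      (pull a (fun k => g (k + 1)) w ψ)

/-! ### Linearity of the operators and the effect of further strands on the left. -/

/-- Linear combinations are preserved. -/
def IsLin (O : Op K) : Prop :=
  ∀ (r s : K) (ψ ψ' : List Bool → K) (x : List Bool),
    O (fun y => r * ψ y + s * ψ' y) x = r * O ψ x + s * O ψ' x

theorem IsLin.lift {O : Op K} (h : IsLin O) (n : ℕ) : IsLin (lift n O) := by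
  induction n with
  | zero => exact h
  | succ n ih =>
    intro r s ψ ψ' x
    cases x with
    | nil => simp [TiedLink.lift]
    | cons t x => exact ih r s _ _ x

theorem IsLin.comp {O O' : Op K} (h : IsLin O) (h' : IsLin O') : IsLin (O ∘ O') := by
  intro r s ψ ψ' x
  have : O' (fun y => r * ψ y + s * ψ' y) = fun y => r * O' ψ y + s * O' ψ' y :=
    funext fun y => h' r s ψ ψ' y
  simp only [Function.comp_apply, this, h r s _ _ x]

theorem isLin_cupOp (a : K) : IsLin (cupOp a) := by
  intro r s ψ ψ' x; simp only [cupOp]; ring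

theorem isLin_capOp (a : K) : IsLin (capOp a) := by
  intro r s ψ ψ' x
  rcases x with _ | ⟨_ | _, _ | ⟨_ | _, x⟩⟩ <;> simp only [capOp] <;> ring

theorem isLin_swapOp : IsLin (swapOp (K := K)) := by
  intro r s ψ ψ' x
  rcases x with _ | ⟨_, _ | ⟨_, x⟩⟩ <;> simp only [swapOp] <;> ring

theorem isLin_crossOp (a : K) (b : Bool) (c d : C) : IsLin (crossOp a b c d) := by
  intro r s ψ ψ' x
  have h := (isLin_capOp a).comp (isLin_cupOp a) r s ψ ψ' x
  simp only [Function.comp_apply] at h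
  have h' := isLin_swapOp r s ψ ψ' x
  cases b <;> simp only [crossOp, h, h', cond_true, cond_false] <;> split_ifs <;> ring

theorem isLin_pieceOp (a : K) (p : Piece) (c d : C) : IsLin (pieceOp a p c d) := by
  cases p
  · exact isLin_cupOp a
  · exact isLin_capOp a
  · exact isLin_crossOp a _ c d

theorem isLin_pull (a : K) (g : ℕ → ℕ → C) (w : List Slice) : IsLin (pull a g w) := by
  induction w generalizing g with
  | nil => intro r s ψ ψ' x; rfl
  | cons s w ih => exact ((isLin_pieceOp a _ _ _).lift _).comp (ih _)

theorem IsLin.smul {O : Op K} (h : IsLin O) (r : K) (ψ : List Bool → K) (x : List Bool) :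
    O (fun y => r * ψ y) x = r * O ψ x := by
  simpa using h r 0 ψ 0 x

theorem IsLin.zero {O : Op K} (h : IsLin O) (x : List Bool) : O (fun _ => 0) x = 0 := by
  simpa using h.smul 0 0 x

theorem lift_comp (n : ℕ) (O O' : Op K) : lift n (O ∘ O') = lift n O ∘ lift n O' := by
  induction n with
  | zero => rfl
  | succ n ih =>
    funext ψ x
    cases x with
    | nil => rfl
    | cons s x => simp only [lift, ih]; rfl

theorem lift_lift (l m : ℕ) (O : Op K) : lift l (lift m O) = lift (l + m) O := by
  induction l with
  | zero => simp [lift]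
  | succ l ih =>
    funext ψ x
    rw [Nat.add_right_comm]
    simp only [lift, ih]

/-- `lift` takes the value 0 on lists too short for it, so operator identities are claimed and
transported only for lists that are long enough. -/
theorem lift_congr {O O' : Op K} {k : ℕ}
    (h : ∀ ψ (x : List Bool), k ≤ x.length → O ψ x = O' ψ x) (l : ℕ) (ψ : List Bool → K)
    (x : List Bool) (hx : l + k ≤ x.length) : lift l O ψ x = lift l O' ψ x := by
  induction l generalizing ψ x with
  | zero => exact h ψ x (by simpa using hx)
  | succ l ih =>
    cases x with
    | nil => rfl
    | cons s x => exact ih _ x (by simp at hx; omega)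

theorem lift_id (l : ℕ) (ψ : List Bool → K) (x : List Bool) (hx : l ≤ x.length) :
    lift l id ψ x = ψ x := by
  induction l generalizing ψ x with
  | zero => rfl
  | succ l ih =>
    cases x with
    | nil => simp at hx
    | cons s x => exact ih _ x (by simpa using hx)

/-! The local identities. -/

theorem crossOp_of_ne (a : K) (b : Bool) {c d : C} (h : c ≠ d) (ψ : List Bool → K)
    (s t : Bool) (x : List Bool) :
    crossOp a b c d ψ (s :: t :: x) = crossSign K b c d * ψ (t :: s :: x) := by
  simp [crossOp, h, swapOp]

/-- Together with the next four lemmas, the matrix of a one-coloured crossing on the spins of its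
two strands. The moves are then verified entry by entry. -/
theorem crossOp_self_same (a : K) (b : Bool) (c : C) (ψ : List Bool → K) (s : Bool)
    (x : List Bool) :
    crossOp a b c c ψ (s :: s :: x) = (bif b then a else a⁻¹) * ψ (s :: s :: x) := by
  cases b <;> cases s <;> simp [crossOp, capOp]

theorem crossOp_true_self_false_true {a : K} (ha : a ≠ 0) (c : C) (ψ : List Bool → K)
    (x : List Bool) :
    crossOp a true c c ψ (false :: true :: x) = a⁻¹ * ψ (true :: false :: x) := by
  simp only [crossOp, capOp, cupOp, if_true, cond_true]
  field_simp
  ring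

theorem crossOp_true_self_true_false {a : K} (ha : a ≠ 0) (c : C) (ψ : List Bool → K)
    (x : List Bool) :
    crossOp a true c c ψ (true :: false :: x) =
      a⁻¹ * ψ (false :: true :: x) + (a - a⁻¹ ^ 3) * ψ (true :: false :: x) := by
  simp only [crossOp, capOp, cupOp, if_true, cond_true]
  field_simp
  ring

theorem crossOp_false_self_false_true {a : K} (ha : a ≠ 0) (c : C) (ψ : List Bool → K)
    (x : List Bool) :
    crossOp a false c c ψ (false :: true :: x) =
      (a⁻¹ - a ^ 3) * ψ (false :: true :: x) + a * ψ (true :: false :: x) := by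
  simp only [crossOp, capOp, cupOp, if_true, cond_false]
  field_simp
  ring

theorem crossOp_false_self_true_false {a : K} (ha : a ≠ 0) (c : C) (ψ : List Bool → K)
    (x : List Bool) :
    crossOp a false c c ψ (true :: false :: x) = a * ψ (false :: true :: x) := by
  simp only [crossOp, capOp, cupOp, if_true, cond_false]
  field_simp
  ring

/-- Both sides have the same over-strand and the same under-strand, and the sign depends on nothing
else. -/
theorem crossSign_not (b : Bool) (c d : C) :
    crossSign K (!b) d c = crossSign K b c d := by
  cases b <;> rfl

theorem crossSign_mul_self (b : Bool) (c d : C) :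
    crossSign K b c d * crossSign K b c d = 1 := by
  unfold crossSign; split_ifs <;> simp

/-- The piece acts on the first spins and `O` on those behind them. Linearity lets `O` pass the
weighted sums that the piece produces. -/
theorem exchange_pieceOp (a : K) (p : Piece) (c d : C) {O : Op K} (hO : IsLin O) (m : ℕ) :
    pieceOp a p c d ∘ lift (p.cod + m) O = lift (p.dom + m) O ∘ pieceOp a p c d := by
  have hl := hO.lift m
  have hcup : cupOp a ∘ lift (m + 2) O = lift m O ∘ cupOp a := by
    funext ψ x
    have := hl (-a ^ 2) 1 (fun y => ψ (false :: true :: y)) (fun y => ψ (true :: false :: y)) x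
    simp only [one_mul] at this
    exact this.symm
  have hcap : capOp a ∘ lift m O = lift (m + 2) O ∘ capOp a := by
    funext ψ x
    rcases x with _ | ⟨_ | _, _ | ⟨_ | _, x⟩⟩ <;> simp [capOp, lift, hl.zero]
    simpa using (hl.smul (-(a ^ 2)⁻¹) ψ x).symm
  cases p with
  | cup => simpa [Piece.dom, Piece.cod, Nat.add_comm, pieceOp] using hcup
  | cap => simpa [Piece.dom, Piece.cod, Nat.add_comm, pieceOp] using hcap
  | cross b =>
    simp only [Piece.dom, Piece.cod, Nat.add_comm 2, pieceOp]
    have hl2 := hO.lift (m + 2)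
    have hh : ∀ ψ x, capOp a (cupOp a (lift (m + 2) O ψ)) x =
        lift (m + 2) O (capOp a (cupOp a ψ)) x := fun ψ x => by
      rw [show cupOp a (lift (m + 2) O ψ) = lift m O (cupOp a ψ) from congrFun hcup ψ]
      exact congrFun (congrFun hcap _) x
    have hs : ∀ ψ x, swapOp (lift (m + 2) O ψ) x = lift (m + 2) O (swapOp ψ) x := by
      intro ψ x
      rcases x with _ | ⟨s, _ | ⟨t, x⟩⟩ <;> simp [swapOp, lift]
    funext ψ x
    simp only [Function.comp_apply]
    unfold crossOp
    by_cases hcd : c = d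
    · cases b
      · simp only [hcd, if_true, cond_false, hh, hl2 a a⁻¹]
      · simp only [hcd, if_true, cond_true, hh, hl2 a a⁻¹]
    · simp only [hcd, if_false, hs, hl2.smul]

theorem zigzagLeft_op {a : K} (ha : a ≠ 0) (ψ : List Bool → K) (x : List Bool)
    (hx : 1 ≤ x.length) : (cupOp a ∘ lift 1 (capOp a)) ψ x = id ψ x := by
  rcases x with _ | ⟨_ | _, x⟩ <;> simp [cupOp, capOp, lift] at hx ⊢
  field_simp

theorem zigzagRight_op {a : K} (ha : a ≠ 0) (ψ : List Bool → K) (x : List Bool)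
    (hx : 1 ≤ x.length) : (lift 1 (cupOp a) ∘ capOp a) ψ x = id ψ x := by
  rcases x with _ | ⟨_ | _, x⟩ <;> simp [cupOp, capOp, lift] at hx ⊢
  field_simp

/-- For equal colours this is an identity of matrices, checked on the eight triples of spins. For
different colours the crossing strand is transparent and `crossSign_not` matches the signs. -/
theorem crossCap_op {a : K} (ha : a ≠ 0) (b : Bool) (c d : C) (ψ : List Bool → K)
    (x : List Bool) (hx : 3 ≤ x.length) :
    (lift 1 (crossOp a b d c) ∘ capOp a) ψ x =
      (crossOp a (!b) c d ∘ lift 1 (capOp a)) ψ x := by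
  obtain ⟨s, t, u, x, rfl⟩ : ∃ s t u x', x = s :: t :: u :: x' := by
    rcases x with _ | ⟨_, _ | ⟨_, _ | ⟨_, x⟩⟩⟩ <;> simp at hx ⊢
  by_cases h : d = c
  · subst h
    cases b <;> cases s <;> cases t <;> cases u <;>
      simp [crossOp_true_self_false_true, crossOp_true_self_true_false,
        crossOp_false_self_false_true, crossOp_false_self_true_false, crossOp_self_same, capOp,
        lift, ha] <;> field_simp <;> ring
  · have h' : c ≠ d := Ne.symm h
    simp only [Function.comp_apply, lift, crossOp_of_ne a _ h, crossOp_of_ne a _ h',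
      crossSign_not]
    cases s <;> cases t <;> cases u <;> simp [capOp]

theorem cupCross_op {a : K} (ha : a ≠ 0) (b : Bool) (c d : C) (ψ : List Bool → K)
    (x : List Bool) (hx : 1 ≤ x.length) :
    (cupOp a ∘ lift 1 (crossOp a b c d)) ψ x =
      (lift 1 (cupOp a) ∘ crossOp a (!b) d c) ψ x := by
  obtain ⟨s, x, rfl⟩ : ∃ s x', x = s :: x' := by
    rcases x with _ | ⟨_, x⟩ <;> simp at hx ⊢
  by_cases h : d = c
  · subst h
    cases b <;> cases s <;>
      simp [crossOp_true_self_false_true, crossOp_true_self_true_false,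
        crossOp_false_self_false_true, crossOp_false_self_true_false, crossOp_self_same, cupOp,
        lift, ha] <;> field_simp <;> ring
  · have h' : c ≠ d := Ne.symm h
    simp only [Function.comp_apply, lift, crossOp_of_ne a _ h, crossOp_of_ne a _ h',
      crossSign_not, cupOp]

theorem two_op {a : K} (ha : a ≠ 0) (b : Bool) (c d : C) (ψ : List Bool → K)
    (x : List Bool) (hx : 2 ≤ x.length) :
    (crossOp a b c d ∘ crossOp a (!b) d c) ψ x = id ψ x := by
  obtain ⟨s, t, x, rfl⟩ : ∃ s t x', x = s :: t :: x' := by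
    rcases x with _ | ⟨_, _ | ⟨_, x⟩⟩ <;> simp at hx ⊢
  by_cases h : d = c
  · subst h
    cases b <;> cases s <;> cases t <;>
      simp [crossOp_true_self_false_true, crossOp_true_self_true_false,
        crossOp_false_self_false_true, crossOp_false_self_true_false, crossOp_self_same,
        ha] <;> field_simp <;> ring
  · have h' : c ≠ d := Ne.symm h
    simp only [Function.comp_apply, crossOp_of_ne a _ h, crossOp_of_ne a _ h', crossSign_not,
      id_eq]
    rw [← mul_assoc, crossSign_mul_self, one_mul]

theorem three_op_self {a : K} (ha : a ≠ 0) (b₁₂ b₁₃ b₂₃ : Bool) (hb : b₁₂ = b₁₃ ∨ b₁₃ = b₂₃)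
    (c : C) (ψ : List Bool → K) (s t u : Bool) (x : List Bool) :
    (crossOp a b₁₂ c c ∘ lift 1 (crossOp a b₁₃ c c) ∘ crossOp a b₂₃ c c) ψ (s :: t :: u :: x) =
      (lift 1 (crossOp a b₂₃ c c) ∘ crossOp a b₁₃ c c ∘ lift 1 (crossOp a b₁₂ c c)) ψ
        (s :: t :: u :: x) := by
  have : (b₁₂ = true ∧ b₁₃ = true) ∨ (b₁₂ = false ∧ b₁₃ = false) ∨
    (b₁₂ = false ∧ b₁₃ = true ∧ b₂₃ = true) ∨ (b₁₂ = true ∧ b₁₃ = false ∧ b₂₃ = false) := by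
    revert hb; cases b₁₂ <;> cases b₁₃ <;> cases b₂₃ <;> simp
  clear hb
  rcases this with ⟨rfl, rfl⟩ | ⟨rfl, rfl⟩ | ⟨rfl, rfl, rfl⟩ | ⟨rfl, rfl, rfl⟩ <;>
    (try cases b₂₃) <;> cases s <;> cases t <;> cases u <;>
    simp [crossOp_true_self_false_true, crossOp_true_self_true_false,
      crossOp_false_self_false_true, crossOp_false_self_true_false, crossOp_self_same,
      ha, lift] <;> field_simp <;> ring

/-- The Yang–Baxter equation proper is the case of one colour, `three_op_self`. Otherwise some
strand has a colour of its own; it is transparent to the spins of the other two and contributes the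
same signs on both sides. -/
theorem three_op {a : K} (ha : a ≠ 0) (b₁₂ b₁₃ b₂₃ : Bool) (hb : b₁₂ = b₁₃ ∨ b₁₃ = b₂₃)
    (c d e : C) (ψ : List Bool → K) (x : List Bool) (hx : 3 ≤ x.length) :
    (crossOp a b₁₂ c d ∘ lift 1 (crossOp a b₁₃ c e) ∘ crossOp a b₂₃ d e) ψ x =
      (lift 1 (crossOp a b₂₃ d e) ∘ crossOp a b₁₃ c e ∘ lift 1 (crossOp a b₁₂ c d)) ψ x := by
  obtain ⟨s, t, u, x, rfl⟩ : ∃ s t u x', x = s :: t :: u :: x' := by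
    rcases x with _ | ⟨_, _ | ⟨_, _ | ⟨_, x⟩⟩⟩ <;> simp at hx ⊢
  by_cases hcd : c = d
  · subst hcd
    by_cases hce : c = e
    · subst hce
      exact three_op_self ha b₁₂ b₁₃ b₂₃ hb c ψ s t u x
    · cases b₁₂ <;> cases s <;> cases t <;>
      simp [crossOp_true_self_false_true, crossOp_true_self_true_false,
        crossOp_false_self_false_true, crossOp_false_self_true_false, crossOp_self_same,
        ha, lift, crossOp_of_ne a _ hce] <;> ring
  · by_cases hce : c = e
    · subst hce
      have hdc : d ≠ c := Ne.symm hcd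
      cases b₁₃ <;> cases s <;> cases u <;>
      simp [crossOp_true_self_false_true, crossOp_true_self_true_false,
        crossOp_false_self_false_true, crossOp_false_self_true_false, crossOp_self_same,
        ha, lift, crossOp_of_ne a _ hcd, crossOp_of_ne a _ hdc] <;> ring
    · by_cases hde : d = e
      · subst hde
        cases b₂₃ <;> cases t <;> cases u <;>
        simp [crossOp_true_self_false_true, crossOp_true_self_true_false,
          crossOp_false_self_false_true, crossOp_false_self_true_false, crossOp_self_same,
          ha, lift, crossOp_of_ne a _ hcd] <;> ring
      · simp [lift, crossOp_of_ne a _ hcd, crossOp_of_ne a _ hce, crossOp_of_ne a _ hde]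
        ring

end

end TiedLink

namespace TiedLink

/-! ### Invariance under local moves -/

section

variable {K : Type} [Field K] {C : Type} [LinearOrder C]

theorem pull_append (a : K) (g : ℕ → ℕ → C) (u v : List Slice) (ψ : List Bool → K) :
    pull a g (u ++ v) ψ = pull a g u (pull a (fun k => g (u.length + k)) v ψ) := by
  induction u generalizing g with
  | nil => simp [pull]
  | cons s u ih =>
    simp only [List.cons_append, pull, ih, List.length_cons, Nat.add_right_comm _ 1]

theorem pieceOp_congr_fun (a : K) (p : Piece) (c d : C) {ψ ψ' : List Bool → K} {x : List Bool}
    (h : ∀ y : List Bool, y.length + p.dom = x.length + p.cod → ψ y = ψ' y) :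
    pieceOp a p c d ψ x = pieceOp a p c d ψ' x := by
  cases p with
  | cup => simp [pieceOp, cupOp, h (false :: true :: x) (by simp [Piece.dom, Piece.cod]),
      h (true :: false :: x) (by simp [Piece.dom, Piece.cod])]
  | cap =>
    rcases x with _ | ⟨_ | _, _ | ⟨_ | _, x⟩⟩ <;> simp [pieceOp, capOp] <;>
      simp [h x (by simp [Piece.dom, Piece.cod])]
  | cross b =>
    have h' : ∀ y : List Bool, y.length = x.length → ψ y = ψ' y := fun y hy =>
      h y (by simp [Piece.dom, Piece.cod, hy])
    rcases x with _ | ⟨s, _ | ⟨t, x⟩⟩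
    · simp [pieceOp, crossOp, capOp, swapOp, h' [] rfl]
    · simp [pieceOp, crossOp, capOp, swapOp, h' [s] rfl]
    · have h1 := fun s t => h' (s :: t :: x) rfl
      cases s <;> cases t <;> simp [pieceOp, crossOp, capOp, swapOp, cupOp, h1]

theorem lift_pieceOp_congr_fun (a : K) (l : ℕ) (p : Piece) (c d : C) {ψ ψ' : List Bool → K}
    {x : List Bool} (h : ∀ y : List Bool, y.length + p.dom = x.length + p.cod → ψ y = ψ' y) :
    lift l (pieceOp a p c d) ψ x = lift l (pieceOp a p c d) ψ' x := by
  induction l generalizing ψ ψ' x with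
  | zero => exact pieceOp_congr_fun a p c d h
  | succ l ih =>
    cases x with
    | nil => rfl
    | cons s x => exact ih fun y hy => h (s :: y) (by simp; omega)

theorem pull_congr_fun (a : K) (g : ℕ → ℕ → C) {w : List Slice} {m n : ℕ} (hw : IsTangle m w n)
    {ψ ψ' : List Bool → K} (h : ∀ y : List Bool, y.length = n → ψ y = ψ' y) {x : List Bool}
    (hx : x.length = m) : pull a g w ψ x = pull a g w ψ' x := by
  induction w generalizing g m x with
  | nil => exact h x (hx.trans hw)
  | cons s w ih =>
    obtain ⟨rfl, hw⟩ := hw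
    refine lift_pieceOp_congr_fun a _ _ _ _ fun y hy => ih _ hw ?_
    simp only [hx, Slice.dom, Slice.cod] at hy ⊢
    omega

theorem pieceOp_congr (a : K) {p : Piece} {c d c' d' : C} (h : p.dom = 2 → c = c' ∧ d = d') :
    pieceOp a p c d = pieceOp a p c' d' := by
  cases p with
  | cup => rfl
  | cap => rfl
  | cross b => obtain ⟨rfl, rfl⟩ := h rfl; rfl

theorem pull_congr_colour (a : K) {g g' : ℕ → ℕ → C} {w : List Slice} {m n : ℕ}
    (hw : IsTangle m w n)
    (h : ∀ k i, k ≤ w.length → i < widthAt m w k → g k i = g' k i) :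
    pull a g w = pull a g' w := by
  induction w generalizing g g' m with
  | nil => rfl
  | cons s w ih =>
    obtain ⟨rfl, hw⟩ := hw
    funext ψ
    simp only [pull]
    rw [ih hw (g := fun k => g (k + 1)) (g' := fun k => g' (k + 1)) fun k i hk hi =>
      h (k + 1) i (by simpa using hk) hi, pieceOp_congr a fun hp => ⟨h 0 _ (by simp) ?_,
        h 0 _ (by simp) ?_⟩] <;> simp [widthAt, Slice.dom, hp] <;> omega

/-- Below and above the strip the operators depend only on the colours there, so equality of the
operators within the strip suffices. -/
theorem pull_replace (a : K) {g g' : ℕ → ℕ → C} {u w w' v : List Slice} {m n : ℕ}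
    (hu : IsTangle 0 u m) (hw' : IsTangle m w' n)
    (hv : IsTangle n v 0)
    (hgu : ∀ k i, k ≤ u.length → i < widthAt 0 u k → g k i = g' k i)
    (hgv : ∀ k i, k ≤ v.length → i < widthAt n v k →
      g (u.length + w.length + k) i = g' (u.length + w'.length + k) i)
    (h : ∀ (ψ : List Bool → K) x, x.length = m →
      pull a (fun k => g (u.length + k)) w ψ x = pull a (fun k => g' (u.length + k)) w' ψ x)
    (ψ : List Bool → K) : pull a g (u ++ w ++ v) ψ [] = pull a g' (u ++ w' ++ v) ψ [] := by
  rw [pull_append, pull_append, pull_append, pull_append, pull_congr_colour a hu hgu]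
  refine pull_congr_fun a _ hu (fun y hy => ?_) rfl
  rw [h _ y hy]
  refine pull_congr_fun a _ hw' (fun z hz => ?_) hy
  rw [pull_congr_colour a hv (g' := fun k => g' ((u ++ w').length + k))]
  intro k i hk hi
  simpa using hgv k i hk hi

/-- Consistency along the arcs determines the colours needed on the middle level by those at the
ends of the strip; after that the operator identities apply. -/
theorem pull_planarMove {a : K} (ha : a ≠ 0) {w w' : List Slice} (hm : PlanarMove w w')
    {g g' : ℕ → ℕ → C} {m n : ℕ} (hw : IsTangle m w n)
    (hg : Consistent g w) (hg' : Consistent g' w')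
    (h0 : ∀ i < m, g 0 i = g' 0 i) (h1 : ∀ i < n, g w.length i = g' w'.length i)
    (ψ : List Bool → K) (x : List Bool) (hx : x.length = m) :
    pull a g w ψ x = pull a g' w' ψ x := by
  cases hm with
  | exchange l k r p q =>
    obtain ⟨rfl, -⟩ := hw
    simp only [pull, id]
    have e1 : pieceOp a p (g 0 l) (g 0 (l + 1)) = pieceOp a p (g' 1 l) (g' 1 (l + 1)) := by
      refine pieceOp_congr a fun hp => ?_
      have j1 := hg' _ _ (.leftStrand 0 _ l rfl (by simp [hp]; omega))
      have j2 := hg' _ _ (.leftStrand 0 _ (l + 1) rfl (by simp [hp]; omega))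
      rw [h0 l (by simp [Slice.dom, hp]; omega), h0 (l + 1) (by simp [Slice.dom, hp]; omega)]
      exact ⟨j1, j2⟩
    have e2 : pieceOp a q (g 1 (l + p.cod + k)) (g 1 (l + p.cod + k + 1)) =
        pieceOp a q (g' 0 (l + p.dom + k)) (g' 0 (l + p.dom + k + 1)) := by
      refine pieceOp_congr a fun hq => ?_
      have j1 := hg _ _ (.rightStrand 0 _ k rfl (by simp [hq]; omega))
      have j2 := hg _ _ (.rightStrand 0 _ (k + 1) rfl (by simp [hq]; omega))
      rw [← h0 _ (by simp [Slice.dom, hq]; omega), ← h0 _ (by simp [Slice.dom, hq]; omega)]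
      exact ⟨j1.symm, j2.symm⟩
    rw [e1, e2]
    generalize g' 0 (l + p.dom + k) = c
    generalize g' 0 (l + p.dom + k + 1) = d
    have := lift_comp l (pieceOp a p (g' 1 l) (g' 1 (l + 1)))
      (lift (p.cod + k) (pieceOp a q c d))
    rw [exchange_pieceOp a p _ _ (isLin_pieceOp a q _ _), lift_comp, lift_lift, lift_lift,
      ← Nat.add_assoc, ← Nat.add_assoc] at this
    exact (congrFun (congrFun this ψ) x).symm
  | zigzagLeft l r =>
    obtain ⟨rfl, -⟩ := hw
    have hl : l + 1 ≤ x.length := by simp [hx, Slice.dom, Piece.dom]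
    have := lift_congr (zigzagLeft_op ha) l ψ x hl
    rw [lift_comp, lift_lift, lift_id l ψ x (by omega)] at this
    exact this
  | zigzagRight l r =>
    obtain ⟨rfl, -⟩ := hw
    have hl : l + 1 ≤ x.length := by simp [hx, Slice.dom, Piece.dom]
    have := lift_congr (zigzagRight_op ha) l ψ x hl
    rw [lift_comp, lift_lift, lift_id l ψ x (by omega)] at this
    exact this
  | crossCap l r b =>
    obtain ⟨rfl, -⟩ := hw
    have hl : l + 3 ≤ x.length := by simp [hx, Slice.dom, Piece.dom]
    have j1 := hg _ _ (.leftStrand 0 _ l rfl (by simp))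
    have j2 := hg _ _ (.crossFalling 0 (l + 1) r b rfl)
    have j3 := hg _ _ (.cap 1 l (r + 1) rfl)
    simp only [Nat.zero_add] at j1 j2 j3
    have := lift_congr (crossCap_op ha b (g 0 l) (g 0 (l + 1))) l ψ x hl
    rw [lift_comp, lift_comp, lift_lift, lift_lift] at this
    simp only [pull, id, pieceOp, j2, ← j3, ← j1]
    rw [← h0 l (by simp [Slice.dom]; omega), ← h0 (l + 1) (by simp [Slice.dom, Piece.dom]; omega)]
    exact this
  | cupCross l r b =>
    obtain ⟨rfl, hw⟩ := hw
    obtain ⟨-, rfl⟩ := hw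
    have hl : l + 1 ≤ x.length := by simp [hx, Slice.dom, Piece.dom]
    have j1 := hg _ _ (.rightStrand 0 _ 0 rfl (by simp))
    have j2 := hg _ _ (.crossRising 1 (l + 1) r b rfl)
    have j3 := hg' _ _ (.leftStrand 0 _ l rfl (by simp))
    have j4 := hg' _ _ (.cup 0 (l + 1) r rfl)
    have j5 := hg' _ _ (.rightStrand 1 _ 0 rfl (by simp))
    simp only [Nat.zero_add, Piece.dom, Piece.cod, Nat.add_zero] at j1 j2 j3 j4 j5
    have k1 := h0 l (by simp [Slice.dom, Piece.dom])
    -- The arc of the minimum has no end at the bottom of the strip, so its colours in the two words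
    -- are compared on top.
    have k2 := h1 (l + 2) (by simp [Slice.cod, Piece.cod]; omega)
    simp only [List.length_cons, List.length_nil, Nat.zero_add, Nat.reduceAdd] at k2 j2 j5
    have := lift_congr (cupCross_op ha b (g 1 (l + 1)) (g 1 (l + 2))) l ψ x hl
    rw [lift_comp, lift_comp, lift_lift, lift_lift] at this
    simp only [pull, id, pieceOp, Nat.zero_add]
    have e1 : g' 1 l = g 1 (l + 2) := by rw [← j3, ← k1, j1]
    have e2 : g' 1 (l + 1) = g 1 (l + 1) := by rw [j4, j5, ← k2, j2]
    rw [e1, e2]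
    exact this

theorem pull_reidemeisterMove {a : K} (ha : a ≠ 0) {w w' : List Slice}
    (hm : ReidemeisterMove w w') {g g' : ℕ → ℕ → C} {m n : ℕ} (hw : IsTangle m w n)
    (hg : Consistent g w) (hg' : Consistent g' w')
    (h0 : ∀ i < m, g 0 i = g' 0 i)
    (ψ : List Bool → K) (x : List Bool) (hx : x.length = m) :
    pull a g w ψ x = pull a g' w' ψ x := by
  cases hm with
  | two l r b =>
    obtain ⟨rfl, -⟩ := hw
    have hl : l + 2 ≤ x.length := by simp [hx, Slice.dom, Piece.dom]
    have j1 := hg _ _ (.crossRising 0 l r b rfl)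
    have j2 := hg _ _ (.crossFalling 0 l r b rfl)
    simp only [Nat.zero_add] at j1 j2
    have := lift_congr (two_op ha b (g 0 l) (g 0 (l + 1))) l ψ x hl
    rw [lift_comp, lift_id l ψ x (by omega)] at this
    simp only [pull, id, pieceOp, ← j1, ← j2, Nat.zero_add]
    exact this
  | three l r b₁₂ b₁₃ b₂₃ hb =>
    obtain ⟨rfl, -⟩ := hw
    have hl : l + 3 ≤ x.length := by simp [hx, Slice.dom, Piece.dom]; omega
    have a1 := hg _ _ (.crossRising 0 l (r + 1) b₁₂ rfl)
    have a2 := hg _ _ (.rightStrand 0 _ 0 rfl (by simp))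
    have a3 := hg _ _ (.leftStrand 1 _ l rfl (by simp))
    have a4 := hg _ _ (.crossFalling 0 l (r + 1) b₁₂ rfl)
    have a5 := hg _ _ (.crossFalling 1 (l + 1) r b₁₃ rfl)
    have c1 := hg' _ _ (.leftStrand 0 _ l rfl (by simp))
    have c2 := hg' _ _ (.crossFalling 0 (l + 1) r b₂₃ rfl)
    have c3 := hg' _ _ (.crossRising 1 l (r + 1) b₁₃ rfl)
    have c4 := hg' _ _ (.rightStrand 1 _ 0 rfl (by simp))
    have c5 := hg' _ _ (.crossRising 0 (l + 1) r b₂₃ rfl)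
    simp only [Nat.zero_add, Piece.dom, Piece.cod, Nat.add_zero, Nat.reduceAdd] at a1 a2 a3 a4 a5
    simp only [Nat.zero_add, Piece.dom, Piece.cod, Nat.add_zero, Nat.reduceAdd] at c1 c2 c3 c4 c5
    have h0' : ∀ i < l + 3, g 0 i = g' 0 i := fun i hi =>
      h0 i (by simp [Slice.dom, Piece.dom]; omega)
    have := lift_congr (three_op ha b₁₂ b₁₃ b₂₃ hb (g 0 l) (g 0 (l + 1)) (g 0 (l + 2))) l ψ x hl
    simp only [lift_comp, lift_lift] at this
    simp only [pull, id, pieceOp, Nat.zero_add, Nat.reduceAdd]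
    rw [← a3, ← a4, ← a1, ← a2, ← a5, ← a2, ← c1, ← c2, ← c3, ← c1, ← c4, ← c5,
      ← h0' l (by omega), ← h0' (l + 1) (by omega), ← h0' (l + 1 + 1) (by omega)]
    exact this

end

end TiedLink

namespace TiedLink

/-! ### Invariance when an arc passes through infinity -/

section

variable {K : Type} [Field K] {C : Type} [LinearOrder C]

/-- The raising operator of the strands of colour `c₀`. -/
def raise (a : K) (c₀ : C) : (ℕ → C) → Op K
  | _, _, [] => 0
  | γ, ψ, s :: x =>
    if γ 0 = c₀ then
      (if s then 0 else ψ (true :: x)) +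
        (if s then a ^ 2 else (a ^ 2)⁻¹) *
          raise a c₀ (fun i => γ (i + 1)) (fun y => ψ (s :: y)) x
    else raise a c₀ (fun i => γ (i + 1)) (fun y => ψ (s :: y)) x

theorem raise_congr (a : K) (c₀ : C) {γ γ' : ℕ → C} (ψ : List Bool → K) {x : List Bool}
    (h : ∀ i < x.length, γ i = γ' i) : raise a c₀ γ ψ x = raise a c₀ γ' ψ x := by
  induction x generalizing γ γ' ψ with
  | nil => rfl
  | cons s x ih =>
    simp only [raise, h 0 (by simp)]
    rw [ih (γ := fun i => γ (i + 1)) (γ' := fun i => γ' (i + 1)) _ fun i hi =>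
      h (i + 1) (by simpa using hi)]

theorem isLin_raise (a : K) (c₀ : C) (γ : ℕ → C) : IsLin (raise a c₀ γ) := by
  intro r s ψ ψ' x
  induction x generalizing γ ψ ψ' with
  | nil => simp [raise]
  | cons t x ih =>
    simp only [raise, ih]
    split_ifs <;> ring

/-- `raise` is the coproduct E ⊗ 1 + K ⊗ E of quantum sl₂, felt only by the strands of colour `c₀`.
On a minimum or maximum its contributions cancel. A one-coloured crossing is a combination of the
identity and of `capOp a ∘ cupOp a`, and at a two-coloured crossing at most one strand feels it. -/
theorem raise_pieceOp {a : K} (ha : a ≠ 0) (c₀ : C) (p : Piece) {γ γ' : ℕ → C} {r : ℕ}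
    (hr : ∀ i < r, γ (p.dom + i) = γ' (p.cod + i))
    (hcup : p = .cup → γ' 0 = γ' 1) (hcap : p = .cap → γ 0 = γ 1)
    (hcross : ∀ b, p = .cross b → γ' 1 = γ 0 ∧ γ' 0 = γ 1)
    (ψ : List Bool → K) (x : List Bool) (hx : x.length = p.dom + r) :
    raise a c₀ γ (pieceOp a p (γ 0) (γ 1) ψ) x = pieceOp a p (γ 0) (γ 1) (raise a c₀ γ' ψ) x := by
  have cup : ∀ {γ γ' : ℕ → C} (x : List Bool), (∀ i < x.length, γ i = γ' (i + 2)) →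
      γ' 0 = γ' 1 → ∀ ψ, raise a c₀ γ (cupOp a ψ) x = cupOp a (raise a c₀ γ' ψ) x := by
    intro γ γ' x hr h01 ψ
    have e := isLin_raise a c₀ γ (-a ^ 2) 1 (fun y => ψ (false :: true :: y))
      (fun y => ψ (true :: false :: y)) x
    simp only [one_mul] at e
    have h1 : raise a c₀ γ (cupOp a ψ) x = _ := e
    rw [h1, raise_congr a c₀ _ hr, raise_congr a c₀ _ hr]
    simp only [cupOp, raise, Nat.zero_add, ← h01, Nat.add_assoc, Nat.reduceAdd]
    by_cases h : γ' 0 = c₀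
    · simp [h]; field_simp; ring
    · simp [h]
  have cap : ∀ {γ γ' : ℕ → C} (x : List Bool), (∀ i, i + 2 < x.length → γ (i + 2) = γ' i) →
      γ 0 = γ 1 → 2 ≤ x.length → ∀ ψ,
      raise a c₀ γ (capOp a ψ) x = capOp a (raise a c₀ γ' ψ) x := by
    intro γ γ' x hr h01 hx ψ
    obtain ⟨s, t, x, rfl⟩ : ∃ s t x', x = s :: t :: x' := by
      rcases x with _ | ⟨_, _ | ⟨_, x⟩⟩ <;> simp at hx ⊢
    have hr' : ∀ i < x.length, γ (i + 2) = γ' i := fun i hi => hr i (by simpa using hi)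
    have hz := (isLin_raise a c₀ (fun i => γ (i + 2))).zero x
    have hs := fun r => (isLin_raise a c₀ (fun i => γ (i + 2))).smul r ψ x
    have hc := raise_congr a c₀ ψ hr'
    simp only [raise, Nat.zero_add, ← h01, Nat.add_assoc, Nat.reduceAdd]
    cases s <;> cases t <;> simp only [capOp, hz, hs, hc] <;> by_cases h : γ 0 = c₀ <;>
      simp [h] <;> field_simp
  cases p with
  | cup => exact cup x (fun i hi => by
      simpa [Piece.dom, Piece.cod, Nat.add_comm] using
        hr i (by simpa [hx, Piece.dom] using hi)) (hcup rfl) ψ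
  | cap => exact cap x (fun i hi => by
      simpa [Piece.dom, Piece.cod, Nat.add_comm] using
        hr i (by simp [hx, Piece.dom] at hi; omega)) (hcap rfl) (by simp [hx, Piece.dom]) ψ
  | cross b =>
    obtain ⟨h1, h0⟩ := hcross b rfl
    have hr' : ∀ i, i < r → γ (i + 2) = γ' (i + 2) := fun i hi => by
      simpa [Piece.dom, Piece.cod, Nat.add_comm] using hr i hi
    simp only [Piece.dom] at hx
    by_cases hcd : γ 0 = γ 1
    · have hγ : ∀ i < x.length, γ i = γ' i := by
        intro i hi
        match i with
        | 0 => rw [h0, hcd]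
        | 1 => rw [h1, hcd]
        | i + 2 => exact hr' i (by omega)
      let δ : ℕ → C := fun i => γ (i + 2)
      have k1 := cap (γ := γ) (γ' := δ) x (fun i _ => rfl) hcd (by omega) (cupOp a ψ)
      have k2 : ∀ y : List Bool, raise a c₀ δ (cupOp a ψ) y = cupOp a (raise a c₀ γ ψ) y :=
        fun y => cup y (fun i _ => rfl) hcd ψ
      have k3 : raise a c₀ γ (capOp a (cupOp a ψ)) x =
          capOp a (cupOp a (raise a c₀ γ' ψ)) x := by
        rw [k1, funext k2]
        refine pieceOp_congr_fun a .cap c₀ c₀ fun y hy => ?_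
        refine pieceOp_congr_fun a .cup c₀ c₀ fun z hz => raise_congr a c₀ ψ fun i hi => hγ i ?_
        simp only [Piece.dom, Piece.cod] at hy hz
        omega
      have k4 := raise_congr a c₀ ψ hγ
      have kl := isLin_raise a c₀ γ
      unfold pieceOp crossOp
      cases b
      · simp only [hcd, if_true, cond_false, kl a a⁻¹, k3, k4]
      · simp only [hcd, if_true, cond_true, kl a a⁻¹, k3, k4]
    · obtain ⟨s, t, x, rfl⟩ : ∃ s t x', x = s :: t :: x' := by
        rcases x with _ | ⟨_, _ | ⟨_, x⟩⟩ <;> simp at hx ⊢ <;> omega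
      have hr'' : ∀ i < x.length, γ (i + 2) = γ' (i + 2) := fun i hi =>
        hr' i (by simp at hx; omega)
      have hsw := fun ψ => (isLin_raise a c₀ (fun i => γ (i + 2))).smul
        (crossSign K b (γ 0) (γ 1)) ψ x
      have hc := fun ψ => raise_congr a c₀ ψ hr''
      simp only [pieceOp, raise, crossOp_of_ne a b hcd, Nat.zero_add, h0, h1, Nat.add_assoc,
        Nat.reduceAdd, hsw, hc]
      by_cases h : γ 0 = c₀
      · have h' : γ 1 ≠ c₀ := fun h' => hcd (h.trans h'.symm)
        simp only [h, h', if_true, if_false]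
        cases s <;> cases t <;> simp <;> ring
      · by_cases h' : γ 1 = c₀
        · simp only [h, h', if_true, if_false]
          cases s <;> cases t <;> simp <;> ring
        · simp [h, h']

theorem raise_lift {a : K} (ha : a ≠ 0) (c₀ : C) (l : ℕ) (p : Piece) {γ γ' : ℕ → C} {r : ℕ}
    (hl : ∀ i < l, γ i = γ' i) (hr : ∀ i < r, γ (l + p.dom + i) = γ' (l + p.cod + i))
    (hcup : p = .cup → γ' l = γ' (l + 1)) (hcap : p = .cap → γ l = γ (l + 1))
    (hcross : ∀ b, p = .cross b → γ' (l + 1) = γ l ∧ γ' l = γ (l + 1))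
    (ψ : List Bool → K) (x : List Bool) (hx : x.length = l + p.dom + r) :
    raise a c₀ γ (lift l (pieceOp a p (γ l) (γ (l + 1))) ψ) x =
      lift l (pieceOp a p (γ l) (γ (l + 1))) (raise a c₀ γ' ψ) x := by
  induction l generalizing γ γ' ψ x with
  | zero => exact raise_pieceOp ha c₀ p (by simpa using hr) hcup hcap hcross ψ x (by simpa using hx)
  | succ l ih =>
    cases x with
    | nil => rfl
    | cons s x =>
      have key := ih (γ := fun i => γ (i + 1)) (γ' := fun i => γ' (i + 1))
        (fun i hi => hl (i + 1) (by omega))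
        (fun i hi => by
          have := hr i hi
          rwa [show l + 1 + p.dom + i = l + p.dom + i + 1 by omega,
            show l + 1 + p.cod + i = l + p.cod + i + 1 by omega] at this)
        hcup hcap hcross (fun y => ψ (s :: y)) x (by simp at hx; omega)
      have lin := (isLin_pieceOp a p (γ (l + 1)) (γ (l + 1 + 1))).lift l
      simp only [raise, lift] at key ⊢
      rw [key, hl 0 (by omega)]
      by_cases h : γ' 0 = c₀
      · simp only [h, if_true]
        cases s
        · have := lin 1 (a ^ 2)⁻¹ (fun y => ψ (true :: y))
            (raise a c₀ (fun i => γ' (i + 1)) (fun y => ψ (false :: y))) x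
          simpa using this.symm
        · have := lin.smul (a ^ 2)
            (raise a c₀ (fun i => γ' (i + 1)) (fun y => ψ (true :: y))) x
          simpa using this.symm
      · simp only [h, if_false]

theorem raise_pull {a : K} (ha : a ≠ 0) (c₀ : C) {w : List Slice} {m n : ℕ}
    (hw : IsTangle m w n) {g : ℕ → ℕ → C} (hg : Consistent g w) (ψ : List Bool → K)
    (x : List Bool) (hx : x.length = m) :
    raise a c₀ (g 0) (pull a g w ψ) x = pull a g w (raise a c₀ (g w.length) ψ) x := by
  induction w generalizing g m x with
  | nil => rfl
  | cons s w ih =>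
    obtain ⟨rfl, hw⟩ := hw
    simp only [pull]
    rw [raise_lift ha c₀ s.left s.piece (γ := g 0) (γ' := g 1) (r := s.right)
      (fun i hi => hg _ _ (.leftStrand 0 s i rfl hi))
      (fun i hi => hg _ _ (.rightStrand 0 s i rfl hi)) ?_ ?_ ?_ _ x hx]
    · refine lift_pieceOp_congr_fun a _ _ _ _ fun y hy => ih hw hg.tail y ?_
      simp only [hx, Slice.dom, Slice.cod] at hy ⊢
      omega
    · obtain ⟨l, p, r⟩ := s
      rintro ⟨⟩
      exact hg _ _ (.cup 0 l r rfl)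
    · obtain ⟨l, p, r⟩ := s
      rintro ⟨⟩
      exact hg _ _ (.cap 0 l r rfl)
    · obtain ⟨l, p, r⟩ := s
      rintro b ⟨⟩
      exact ⟨(hg _ _ (.crossRising 0 l r b rfl)).symm, (hg _ _ (.crossFalling 0 l r b rfl)).symm⟩

/-- The diagonal of the operator of a tangle with one end at the bottom and one at the top is
constant. -/
theorem pull_diagonal {a : K} (ha : a ≠ 0) {w : List Slice} (hw : IsTangle 1 w 1)
    {g : ℕ → ℕ → C} (hg : Consistent g w) (hc : g 0 0 = g w.length 0) :
    pull a g w (fun y => if y = [true] then 1 else 0) [true] =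
      pull a g w (fun y => if y = [false] then 1 else 0) [false] := by
  -- Applied to the indicator of spin `true` and evaluated at spin `false`, the commutation relation
  -- equates the two diagonal entries. By `hc` the raising operator acts on both ends of the tangle.
  have key := raise_pull ha (g 0 0) hw hg (fun y => if y = [true] then 1 else 0) [false] rfl
  rw [pull_congr_fun a g hw (ψ' := fun y => if y = [false] then 1 else 0) ?_ rfl] at key
  · simpa [raise] using key
  · intro y hy
    obtain ⟨s, rfl⟩ := List.length_eq_one_iff.1 hy
    cases s <;> simp [raise, hc]

/-! ### Spectator strands and the two closures of a tangle. -/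

theorem lift_append (a : K) (l : ℕ) (p : Piece) (c d : C) (ψ : List Bool → K) (t : Bool)
    {x : List Bool} (hx : l + p.dom ≤ x.length) :
    lift l (pieceOp a p c d) ψ (x ++ [t]) =
      lift l (pieceOp a p c d) (fun y => ψ (y ++ [t])) x := by
  induction l generalizing ψ x with
  | zero =>
    simp only [Nat.zero_add] at hx
    cases p with
    | cup => rfl
    | cap =>
      rcases x with _ | ⟨s, _ | ⟨u, x⟩⟩ <;> simp [Piece.dom] at hx
      cases s <;> cases u <;> rfl
    | cross b =>
      rcases x with _ | ⟨s, _ | ⟨u, x⟩⟩ <;> simp [Piece.dom] at hx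
      cases s <;> cases u <;> rfl
  | succ l ih =>
    cases x with
    | nil => simp at hx
    | cons s x => exact ih (fun y => ψ (s :: y)) (by simp at hx; omega)

theorem pull_addRight (a : K) (g : ℕ → ℕ → C) {w : List Slice} {m n : ℕ} (hw : IsTangle m w n)
    (ψ : List Bool → K) (t : Bool) {x : List Bool} (hx : x.length = m) :
    pull a g (addRight w) ψ (x ++ [t]) = pull a g w (fun y => ψ (y ++ [t])) x := by
  induction w generalizing g m x with
  | nil => rfl
  | cons s w ih =>
    obtain ⟨rfl, hw⟩ := hw
    simp only [addRight, List.map_cons, pull]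
    rw [lift_append a _ _ _ _ _ _ (by simp [hx, Slice.dom])]
    refine lift_pieceOp_congr_fun a _ _ _ _ fun y hy => ih _ hw ?_
    simp only [hx, Slice.dom, Slice.cod] at hy ⊢
    omega

theorem pull_addLeft (a : K) (g : ℕ → ℕ → C) (w : List Slice)
    (ψ : List Bool → K) (t : Bool) (x : List Bool) :
    pull a g (addLeft w) ψ (t :: x) =
      pull a (fun k i => g k (i + 1)) w (fun y => ψ (t :: y)) x := by
  induction w generalizing g x with
  | nil => rfl
  | cons s w ih =>
    simp only [addLeft, List.map_cons, pull, lift]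
    congr 1
    funext y
    exact ih _ y

omit [LinearOrder C] in
theorem consistent_addRight {g : ℕ → ℕ → C} {w : List Slice} (h : Consistent g (addRight w))
    {m n : ℕ} (hw : IsTangle m w n) : g 0 m = g w.length n := by
  induction w generalizing g m with
  | nil => obtain rfl : m = n := hw
           rfl
  | cons s w ih =>
    obtain ⟨rfl, hw⟩ := hw
    have := h _ _ (.rightStrand 0 _ s.right rfl (Nat.lt_succ_self _))
    exact this.trans (ih (g := fun k => g (k + 1)) h.tail hw)

omit [LinearOrder C] in
theorem Consistent.of_addLeft {g : ℕ → ℕ → C} {w : List Slice} (h : Consistent g (addLeft w)) :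
    Consistent (fun k i => g k (i + 1)) w := by
  have key : ∀ {k : ℕ} {s : Slice}, w[k]? = some s →
      (addLeft w)[k]? = some ⟨s.left + 1, s.piece, s.right⟩ := fun {k s} hs => by
    simp [addLeft, hs]
  intro p q hj
  cases hj with
  | leftStrand k s i hs hi => exact h _ _ (.leftStrand k _ (i + 1) (key hs) (Nat.succ_lt_succ hi))
  | rightStrand k s i hs hi =>
    have := h _ _ (.rightStrand k _ i (key hs) hi)
    simp only at this ⊢
    rwa [show s.left + 1 + s.piece.dom + i = s.left + s.piece.dom + i + 1 by omega,
      show s.left + 1 + s.piece.cod + i = s.left + s.piece.cod + i + 1 by omega] at this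
  | cup k l r hs => exact h _ _ (.cup k _ _ (key hs))
  | cap k l r hs => exact h _ _ (.cap k _ _ (key hs))
  | crossRising k l r b hs => exact h _ _ (.crossRising k _ _ b (key hs))
  | crossFalling k l r b hs => exact h _ _ (.crossFalling k _ _ b (key hs))

/-- Minima and maxima pair opposite spins, so only the diagonal entries of the tangle matter. The
two closures weigh them by -a² and -a⁻² in opposite orders, which by `pull_diagonal` makes no
difference. -/
theorem pull_closure {a : K} (ha : a ≠ 0) {w : List Slice} (hw : IsTangle 1 w 1)
    {g g' : ℕ → ℕ → C} (hg : Consistent g (rightClosure w))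
    (hg' : Consistent g' (leftClosure w))
    (h : ∀ k i, k ≤ w.length → i < widthAt 1 w k → g (k + 1) i = g' (k + 1) (i + 1)) :
    pull a g (rightClosure w) (fun _ => 1) [] = pull a g' (leftClosure w) (fun _ => 1) [] := by
  have hG : Consistent (fun k i => g' (k + 1) (i + 1)) w := by
    have := Consistent.append_left (w := addLeft w) hg'.tail
    exact this.of_addLeft
  have hcap := Consistent.append_right (u := [⟨0, .cup, 0⟩] ++ addRight w) hg _ _ (.cap 0 0 0 rfl)
  have hcup := hg _ _ (.cup 0 0 0 rfl)
  have hstrand := consistent_addRight (Consistent.append_left (w := addRight w) hg.tail) hw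
  have hlen : (addRight w).length = w.length := by simp [addRight]
  simp only [List.length_append, List.length_cons, List.length_nil, hlen, Nat.zero_add,
    Nat.add_zero, Nat.add_comm 1] at hcap hcup hstrand
  have hwl : widthAt 1 w w.length = 1 := widthAt_length hw
  -- The closing arc joins the two ends of the tangle, so they have the same colour.
  have hc : g' 1 1 = g' (w.length + 1) 1 := by
    rw [← h 0 0 (by simp) (by simp [widthAt_zero]), ← h w.length 0 le_rfl (by simp [hwl]), hcup,
      hcap]
    exact hstrand
  have hdiag := pull_diagonal ha hw hG hc
  have hpull : pull a (fun k => g (k + 1)) w = pull a (fun k i => g' (k + 1) (i + 1)) w :=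
    pull_congr_colour a hw h
  set T := pull a (fun k i => g' (k + 1) (i + 1)) w with hT
  have hTl : IsLin T := isLin_pull a _ w
  have hTc : ∀ {ψ ψ' : List Bool → K} (s : Bool), (∀ t, ψ [t] = ψ' [t]) → T ψ [s] = T ψ' [s] :=
    fun s hψ => pull_congr_fun a _ hw (fun y hy => by
      obtain ⟨t, rfl⟩ := List.length_eq_one_iff.1 hy; exact hψ t) rfl
  have e1 : ∀ (φ : List Bool → K) (s t : Bool),
      pull a (fun k => g (k + 1)) (addRight w) φ [s, t] = T (fun y => φ (y ++ [t])) [s] :=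
    fun φ s t => by
      rw [← hpull]
      exact pull_addRight a _ hw φ t (x := [s]) rfl
  have e2 : ∀ (φ : List Bool → K) (s t : Bool),
      pull a (fun k => g' (k + 1)) (addLeft w) φ [s, t] = T (fun y => φ (s :: y)) [t] :=
    fun φ s t => pull_addLeft a _ w φ s [t]
  have r1 : pull a g (rightClosure w) (fun _ => 1) [] =
      cupOp a (pull a (fun k => g (k + 1)) (addRight w) (capOp a fun _ => 1)) [] := by
    simp only [rightClosure, List.cons_append, List.nil_append, pull,
      pull_append, lift, pieceOp, id]
  have r2 : pull a g' (leftClosure w) (fun _ => 1) [] =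
      cupOp a (pull a (fun k => g' (k + 1)) (addLeft w) (capOp a fun _ => 1)) [] := by
    simp only [leftClosure, List.cons_append, List.nil_append, pull,
      pull_append, lift, pieceOp, id]
  set χ : Bool → List Bool → K := fun s y => if y = [s] then 1 else 0 with hχ
  have k1 : T (fun y => capOp a (fun _ => 1) (y ++ [true])) [false] = T (χ false) [false] :=
    hTc _ fun t => by cases t <;> simp [hχ, capOp]
  have k2 : T (fun y => capOp a (fun _ => 1) (y ++ [false])) [true] =
      -(a ^ 2)⁻¹ * T (χ true) [true] := by
    rw [← hTl.smul]
    exact hTc _ fun t => by cases t <;> simp [hχ, capOp]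
  have k3 : T (fun y => capOp a (fun _ => 1) (false :: y)) [true] = T (χ true) [true] :=
    hTc _ fun t => by cases t <;> simp [hχ, capOp]
  have k4 : T (fun y => capOp a (fun _ => 1) (true :: y)) [false] =
      -(a ^ 2)⁻¹ * T (χ false) [false] := by
    rw [← hTl.smul]
    exact hTc _ fun t => by cases t <;> simp [hχ, capOp]
  have hdiag' : T (χ true) [true] = T (χ false) [false] := hdiag
  rw [r1, r2]
  simp only [cupOp, e1, e2, k1, k2, k3, k4, hdiag']

end

end TiedLink

namespace TiedLink

open MorseDiagram

/-! ### Corresponding colourings -/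

section

variable {C : Type}

theorem IsTangle.unique {m n n' : ℕ} {w : List Slice} (h : IsTangle m w n)
    (h' : IsTangle m w n') : n = n' := by
  induction w generalizing m with
  | nil => exact (show m = n from h).symm.trans h'
  | cons s w ih => exact ih h.2 h'.2

theorem IsTangle.unique_left {m m' n : ℕ} {w : List Slice} (h : IsTangle m w n)
    (h' : IsTangle m' w n) : m = m' := by
  cases w with
  | nil => exact (show m = n from h).trans (show m' = n from h').symm
  | cons s w => exact h.1.symm.trans h'.1

/-- A colouring of the classes of points as a colouring of the points. -/
noncomputable def colouring [Inhabited C] (D : MorseDiagram) (f : Quotient D.tied → C) :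
    ℕ → ℕ → C := fun k i => (D.class? k i).elim default f

theorem class?_point (D : MorseDiagram) (p : D.Pt) :
    D.class? p.1.1 p.1.2 = some (Quotient.mk _ p) := by
  have : IsPoint D.word (p.1.1, p.1.2) := p.2
  rw [class?, dif_pos this]
  rfl

theorem colouring_point [Inhabited C] (D : MorseDiagram) (f : Quotient D.tied → C) (p : D.Pt) :
    colouring D f p.1.1 p.1.2 = f (Quotient.mk _ p) := by
  simp [colouring, class?_point]

theorem consistent_colouring [Inhabited C] (D : MorseDiagram) (f : Quotient D.tied → C) :
    Consistent (colouring D f) D.word := fun p q hj => by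
  simp only [colouring, D.consistent_class? p q hj]

/-- Corresponding points define an injection of classes. -/
theorem exists_embedding_of_tiesAgree {D D' : MorseDiagram} {R : ℕ × ℕ → ℕ × ℕ → Prop}
    (h : TiesAgree R D D') (hD : ∀ p : D.Pt, ∃ (p₀ : D.Pt) (p' : D'.Pt), D.tied p p₀ ∧ R p₀.1 p'.1) :
    ∃ e : Quotient D.tied → Quotient D'.tied, Function.Injective e ∧
      ∀ (p : D.Pt) (p' : D'.Pt), R p.1 p'.1 → e (Quotient.mk _ p) = Quotient.mk _ p' := by
  choose b b' hb hR using hD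
  refine ⟨Quotient.lift (fun p => Quotient.mk _ (b' p)) fun p q hpq => Quotient.sound
    ((h _ _ _ _ (hR p) (hR q)).1 (D.tied.trans (D.tied.symm (hb p))
      (D.tied.trans hpq (hb q)))), ?_, ?_⟩
  · rintro ⟨p⟩ ⟨q⟩ hpq
    have hpq' := Quotient.exact (show Quotient.mk _ (b' p) = Quotient.mk _ (b' q) from hpq)
    exact Quotient.sound (D.tied.trans (hb p) (D.tied.trans
      ((h _ _ _ _ (hR p) (hR q)).2 hpq') (D.tied.symm (hb q))))
  · intro p p' hp
    exact Quotient.sound ((h _ _ _ _ (hR p) hp).1 (D.tied.symm (hb p)))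

theorem exists_equiv_of_tiesAgree {D D' : MorseDiagram} {R : ℕ × ℕ → ℕ × ℕ → Prop}
    (h : TiesAgree R D D') (hD : ∀ p : D.Pt, ∃ (p₀ : D.Pt) (p' : D'.Pt), D.tied p p₀ ∧ R p₀.1 p'.1)
    (hD' : ∀ p' : D'.Pt, ∃ (p : D.Pt) (p₀' : D'.Pt), D'.tied p' p₀' ∧ R p.1 p₀'.1) :
    ∃ e : Quotient D.tied ≃ Quotient D'.tied,
      ∀ (p : D.Pt) (p' : D'.Pt), R p.1 p'.1 → e (Quotient.mk _ p) = Quotient.mk _ p' := by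
  obtain ⟨e, he, hR⟩ := exists_embedding_of_tiesAgree h hD
  refine ⟨Equiv.ofBijective e ⟨he, ?_⟩, hR⟩
  rintro ⟨p'⟩
  obtain ⟨p, p₀', h1, h2⟩ := hD' p'
  exact ⟨Quotient.mk _ p, (hR p p₀' h2).trans (Quotient.sound (D'.tied.symm h1))⟩

/-! ### Tie classes and colourings under the replacement of a strip. -/

/-- The words of two diagrams that differ in a strip. -/
structure Strip (u w w' v : List Slice) (m n : ℕ) : Prop where
  bottom : IsTangle 0 u m
  left : IsTangle m w n
  right : IsTangle m w' n
  top : IsTangle n v 0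

theorem MorseDiagram.Replace.strip {D D' : MorseDiagram} {u w w' v : List Slice}
    (h : Replace u w w' v D D') : ∃ m n, Strip u w w' v m n := by
  obtain ⟨hD, hD', -⟩ := h
  have c := D.closed
  have c' := D'.closed
  rw [hD] at c
  rw [hD'] at c'
  obtain ⟨n, h1, hv⟩ := isTangle_append.1 c
  obtain ⟨m, hu, hw⟩ := isTangle_append.1 h1
  obtain ⟨n', h1', hv'⟩ := isTangle_append.1 c'
  obtain ⟨m', hu', hw'⟩ := isTangle_append.1 h1'
  obtain rfl := hu.unique hu'
  obtain rfl := hv.unique_left hv'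
  exact ⟨m, n, hu, hw, hw', hv⟩

/-- Colourings that agree outside of a strip. -/
def AgreeOutside (u w w' v : List Slice) (n : ℕ) (g g' : ℕ → ℕ → C) : Prop :=
  (∀ k i, k ≤ u.length → i < widthAt 0 u k → g k i = g' k i) ∧
    ∀ k i, k ≤ v.length → i < widthAt n v k →
      g (u.length + w.length + k) i = g' (u.length + w'.length + k) i

theorem isPoint_bottom {u w : List Slice} {k i : ℕ} (hk : k ≤ u.length)
    (hi : i < widthAt 0 u k) : IsPoint (u ++ w) (k, i) :=
  ⟨by simp; omega, by simpa [widthAt_append_left hk] using hi⟩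

theorem isPoint_top {u w v : List Slice} {m n : ℕ} (hu : IsTangle 0 u m) (hw : IsTangle m w n)
    {k i : ℕ} (hk : k ≤ v.length) (hi : i < widthAt n v k) :
    IsPoint (u ++ w ++ v) (u.length + w.length + k, i) := by
  have huw : IsTangle 0 (u ++ w) n := isTangle_append.2 ⟨m, hu, hw⟩
  refine ⟨by simp; omega, ?_⟩
  have := widthAt_append_right (v := v) huw k
  rw [List.length_append] at this
  simpa only [this] using hi

/-- The level is not strictly inside the strip. -/
def Outer (u w : List Slice) (k : ℕ) : Prop := k ≤ u.length ∨ u.length + w.length ≤ k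

theorem exists_outside {D D' : MorseDiagram} {u w w' v : List Slice}
    (h : Replace u w w' v D D') (p : D.Pt) (hp : Outer u w p.1.1) :
    ∃ p' : D'.Pt, outside u.length w.length w'.length p.1 p'.1 := by
  obtain ⟨m, n, hs⟩ := h.strip
  obtain ⟨hD, hD', -⟩ := h
  obtain ⟨⟨k, i⟩, hk, hi⟩ := p
  simp only at hk hi hp
  rw [hD] at hk hi
  simp only [List.length_append] at hk
  rcases hp with hp | hp
  · refine ⟨⟨(k, i), ?_⟩, .inl ⟨hp, rfl⟩⟩
    rw [hD', List.append_assoc]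
    rw [List.append_assoc, widthAt_append_left hp] at hi
    exact isPoint_bottom hp hi
  · obtain ⟨k, rfl⟩ := Nat.exists_eq_add_of_le hp
    refine ⟨⟨(u.length + w'.length + k, i), ?_⟩, .inr ⟨k, i, rfl, rfl⟩⟩
    rw [hD']
    have := widthAt_append_right (v := v) (isTangle_append.2 ⟨m, hs.bottom, hs.left⟩) k
    rw [List.length_append] at this
    rw [this] at hi
    exact isPoint_top hs.bottom hs.right (by omega) hi

theorem outside_symm {n i j : ℕ} {p p' : ℕ × ℕ} (h : outside n i j p p') : outside n j i p' p := by
  rcases h with ⟨h, rfl⟩ | ⟨k, x, rfl, rfl⟩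
  · exact .inl ⟨h, rfl⟩
  · exact .inr ⟨k, x, rfl, rfl⟩

theorem MorseDiagram.Replace.symm {D D' : MorseDiagram} {u w w' v : List Slice}
    (h : Replace u w w' v D D') : Replace u w' w v D' D :=
  ⟨h.2.1, h.1, fun p q p' q' hp hq => (h.2.2 p' q' p q (outside_symm hp) (outside_symm hq)).symm⟩

/-- Every point is tied to a point outside of the strip. -/
def TiedOutside (D : MorseDiagram) (u w : List Slice) : Prop :=
  ∀ p : D.Pt, ∃ p₀ : D.Pt, D.tied p p₀ ∧ Outer u w p₀.1.1

theorem agreeOutside_of_forall {D D' : MorseDiagram} {u w w' v : List Slice}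
    (h : Replace u w w' v D D') {m n : ℕ} (hs : Strip u w w' v m n) {g g' : ℕ → ℕ → C}
    (hg : ∀ (p : D.Pt) (p' : D'.Pt), outside u.length w.length w'.length p.1 p'.1 →
      g p.1.1 p.1.2 = g' p'.1.1 p'.1.2) : AgreeOutside u w w' v n g g' := by
  obtain ⟨hD, hD', -⟩ := h
  refine ⟨fun k i hk hi => ?_, fun k i hk hi => ?_⟩
  · have i1 : IsPoint D.word (k, i) := by
      rw [hD, List.append_assoc]; exact isPoint_bottom hk hi
    have i2 : IsPoint D'.word (k, i) := by
      rw [hD', List.append_assoc]; exact isPoint_bottom hk hi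
    exact hg ⟨_, i1⟩ ⟨_, i2⟩ (.inl ⟨hk, rfl⟩)
  · have i1 : IsPoint D.word (u.length + w.length + k, i) := by
      rw [hD]; exact isPoint_top hs.bottom hs.left hk hi
    have i2 : IsPoint D'.word (u.length + w'.length + k, i) := by
      rw [hD']; exact isPoint_top hs.bottom hs.right hk hi
    exact hg ⟨_, i1⟩ ⟨_, i2⟩ (.inr ⟨k, i, rfl, rfl⟩)

/-- `Replace` compares the ties only outside of the strip. If every inner point is tied to an outer
one, no class is hidden in the strip, and the classes of the two diagrams correspond. -/
theorem MorseDiagram.Replace.exists_equiv {D D' : MorseDiagram} {u w w' v : List Slice}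
    (h : Replace u w w' v D D') {m n : ℕ} (hs : Strip u w w' v m n) (hD : TiedOutside D u w)
    (hD' : TiedOutside D' u w') :
    ∃ e : Quotient D.tied ≃ Quotient D'.tied,
      ∀ (C : Type) [Inhabited C] (f : Quotient D.tied → C),
      AgreeOutside u w w' v n (colouring D f) (colouring D' (f ∘ e.symm)) := by
  obtain ⟨e, he⟩ := exists_equiv_of_tiesAgree h.2.2 (fun p => by
      obtain ⟨p₀, h1, h2⟩ := hD p
      obtain ⟨p', h3⟩ := exists_outside h p₀ h2
      exact ⟨p₀, p', h1, h3⟩) (fun p' => by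
      obtain ⟨p₀, h1, h2⟩ := hD' p'
      obtain ⟨p, h3⟩ := exists_outside h.symm p₀ h2
      exact ⟨p, p₀, h1, outside_symm h3⟩)
  refine ⟨e, fun C _ f => agreeOutside_of_forall h hs fun p p' hp => ?_⟩
  rw [colouring_point, colouring_point, ← he p p' hp]
  simp

/-! ### Points inside a strip -/

/-- The strand through the `i`-th point on top of the slice goes down through the slice. -/
def Slice.Descends (s : Slice) (i : ℕ) : Prop :=
  i < s.cod ∧ (s.piece = .cup → i ≠ s.left ∧ i ≠ s.left + 1)

/-- The strand through the `i`-th point at the bottom of the slice goes up through the slice. -/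
def Slice.Ascends (s : Slice) (i : ℕ) : Prop :=
  i < s.dom ∧ (s.piece = .cap → i ≠ s.left ∧ i ≠ s.left + 1)

theorem Slice.Descends.exists_joined {s : Slice} {i : ℕ} (h : s.Descends i) {w : List Slice}
    {k : ℕ} (hs : w[k]? = some s) : ∃ j, Joined w (k, j) (k + 1, i) := by
  obtain ⟨h1, h2⟩ := h
  rcases lt_or_ge i s.left with hi | hi
  · exact ⟨i, .leftStrand k s i hs hi⟩
  rcases lt_or_ge i (s.left + s.piece.cod) with hi' | hi'
  · obtain ⟨l, p, r⟩ := s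
    cases p with
    | cup => simp [Piece.cod] at h2 hi hi'; omega
    | cap => simp [Piece.cod] at hi hi'; omega
    | cross b =>
      simp only [Piece.cod] at hi hi'
      obtain rfl | rfl : i = l ∨ i = l + 1 := by omega
      · exact ⟨_, .crossFalling k _ r b hs⟩
      · exact ⟨_, .crossRising k _ r b hs⟩
  · obtain ⟨j, rfl⟩ := Nat.exists_eq_add_of_le hi'
    simp only [Slice.cod] at h1
    exact ⟨_, .rightStrand k s j hs (by omega)⟩

theorem Slice.Ascends.exists_joined {s : Slice} {i : ℕ} (h : s.Ascends i) {w : List Slice}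
    {k : ℕ} (hs : w[k]? = some s) : ∃ j, Joined w (k, i) (k + 1, j) := by
  obtain ⟨h1, h2⟩ := h
  rcases lt_or_ge i s.left with hi | hi
  · exact ⟨i, .leftStrand k s i hs hi⟩
  rcases lt_or_ge i (s.left + s.piece.dom) with hi' | hi'
  · obtain ⟨l, p, r⟩ := s
    cases p with
    | cup => simp [Piece.dom] at hi hi'; omega
    | cap => simp [Piece.dom] at h2 hi hi'; omega
    | cross b =>
      simp only [Piece.dom] at hi hi'
      obtain rfl | rfl : i = l ∨ i = l + 1 := by omega
      · exact ⟨_, .crossRising k _ r b hs⟩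
      · exact ⟨_, .crossFalling k _ r b hs⟩
  · obtain ⟨j, rfl⟩ := Nat.exists_eq_add_of_le hi'
    simp only [Slice.dom] at h1
    exact ⟨_, .rightStrand k s j hs (by omega)⟩

theorem exists_tied_of_joined {D : MorseDiagram} {p : D.Pt} {q : ℕ × ℕ}
    (h : Joined D.word p.1 q ∨ Joined D.word q p.1) : ∃ q' : D.Pt, q'.1 = q ∧ D.tied p q' := by
  rcases h with h | h
  · exact ⟨⟨q, (h.isPoint D.closed).2⟩, rfl, D.tied_of_joined _ _ h⟩
  · exact ⟨⟨q, (h.isPoint D.closed).1⟩, rfl, D.tied.symm (D.tied_of_joined _ _ h)⟩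

theorem tiedOutside_of_length_le {D : MorseDiagram} {u w : List Slice} (hw : w.length ≤ 1) :
    TiedOutside D u w := fun p => ⟨p, D.tied.refl _, by unfold Outer; omega⟩

theorem getElem?_strip {u w v : List Slice} {k : ℕ} (hk : k < w.length) :
    (u ++ w ++ v)[u.length + k]? = some w[k] := by
  rw [List.append_assoc, List.getElem?_append_right (by omega), Nat.add_sub_cancel_left,
    List.getElem?_append_left hk, List.getElem?_eq_getElem hk]

theorem lt_of_point {D : MorseDiagram} {p : D.Pt} {k : ℕ} {s : Slice} (hs : D.word[k]? = some s)
    (hp : p.1.1 = k + 1) : p.1.2 < s.cod := by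
  have h := p.2.2
  change p.1.2 < widthAt 0 D.word p.1.1 at h
  rwa [hp, (widthAt_of_getElem? D.closed hs).2] at h

theorem exists_tied_of_descends {D : MorseDiagram} {k : ℕ} {s : Slice} (hs : D.word[k]? = some s)
    {p : D.Pt} (hp : p.1.1 = k + 1) (h : s.Descends p.1.2) :
    ∃ q : D.Pt, D.tied p q ∧ q.1.1 = k := by
  obtain ⟨j, hj⟩ := h.exists_joined hs
  obtain ⟨q, hq, ht⟩ := exists_tied_of_joined (p := p) (q := (k, j)) (.inr (by
    rwa [show p.1 = (k + 1, p.1.2) from Prod.ext hp rfl]))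
  exact ⟨q, ht, by rw [hq]⟩

theorem exists_tied_of_ascends {D : MorseDiagram} {k : ℕ} {s : Slice} (hs : D.word[k]? = some s)
    {p : D.Pt} (hp : p.1.1 = k) (h : s.Ascends p.1.2) :
    ∃ q : D.Pt, D.tied p q ∧ q.1.1 = k + 1 := by
  obtain ⟨j, hj⟩ := h.exists_joined hs
  obtain ⟨q, hq, ht⟩ := exists_tied_of_joined (p := p) (q := (k + 1, j)) (.inl (by
    rwa [show p.1 = (k, p.1.2) from Prod.ext hp rfl]))
  exact ⟨q, ht, by rw [hq]⟩

/-- The point on the middle level of two slices is joined to another level. -/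
def Leaves (s t : Slice) (i : ℕ) : Prop := s.Descends i ∨ t.Ascends i

theorem exists_tied_of_leaves {D : MorseDiagram} {u v : List Slice} {s t : Slice}
    (hw : D.word = u ++ [s, t] ++ v) {p : D.Pt} (hp : p.1.1 = u.length + 1)
    (h : Leaves s t p.1.2) : ∃ p₀ : D.Pt, D.tied p p₀ ∧ Outer u [s, t] p₀.1.1 := by
  have hs : D.word[u.length + 0]? = some s := by
    rw [hw]; exact getElem?_strip (w := [s, t]) (by simp)
  have ht : D.word[u.length + 1]? = some t := by
    rw [hw]; exact getElem?_strip (w := [s, t]) (by simp)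
  rcases h with h | h
  · obtain ⟨q, h1, h2⟩ := exists_tied_of_descends hs hp h
    exact ⟨q, h1, .inl (by omega)⟩
  · obtain ⟨q, h1, h2⟩ := exists_tied_of_ascends ht hp h
    exact ⟨q, h1, .inr (by simp; omega)⟩

theorem tiedOutside_pair {D : MorseDiagram} {u v : List Slice} {s t : Slice}
    (hw : D.word = u ++ [s, t] ++ v)
    (h : ∀ p : D.Pt, p.1.1 = u.length + 1 → Leaves s t p.1.2 ∨
      ∃ q : D.Pt, D.tied p q ∧ q.1.1 = u.length + 1 ∧ Leaves s t q.1.2) :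
    TiedOutside D u [s, t] := by
  intro p
  by_cases hp : p.1.1 = u.length + 1
  · rcases h p hp with h | ⟨q, h1, h2, h3⟩
    · exact exists_tied_of_leaves hw hp h
    · obtain ⟨p₀, h4, h5⟩ := exists_tied_of_leaves hw h2 h3
      exact ⟨p₀, D.tied.trans h1 h4, h5⟩
  · exact ⟨p, D.tied.refl _, by unfold Outer; simp; omega⟩

theorem tiedOutside_pair_of_leaves {D : MorseDiagram} {u v : List Slice} {s t : Slice}
    (hw : D.word = u ++ [s, t] ++ v)
    (h : ∀ i < s.cod, Leaves s t i) : TiedOutside D u [s, t] :=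
  tiedOutside_pair hw fun p hp => .inl (h _ (lt_of_point (k := u.length + 0) (by
    rw [hw]; exact getElem?_strip (w := [s, t]) (by simp)) hp))

/-- There is at most one level strictly inside the strip. Its points leave it directly upwards or
downwards, except for the middle point of a zigzag. -/
theorem tiedOutside_planarMove {D : MorseDiagram} {u w w' v : List Slice}
    (hm : PlanarMove w w') :
    (D.word = u ++ w ++ v → TiedOutside D u w) ∧ (D.word = u ++ w' ++ v → TiedOutside D u w') := by
  have tangle : ∀ {s t : Slice}, D.word = u ++ [s, t] ++ v → t.dom = s.cod := by
    intro s t hw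
    have h1 := (widthAt_of_getElem? D.closed (k := u.length + 0) (s := s) (by
      rw [hw]; exact getElem?_strip (w := [s, t]) (by simp))).2
    have h2 := (widthAt_of_getElem? D.closed (k := u.length + 1) (s := t) (by
      rw [hw]; exact getElem?_strip (w := [s, t]) (by simp))).1
    exact h2.symm.trans h1
  cases hm with
  | exchange l m r g h =>
    refine ⟨fun hw => tiedOutside_pair_of_leaves hw fun i hi => ?_,
      fun hw => tiedOutside_pair_of_leaves hw fun i hi => ?_⟩
    · cases g <;> cases h <;>
        simp only [Leaves, Slice.Descends, Slice.Ascends, Slice.dom, Slice.cod, Piece.dom,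
          Piece.cod, reduceCtorEq, false_implies, true_implies, and_true] at hi ⊢ <;> omega
    · cases g <;> cases h <;>
        simp only [Leaves, Slice.Descends, Slice.Ascends, Slice.dom, Slice.cod, Piece.dom,
          Piece.cod, reduceCtorEq, false_implies, true_implies, and_true] at hi ⊢ <;> omega
  | zigzagLeft l r =>
    refine ⟨fun hw => tiedOutside_pair hw fun p hp => ?_,
      fun _ => tiedOutside_of_length_le (by simp)⟩
    have hi := lt_of_point (k := u.length + 0) (by
      rw [hw]; exact getElem?_strip (w := [⟨l, .cup, r + 1⟩, ⟨l + 1, .cap, r⟩]) (by simp)) hp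
    simp only [Slice.cod, Piece.cod, List.getElem_cons_zero] at hi
    -- This point lies on both turning arcs; along the maximum it is joined to a point whose strand
    -- goes down through the slice below.
    by_cases h : p.1.2 = l + 1
    · right
      have hj : Joined D.word (u.length + 1, l + 1) (u.length + 1, l + 1 + 1) :=
        .cap _ (l + 1) r (by
          rw [hw]
          exact getElem?_strip (w := [⟨l, .cup, r + 1⟩, ⟨l + 1, .cap, r⟩]) (by simp))
      rw [← h, ← hp] at hj
      obtain ⟨q, hq, ht⟩ := exists_tied_of_joined (p := p) (.inl hj)
      refine ⟨q, ht, by rw [hq, hp], ?_⟩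
      simp only [hq, Leaves, Slice.Descends, Slice.Ascends, Slice.dom, Slice.cod, Piece.dom,
        Piece.cod, true_implies]
      omega
    · left
      simp only [Leaves, Slice.Descends, Slice.Ascends, Slice.dom, Slice.cod, Piece.dom,
        Piece.cod, true_implies]
      omega
  | zigzagRight l r =>
    refine ⟨fun hw => tiedOutside_pair hw fun p hp => ?_,
      fun _ => tiedOutside_of_length_le (by simp)⟩
    have hi := lt_of_point (k := u.length + 0) (by
      rw [hw]; exact getElem?_strip (w := [⟨l + 1, .cup, r⟩, ⟨l, .cap, r + 1⟩]) (by simp)) hp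
    simp only [Slice.cod, Piece.cod, List.getElem_cons_zero] at hi
    by_cases h : p.1.2 = l + 1
    · right
      have hj : Joined D.word (u.length + 1, l) (u.length + 1, l + 1) :=
        .cap _ l (r + 1) (by
          rw [hw]
          exact getElem?_strip (w := [⟨l + 1, .cup, r⟩, ⟨l, .cap, r + 1⟩]) (by simp))
      rw [show ((u.length + 1, l + 1) : ℕ × ℕ) = p.1 from Prod.ext hp.symm h.symm] at hj
      obtain ⟨q, hq, ht⟩ := exists_tied_of_joined (p := p) (.inr hj)
      refine ⟨q, ht, by rw [hq], ?_⟩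
      simp only [hq, Leaves, Slice.Descends, Slice.Ascends, Slice.dom, Slice.cod, Piece.dom,
        Piece.cod, true_implies]
      omega
    · left
      simp only [Leaves, Slice.Descends, Slice.Ascends, Slice.dom, Slice.cod, Piece.dom,
        Piece.cod, true_implies]
      omega
  | crossCap l r b =>
    refine ⟨fun hw => tiedOutside_pair_of_leaves hw fun i hi => ?_,
      fun hw => tiedOutside_pair_of_leaves hw fun i hi => ?_⟩ <;>
    exact .inl ⟨hi, by simp⟩
  | cupCross l r b =>
    refine ⟨fun hw => tiedOutside_pair_of_leaves hw fun i hi => ?_,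
      fun hw => tiedOutside_pair_of_leaves hw fun i hi => ?_⟩ <;>
    exact .inr ⟨(tangle hw).symm ▸ hi, by simp⟩

/-- Strands do not turn at crossings, so each can be followed down to the lower level of the strip.
-/
theorem tiedOutside_crossings {D : MorseDiagram} {u v : List Slice} {w : List Slice}
    (hD : D.word = u ++ w ++ v) (hw : ∀ s ∈ w, ∃ b, s.piece = .cross b) :
    TiedOutside D u w := by
  have key : ∀ j, j ≤ w.length → ∀ p : D.Pt, p.1.1 = u.length + j →
      ∃ p₀ : D.Pt, D.tied p p₀ ∧ p₀.1.1 = u.length := by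
    intro j
    induction j with
    | zero => exact fun _ p hp => ⟨p, D.tied.refl _, hp⟩
    | succ j ih =>
      intro hj p hp
      have hs : D.word[u.length + j]? = some w[j] := by
        rw [hD]; exact getElem?_strip (by omega)
      obtain ⟨b, hb⟩ := hw w[j] (List.getElem_mem _)
      obtain ⟨q, h1, h2⟩ := exists_tied_of_descends hs hp ⟨lt_of_point hs hp, by simp [hb]⟩
      obtain ⟨p₀, h3, h4⟩ := ih (by omega) q h2
      exact ⟨p₀, D.tied.trans h1 h3, h4⟩
  intro p
  by_cases hp : Outer u w p.1.1
  · exact ⟨p, D.tied.refl _, hp⟩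
  · simp only [Outer, not_or, not_le] at hp
    obtain ⟨p₀, h1, h2⟩ := key (p.1.1 - u.length) (by omega) p (by omega)
    exact ⟨p₀, h1, .inl h2.le⟩

theorem tiedOutside_reidemeisterMove {D : MorseDiagram} {u w w' v : List Slice}
    (hm : ReidemeisterMove w w') :
    (D.word = u ++ w ++ v → TiedOutside D u w) ∧ (D.word = u ++ w' ++ v → TiedOutside D u w') := by
  cases hm with
  | two l r b =>
    exact ⟨fun hw => tiedOutside_crossings hw (by simp), fun hw => tiedOutside_crossings hw (by simp)⟩
  | three l r b₁₂ b₁₃ b₂₃ hb =>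
    exact ⟨fun hw => tiedOutside_crossings hw (by simp), fun hw => tiedOutside_crossings hw (by simp)⟩

end

end TiedLink

namespace TiedLink

open MorseDiagram

/-! ### The state sum -/

section

variable {K : Type} [Field K]

noncomputable instance fintype_quotient (D : MorseDiagram) : Fintype (Quotient D.tied) :=
  Fintype.ofFinite _

noncomputable instance decidableEq_quotient (D : MorseDiagram) : DecidableEq (Quotient D.tied) :=
  Classical.decEq _

/-- The contribution of a colouring of the classes of tied components. -/
noncomputable def stateTerm (a : K) (q : ℕ) (D : MorseDiagram)
    (f : Quotient D.tied → Fin (q + 1)) : K :=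
  pull a (colouring D f) D.word (fun _ => 1) []

/-- The sum over the colourings of the classes of tied components with `q + 1` colours. -/
noncomputable def stateSum (a : K) (q : ℕ) (D : MorseDiagram) : K :=
  ∑ f : Quotient D.tied → Fin (q + 1), stateTerm a q D f

theorem stateTerm_eq (a : K) (q : ℕ) {D : MorseDiagram} {w : List Slice} (hw : D.word = w)
    (f : Quotient D.tied → Fin (q + 1)) :
    stateTerm a q D f = pull a (colouring D f) w (fun _ => 1) [] := by
  unfold stateTerm
  generalize colouring D f = g
  rw [hw]

theorem consistent_of_word {D : MorseDiagram} {w : List Slice} (hw : D.word = w) {q : ℕ}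
    (f : Quotient D.tied → Fin (q + 1)) : Consistent (colouring D f) w := by
  have := consistent_colouring D f
  generalize colouring D f = g at this
  rwa [hw] at this

theorem sum_comp_symm (q : ℕ) {D D' : MorseDiagram} (e : Quotient D.tied ≃ Quotient D'.tied)
    (t : (Quotient D'.tied → Fin (q + 1)) → K) :
    ∑ f : Quotient D.tied → Fin (q + 1), t (f ∘ e.symm) = ∑ f, t f :=
  Fintype.sum_equiv (e.arrowCongr (Equiv.refl _)) _ _ fun _ => rfl

theorem stateSum_eq {a : K} {q : ℕ} {D D' : MorseDiagram} (e : Quotient D.tied ≃ Quotient D'.tied)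
    (h : ∀ f, stateTerm a q D f = stateTerm a q D' (f ∘ e.symm)) :
    stateSum a q D = stateSum a q D' := by
  unfold stateSum
  rw [← sum_comp_symm q e]
  exact Finset.sum_congr rfl fun f _ => h f

theorem AgreeOutside.level_bottom {C : Type} {u w w' v : List Slice} {m n : ℕ} {g g' : ℕ → ℕ → C}
    (h : AgreeOutside u w w' v n g g') (hs : Strip u w w' v m n) (i : ℕ) (hi : i < m) :
    g u.length i = g' u.length i :=
  h.1 _ i le_rfl (by rwa [widthAt_length hs.bottom])

theorem AgreeOutside.level_top {C : Type} {u w w' v : List Slice} {n : ℕ} {g g' : ℕ → ℕ → C}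
    (h : AgreeOutside u w w' v n g g') (i : ℕ) (hi : i < n) :
    g (u.length + w.length) i = g' (u.length + w'.length) i :=
  h.2 0 i (Nat.zero_le _) (by rwa [widthAt_zero])

theorem AgreeOutside.symm {C : Type} {u w w' v : List Slice} {n : ℕ} {g g' : ℕ → ℕ → C}
    (h : AgreeOutside u w w' v n g g') : AgreeOutside u w' w v n g' g :=
  ⟨fun k i hk hi => (h.1 k i hk hi).symm, fun k i hk hi => (h.2 k i hk hi).symm⟩

theorem AgreeOutside.trans {C : Type} {u w w' w'' v : List Slice} {n : ℕ} {g g' g'' : ℕ → ℕ → C}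
    (h : AgreeOutside u w w' v n g g') (h' : AgreeOutside u w' w'' v n g' g'') :
    AgreeOutside u w w'' v n g g'' :=
  ⟨fun k i hk hi => (h.1 k i hk hi).trans (h'.1 k i hk hi),
    fun k i hk hi => (h.2 k i hk hi).trans (h'.2 k i hk hi)⟩

theorem Consistent.strip {C : Type} {g : ℕ → ℕ → C} {u w v : List Slice}
    (h : Consistent g (u ++ w ++ v)) : Consistent (fun k => g (u.length + k)) w :=
  h.append_left.append_right

/-- The bijection of the tie classes matches the colourings, and corresponding terms agree because
their colourings agree at the boundary of the strip. -/
theorem stateSum_of_replace {a : K} {q : ℕ} {D D' : MorseDiagram} {u w w' v : List Slice}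
    (h : Replace u w w' v D D') (hD : TiedOutside D u w) (hD' : TiedOutside D' u w')
    (hpull : ∀ (g g' : ℕ → ℕ → Fin (q + 1)) (m n : ℕ), IsTangle m w n → Consistent g w →
      Consistent g' w' → (∀ i < m, g 0 i = g' 0 i) →
      (∀ i < n, g w.length i = g' w'.length i) → ∀ (ψ : List Bool → K) x, x.length = m →
      pull a g w ψ x = pull a g' w' ψ x) :
    stateSum a q D = stateSum a q D' := by
  obtain ⟨m, n, hs⟩ := h.strip
  obtain ⟨e, he⟩ := h.exists_equiv hs hD hD'
  refine stateSum_eq e fun f => ?_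
  have hag := he _ f
  have hc := consistent_of_word h.1 f
  have hc' := consistent_of_word h.2.1 (f ∘ e.symm)
  rw [stateTerm_eq a q h.1, stateTerm_eq a q h.2.1]
  refine pull_replace a hs.bottom hs.right hs.top hag.1 hag.2 ?_ _
  exact hpull _ _ m n hs.left hc.strip hc'.strip (hag.level_bottom hs) hag.level_top

theorem stateSum_reidemeister {a : K} (ha : a ≠ 0) (q : ℕ) {D D' : MorseDiagram}
    (h : Reidemeister D D') : stateSum a q D = stateSum a q D' := by
  obtain ⟨u, w, w', v, hm, hr⟩ := h
  exact stateSum_of_replace hr ((tiedOutside_reidemeisterMove hm).1 hr.1)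
    ((tiedOutside_reidemeisterMove hm).2 hr.2.1) fun g g' m n hw hg hg' h0 _ =>
      pull_reidemeisterMove ha hm hw hg hg' h0

theorem widthAt_addRight_append (m : ℕ) (w x : List Slice) (k : ℕ) :
    widthAt m (addRight w ++ x) k = widthAt m (addLeft w ++ x) k := by
  induction w generalizing m k with
  | nil => rfl
  | cons s w ih =>
    cases k with
    | zero => rfl
    | succ k =>
      have e : Slice.cod ⟨s.left, s.piece, s.right + 1⟩ =
        Slice.cod ⟨s.left + 1, s.piece, s.right⟩ := by simp [Slice.cod]; omega
      change widthAt _ _ k = widthAt _ _ k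
      rw [e]
      exact ih _ k

theorem widthAt_addRight (m : ℕ) (w : List Slice) (k : ℕ) :
    widthAt (m + 1) (addRight w) k = widthAt m w k + 1 := by
  induction w generalizing m k with
  | nil => cases k <;> rfl
  | cons s w ih =>
    cases k with
    | zero => rfl
    | succ k => exact ih s.cod k

theorem widthAt_closure (w : List Slice) (k : ℕ) :
    widthAt 0 (rightClosure w) k = widthAt 0 (leftClosure w) k := by
  cases k with
  | zero => rfl
  | succ k => exact widthAt_addRight_append 2 w _ k

theorem widthAt_rightClosure (w : List Slice) {k : ℕ} (hk : k ≤ w.length) :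
    widthAt 0 (rightClosure w) (k + 1) = widthAt 1 w k + 1 := by
  have : widthAt 0 (rightClosure w) (k + 1) = widthAt 2 (addRight w ++ [⟨0, .cap, 0⟩]) k := rfl
  rw [this, widthAt_append_left (by simpa [addRight] using hk), widthAt_addRight]

theorem length_closure (w : List Slice) : (rightClosure w).length = (leftClosure w).length := by
  simp [rightClosure, leftClosure, addRight, addLeft]

/-- All points correspond, hence all classes. Moving the last point of a level to the front raises
the other indices by one, which is the shift of colours in `pull_closure`. -/
theorem stateSum_infinity {a : K} (ha : a ≠ 0) (q : ℕ) {w : List Slice} {D D' : MorseDiagram}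
    (hw : IsTangle 1 w 1) (hD : D.word = rightClosure w) (hD' : D'.word = leftClosure w)
    (h : TiesAgree (throughInfinity w) D D') : stateSum a q D = stateSum a q D' := by
  have hpt : ∀ {k i : ℕ}, IsPoint D.word (k, i) ↔ IsPoint (rightClosure w) (k, i) := by simp [hD]
  have hpt' : ∀ {k i : ℕ}, IsPoint D'.word (k, i) ↔ IsPoint (rightClosure w) (k, i) := by
    simp [hD', IsPoint, length_closure, widthAt_closure]
  obtain ⟨e, he⟩ := exists_equiv_of_tiesAgree h (fun p => by
      obtain ⟨⟨k, i⟩, hp⟩ := p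
      have hp' := hpt.1 hp
      have hi : i < widthAt 0 (rightClosure w) k := hp'.2
      rcases Nat.lt_or_ge (i + 1) (widthAt 0 (rightClosure w) k) with h1 | h1
      · exact ⟨_, ⟨(k, i + 1), hpt'.2 ⟨hp'.1, h1⟩⟩, D.tied.refl _, .inl ⟨h1, rfl⟩⟩
      · exact ⟨_, ⟨(k, 0), hpt'.2 ⟨hp'.1, by simp only; omega⟩⟩, D.tied.refl _,
          .inr ⟨by simp only; omega, rfl⟩⟩) (fun p' => by
      obtain ⟨⟨k, i⟩, hp⟩ := p'
      have hp' := hpt'.1 hp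
      have hi : i < widthAt 0 (rightClosure w) k := hp'.2
      cases i with
      | zero =>
        exact ⟨⟨(k, widthAt 0 (rightClosure w) k - 1), hpt.2 ⟨hp'.1, by simp only; omega⟩⟩, _,
          D'.tied.refl _, .inr ⟨by simp only; omega, rfl⟩⟩
      | succ i =>
        exact ⟨⟨(k, i), hpt.2 ⟨hp'.1, by simp only; omega⟩⟩, _, D'.tied.refl _,
          .inl ⟨hi, rfl⟩⟩)
  refine stateSum_eq e fun f => ?_
  rw [stateTerm_eq a q hD, stateTerm_eq a q hD']
  refine pull_closure ha hw (consistent_of_word hD f) (consistent_of_word hD' _)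
    fun k i hk hi => ?_
  have hwd := widthAt_rightClosure w hk
  have hlen : k + 1 ≤ (rightClosure w).length := by simp [rightClosure, addRight]; omega
  have i1 : IsPoint D.word (k + 1, i) := hpt.2 ⟨hlen, by simp only; omega⟩
  have i2 : IsPoint D'.word (k + 1, i + 1) := hpt'.2 ⟨hlen, by simp only; omega⟩
  have hR := he ⟨_, i1⟩ ⟨_, i2⟩ (.inl ⟨by simp only; omega, rfl⟩)
  have c1 := colouring_point D f ⟨_, i1⟩
  have c2 := colouring_point D' (f ∘ e.symm) ⟨_, i2⟩
  rw [← hR] at c2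
  simp only [Function.comp_apply, Equiv.symm_apply_apply] at c1 c2
  exact c1.trans c2.symm

theorem stateSum_isotopy {a : K} (ha : a ≠ 0) (q : ℕ) {D D' : MorseDiagram}
    (h : Isotopy D D') : stateSum a q D = stateSum a q D' := by
  cases h with
  | planar u w w' v _ _ hm hr =>
    exact stateSum_of_replace hr ((tiedOutside_planarMove hm).1 hr.1)
      ((tiedOutside_planarMove hm).2 hr.2.1) fun g g' m n hw hg hg' h0 h1 =>
        pull_planarMove ha hm hw hg hg' h0 h1
  | infinity w _ _ hw hD hD' ht => exact stateSum_infinity ha q hw hD hD' ht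

/-! ### The skein relations -/

variable {C : Type} [LinearOrder C]

theorem pull_replace_add (a : K) {g g₁ g₂ : ℕ → ℕ → C} {u w w₁ w₂ v : List Slice} {m n : ℕ}
    (h₁ : Strip u w w₁ v m n) (ag₁ : AgreeOutside u w w₁ v n g g₁)
    (ag₂ : AgreeOutside u w w₂ v n g g₂) (r s : K)
    (h : ∀ (ψ : List Bool → K) x, x.length = m →
      pull a (fun k => g (u.length + k)) w ψ x =
        r * pull a (fun k => g₁ (u.length + k)) w₁ ψ x +
        s * pull a (fun k => g₂ (u.length + k)) w₂ ψ x)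
    (ψ : List Bool → K) : pull a g (u ++ w ++ v) ψ [] =
      r * pull a g₁ (u ++ w₁ ++ v) ψ [] + s * pull a g₂ (u ++ w₂ ++ v) ψ [] := by
  have top : ∀ {w' : List Slice} {g' : ℕ → ℕ → C}, AgreeOutside u w w' v n g g' →
      pull a (fun k => g' ((u ++ w').length + k)) v =
        pull a (fun k => g ((u ++ w).length + k)) v := fun hag =>
    pull_congr_colour a h₁.top fun k i hk hi => by
      simpa using (hag.2 k i hk hi).symm
  rw [pull_append, pull_append, pull_append, pull_append, pull_append, pull_append, top ag₁,
    top ag₂, ← pull_congr_colour a h₁.bottom ag₁.1, ← pull_congr_colour a h₁.bottom ag₂.1,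
    ← isLin_pull]
  exact pull_congr_fun a _ h₁.bottom (fun y hy => h _ y hy) rfl

theorem lift_linear (l : ℕ) (O O' : Op K) (r s : K) :
    lift l (fun ψ x => r * O ψ x + s * O' ψ x) =
      fun ψ x => r * lift l O ψ x + s * lift l O' ψ x := by
  induction l with
  | zero => rfl
  | succ l ih =>
    funext ψ x
    cases x with
    | nil => simp [lift]
    | cons t x => simp only [lift, ih]

theorem lift_crossOp_self (a : K) (l : ℕ) (b : Bool) (c : C) (ψ : List Bool → K) (x : List Bool)
    (hx : l ≤ x.length) :
    lift l (crossOp a b c c) ψ x =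
      bif b then a * ψ x + a⁻¹ * lift l (capOp a) (lift l (cupOp a) ψ) x
      else a * lift l (capOp a) (lift l (cupOp a) ψ) x + a⁻¹ * ψ x := by
  have e := congrFun (congrFun (lift_comp l (capOp a) (cupOp a)) ψ) x
  simp only [Function.comp_apply] at e
  cases b
  · have : crossOp a false c c = fun ψ x =>
        a * (capOp a ∘ cupOp a) ψ x + a⁻¹ * (id : Op K) ψ x := by
      funext ψ x; simp [crossOp]
    rw [this, lift_linear]
    simp only [lift_id l ψ x hx, e, cond_false]
  · have : crossOp a true c c = fun ψ x =>
        a * (id : Op K) ψ x + a⁻¹ * (capOp a ∘ cupOp a) ψ x := by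
      funext ψ x; simp [crossOp]
    rw [this, lift_linear]
    simp only [lift_id l ψ x hx, e, cond_true]

theorem pull_skein_self (a : K) {g gE gF : ℕ → ℕ → C} {u v : List Slice} {m n l r : ℕ} {b : Bool}
    (hE : Strip u [⟨l, .cross b, r⟩] [] v m n)
    (agE : AgreeOutside u [⟨l, .cross b, r⟩] [] v n g gE)
    (agF : AgreeOutside u [⟨l, .cross b, r⟩] [⟨l, .cap, r⟩, ⟨l, .cup, r⟩] v n g gF)
    (hc : g u.length l = g u.length (l + 1)) (ψ : List Bool → K) :
    pull a g (u ++ [⟨l, .cross b, r⟩] ++ v) ψ [] =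
      (bif b then a else a⁻¹) * pull a gE (u ++ [] ++ v) ψ [] +
      (bif b then a⁻¹ else a) *
        pull a gF (u ++ [⟨l, .cap, r⟩, ⟨l, .cup, r⟩] ++ v) ψ [] := by
  refine pull_replace_add a hE agE agF _ _ (fun ψ x hx => ?_) ψ
  have hl : l ≤ x.length := by
    rw [hx, ← hE.left.1]; simp [Slice.dom]; omega
  simp only [pull, pieceOp, Nat.add_zero, id, hc, lift_crossOp_self a l b _ ψ x hl]
  cases b
  · simp only [cond_false]; ring
  · simp only [cond_true]

/-- The over-strand and the under-strand trade places, and as their colours differ, exactly one of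
the two signs is -1. -/
theorem pull_skein_ne (a : K) {g g' : ℕ → ℕ → C} {u v : List Slice} {m n l r : ℕ}
    (hs : Strip u [⟨l, .cross true, r⟩] [⟨l, .cross false, r⟩] v m n)
    (hag : AgreeOutside u [⟨l, .cross true, r⟩] [⟨l, .cross false, r⟩] v n g g')
    (hc : g u.length l ≠ g u.length (l + 1)) (ψ : List Bool → K) :
    pull a g (u ++ [⟨l, .cross true, r⟩] ++ v) ψ [] +
      pull a g' (u ++ [⟨l, .cross false, r⟩] ++ v) ψ [] = 0 := by
  -- Only one term is wanted, so the second one repeats it with the coefficient 0.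
  have key := pull_replace_add a hs hag hag (-1) 0 (fun ψ x hx => ?_) ψ
  · rw [key]; ring
  · have hm : l + 2 ≤ m := by rw [← hs.left.1]; simp [Slice.dom, Piece.dom]
    have e1 := hag.level_bottom hs l (by omega)
    have e2 := hag.level_bottom hs (l + 1) (by omega)
    rw [e1, e2] at hc
    have hsign : crossSign K true (g' u.length l) (g' u.length (l + 1)) =
        -1 * crossSign K false (g' u.length l) (g' u.length (l + 1)) := by
      simp only [crossSign, cond_true, cond_false]
      rcases lt_or_gt_of_ne hc with h | h
      · rw [if_pos h, if_neg h.not_gt]; ring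
      · rw [if_neg h.not_gt, if_pos h]; ring
    have hop : crossOp a true (g' u.length l) (g' u.length (l + 1)) =
        fun ψ x => -1 * crossOp a false (g' u.length l) (g' u.length (l + 1)) ψ x +
          0 * crossOp a false (g' u.length l) (g' u.length (l + 1)) ψ x := by
      funext ψ x
      simp only [crossOp, if_neg hc, hsign]
      ring
    simp only [pull, pieceOp, Nat.add_zero, id, e1, e2, hop, lift_linear]

theorem tiedOutside_capCup {D : MorseDiagram} {u v : List Slice} {l r : ℕ}
    (hw : D.word = u ++ [⟨l, .cap, r⟩, ⟨l, .cup, r⟩] ++ v) :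
    TiedOutside D u [⟨l, .cap, r⟩, ⟨l, .cup, r⟩] :=
  tiedOutside_pair_of_leaves hw fun i hi => .inl ⟨hi, by simp⟩

theorem colouring_eq_of_tied {q : ℕ} {D : MorseDiagram} (f : Quotient D.tied → Fin (q + 1))
    {p p' : D.Pt} {k i j : ℕ} (hp : p.1 = (k, i)) (hp' : p'.1 = (k, j)) :
    (colouring D f k i = colouring D f k j ↔
      f (Quotient.mk _ p) = f (Quotient.mk _ p')) := by
  have h1 := colouring_point D f p
  have h2 := colouring_point D f p'
  rw [hp] at h1
  rw [hp'] at h2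
  rw [← h1, ← h2]

/-- Both strands lie in one tie class, so every colouring gives them the same colour and the
Kauffman expansion holds term by term. -/
theorem stateSum_tiedSkein (a : K) (q : ℕ) {b : Bool} {D E F : MorseDiagram}
    (h : TiedSkein b D E F) : stateSum a q D =
      (bif b then a else a⁻¹) * stateSum a q E + (bif b then a⁻¹ else a) * stateSum a q F := by
  obtain ⟨u, v, l, r, hE, hF, p, p', hp, hp', hpp⟩ := h
  obtain ⟨m, n, sE⟩ := hE.strip
  obtain ⟨m', n', sF⟩ := hF.strip
  obtain rfl := sE.bottom.unique sF.bottom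
  obtain rfl := sE.left.unique sF.left
  have tD : TiedOutside D u [⟨l, .cross b, r⟩] := tiedOutside_of_length_le (by simp)
  obtain ⟨eE, hagE⟩ := hE.exists_equiv sE tD (tiedOutside_of_length_le (by simp))
  obtain ⟨eF, hagF⟩ := hF.exists_equiv sF tD (tiedOutside_capCup hF.2.1)
  unfold stateSum
  rw [← sum_comp_symm q eE, ← sum_comp_symm q eF, Finset.mul_sum, Finset.mul_sum,
    ← Finset.sum_add_distrib]
  refine Finset.sum_congr rfl fun f _ => ?_
  rw [stateTerm_eq a q hE.1, stateTerm_eq a q hE.2.1, stateTerm_eq a q hF.2.1]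
  refine pull_skein_self a sE (hagE _ f) (hagF _ f) ?_ _
  rw [colouring_eq_of_tied f hp hp']
  exact congrArg f (Quotient.sound hpp)

/-- The class of a point after the addition of a tie. -/
def addTieClass (D : MorseDiagram) (p p' : D.Pt) :
    Quotient D.tied → Quotient (D.addTie p p').tied :=
  Quotient.map' id fun _ _ h => (le_sup_left : D.tied ≤ (D.addTie p p').tied) h

theorem addTieClass_eq (D : MorseDiagram) (p p' : D.Pt) :
    addTieClass D p p' (Quotient.mk _ p) = addTieClass D p p' (Quotient.mk _ p') :=
  Quotient.sound ((le_sup_right : _ ≤ (D.addTie p p').tied) (Relation.EqvGen.rel _ _ ⟨rfl, rfl⟩))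

theorem addTieClass_surjective (D : MorseDiagram) (p p' : D.Pt) :
    Function.Surjective (addTieClass D p p') := by
  rintro ⟨x⟩
  exact ⟨Quotient.mk _ x, rfl⟩

theorem exists_comp_addTieClass {T : Type} (D : MorseDiagram) (p p' : D.Pt)
    (f : Quotient D.tied → T) (hf : f (Quotient.mk _ p) = f (Quotient.mk _ p')) :
    ∃ f', f' ∘ addTieClass D p p' = f := by
  have hle : (D.addTie p p').tied ≤ Setoid.comap (fun x => f (Quotient.mk _ x)) ⊥ := by
    refine sup_le (fun x y hxy => congrArg f (Quotient.sound hxy)) (Setoid.eqvGen_le ?_)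
    rintro x y ⟨rfl, rfl⟩
    exact hf
  refine ⟨Quotient.lift (fun x => f (Quotient.mk _ x)) fun x y hxy => hle hxy, ?_⟩
  funext x
  obtain ⟨x, rfl⟩ := Quotient.exists_rep x
  rfl

theorem colouring_addTie {q : ℕ} (D : MorseDiagram) (p p' : D.Pt)
    (f : Quotient (D.addTie p p').tied → Fin (q + 1)) :
    colouring (D.addTie p p') f = colouring D (f ∘ addTieClass D p p') := by
  funext k i
  by_cases h : IsPoint D.word (k, i)
  · have h1 := colouring_point D (f ∘ addTieClass D p p') ⟨_, h⟩
    have h2 := colouring_point (D.addTie p p') f ⟨_, h⟩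
    exact h2.trans h1.symm
  · have h' : ¬ IsPoint (D.addTie p p').word (k, i) := h
    simp [colouring, class?, h, h']

/-- The colourings after the tie are precisely those before it that agree on `p` and `p'`; the
others contribute nothing. -/
theorem sum_addTie {q : ℕ} (D : MorseDiagram) (p p' : D.Pt)
    (t : (Quotient D.tied → Fin (q + 1)) → K)
    (ht : ∀ f, f (Quotient.mk _ p) ≠ f (Quotient.mk _ p') → t f = 0) :
    ∑ f, t f = ∑ f : Quotient (D.addTie p p').tied → Fin (q + 1),
      t (f ∘ addTieClass D p p') := by
  symm
  refine Finset.sum_of_injOn (fun f => f ∘ addTieClass D p p')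
    (fun f _ f' _ hff => (addTieClass_surjective D p p').injective_comp_right hff)
    (fun _ _ => by simp) (fun f _ hf => ?_) (fun _ _ => rfl)
  by_contra h0
  have := mt (ht f) h0
  obtain ⟨f', hf'⟩ := exists_comp_addTieClass D p p' f (not_not.1 this)
  exact hf ⟨f', by simp, hf'⟩

/-- Colourings with different colours at the crossing cancel between `D` and `D'`. The remaining
ones are the colourings of `D` with the tie; for them both crossings are expanded, and the
coefficients add up to a + a⁻¹. -/
theorem stateSum_skein (a : K) (q : ℕ) {D D' E F : MorseDiagram} (h : Skein D D' E F) :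
    stateSum a q D + stateSum a q D' =
      (a + a⁻¹) * (stateSum a q E + stateSum a q F) := by
  obtain ⟨u, v, l, r, hD, p, p', hp, hp', hE, hF⟩ := h
  obtain ⟨m, n, sD⟩ := hD.strip
  obtain ⟨m', n', sE⟩ := hE.strip
  obtain ⟨m'', n'', sF⟩ := hF.strip
  obtain rfl := sD.bottom.unique sE.bottom
  obtain rfl := sD.bottom.unique sF.bottom
  obtain rfl := sD.left.unique sE.left
  obtain rfl := sD.left.unique sF.left
  have t1 : ∀ (X : MorseDiagram) b, TiedOutside X u [⟨l, .cross b, r⟩] := fun X b =>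
    tiedOutside_of_length_le (by simp)
  obtain ⟨e, hag⟩ := hD.exists_equiv sD (t1 D true) (t1 D' false)
  obtain ⟨eE, hagE⟩ := hE.exists_equiv sE (t1 _ true) (tiedOutside_of_length_le (by simp))
  obtain ⟨eF, hagF⟩ := hF.exists_equiv sF (t1 _ true) (tiedOutside_capCup hF.2.1)
  -- The smoothings are given relative to `D`; chaining the agreements outside of the strip makes
  -- them comparable with `D'` too.
  have sE' : Strip u [⟨l, .cross false, r⟩] [] v m n := ⟨sD.bottom, sD.right, sE.right, sD.top⟩
  unfold stateSum
  rw [← sum_comp_symm q e, ← Finset.sum_add_distrib, sum_addTie D p p', ← sum_comp_symm q eE,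
    ← sum_comp_symm q eF, ← Finset.sum_add_distrib, Finset.mul_sum]
  · refine Finset.sum_congr rfl fun f _ => ?_
    have agD := hag _ (f ∘ addTieClass D p p')
    have agE := hagE _ f
    have agF := hagF _ f
    rw [colouring_addTie] at agE agF
    have hc : colouring D (f ∘ addTieClass D p p') u.length l =
        colouring D (f ∘ addTieClass D p p') u.length (l + 1) := by
      rw [colouring_eq_of_tied _ hp hp']
      exact congrArg f (addTieClass_eq D p p')
    have hm : l + 2 ≤ m := by rw [← sD.left.1]; simp [Slice.dom, Piece.dom]
    have hc' := hc
    rw [agD.level_bottom sD l (by omega), agD.level_bottom sD (l + 1) (by omega)] at hc'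
    rw [stateTerm_eq a q hD.1, stateTerm_eq a q hD.2.1, stateTerm_eq a q hE.2.1,
      stateTerm_eq a q hF.2.1, pull_skein_self a sE agE agF hc,
      pull_skein_self a sE' (agD.symm.trans agE) (agD.symm.trans agF) hc']
    simp only [cond_true, cond_false]
    ring
  · intro f hf
    rw [stateTerm_eq a q hD.1, stateTerm_eq a q hD.2.1]
    refine pull_skein_ne a sD (hag _ f) ?_ _
    rwa [Ne, colouring_eq_of_tied f hp hp']

end

end TiedLink

namespace TiedLink

open MorseDiagram

/-! ### Circles in the state sum -/

section

variable {K : Type} [Field K]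

theorem pull_circle {C : Type} [LinearOrder C] (a : K) (g : ℕ → ℕ → C) (l r : ℕ)
    (ψ : List Bool → K) (x : List Bool) (hx : l ≤ x.length) :
    pull a g (circle l r) ψ x = -(a ^ 2 + (a ^ 2)⁻¹) * ψ x := by
  have e := congrFun (congrFun (lift_comp l (cupOp a) (capOp a)) ψ) x
  have h : cupOp a ∘ capOp a = fun ψ x =>
      -(a ^ 2 + (a ^ 2)⁻¹) * (id : Op K) ψ x + 0 * (id : Op K) ψ x := by
    funext ψ x
    simp only [Function.comp_apply, cupOp, capOp, id]
    ring
  rw [h, lift_linear] at e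
  simp only [lift_id l ψ x hx, zero_mul, add_zero] at e
  exact e.symm

theorem pull_insert_circle {C : Type} [LinearOrder C] (a : K) {g g' : ℕ → ℕ → C}
    {u v : List Slice} {m n l r : ℕ} (hs : Strip u (circle l r) [] v m n)
    (hag : AgreeOutside u (circle l r) [] v n g g') (ψ : List Bool → K) :
    pull a g (u ++ circle l r ++ v) ψ [] =
      -(a ^ 2 + (a ^ 2)⁻¹) * pull a g' (u ++ [] ++ v) ψ [] := by
  have key := pull_replace_add a hs hag hag (-(a ^ 2 + (a ^ 2)⁻¹)) 0 (fun ψ x hx => ?_) ψ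
  · rw [key, zero_mul, add_zero]
  · have hl : l ≤ x.length := by
      rw [hx, ← hs.left.1]; simp [Slice.dom]; omega
    rw [pull_circle a _ l r ψ x hl]
    simp [pull]

theorem exists_circlePoint {D : MorseDiagram} {u v : List Slice} {l r : ℕ}
    (hw : D.word = u ++ circle l r ++ v) :
    ∃ z : D.Pt, z.1 = (u.length + 1, l) ∧ ∀ p : D.Pt,
      p.1 = (u.length + 1, l) ∨ p.1 = (u.length + 1, l + 1) → D.tied p z := by
  have hj : Joined D.word (u.length + 1, l) (u.length + 1, l + 1) :=
    .cup (u.length + 0) l r (by rw [hw]; exact getElem?_strip (w := circle l r) (by simp [circle]))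
  refine ⟨⟨_, (hj.isPoint D.closed).1⟩, rfl, ?_⟩
  rintro ⟨p, hp⟩ (rfl | rfl)
  · exact D.tied.refl _
  · exact D.tied.symm (D.tied_of_joined ⟨_, (hj.isPoint D.closed).1⟩ ⟨_, hp⟩ hj)

theorem exists_outer_of_ne_circle {D : MorseDiagram} {u v : List Slice} {l r : ℕ}
    (hw : D.word = u ++ circle l r ++ v) (p : D.Pt) (h : p.1 ≠ (u.length + 1, l))
    (h' : p.1 ≠ (u.length + 1, l + 1)) :
    ∃ p₀ : D.Pt, D.tied p p₀ ∧ Outer u (circle l r) p₀.1.1 := by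
  by_cases hp : p.1.1 = u.length + 1
  · refine exists_tied_of_leaves hw hp (.inl ⟨?_, fun _ => ⟨fun hi => h ?_, fun hi => h' ?_⟩⟩)
    · exact lt_of_point (k := u.length + 0)
        (by rw [hw]; exact getElem?_strip (w := circle l r) (by simp [circle])) hp
    · exact Prod.ext hp hi
    · exact Prod.ext hp hi
  · exact ⟨p, D.tied.refl _, by unfold Outer; simp [circle]; omega⟩

/-- The circle joins a class that has a colour already, so the colourings correspond one to one and
each term gains one factor. -/
theorem stateSum_tiedCircle (a : K) (q : ℕ) {D D' : MorseDiagram} (h : TiedCircle D D') :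
    stateSum a q D' = -(a ^ 2 + (a ^ 2)⁻¹) * stateSum a q D := by
  obtain ⟨u, v, l, r, h, p, p', hp, hpp, hne, hne'⟩ := h
  obtain ⟨m, n, hs⟩ := h.strip
  have t : TiedOutside D' u (circle l r) := by
    intro x
    by_cases hx : x.1 = (u.length + 1, l) ∨ x.1 = (u.length + 1, l + 1)
    · obtain ⟨z, -, hz⟩ := exists_circlePoint h.1
      obtain ⟨p₀, h1, h2⟩ := exists_outer_of_ne_circle h.1 p' hne hne'
      exact ⟨p₀, D'.tied.trans (hz x hx) (D'.tied.trans (D'.tied.symm (hz p (.inl hp)))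
        (D'.tied.trans hpp h1)), h2⟩
    · rw [not_or] at hx
      exact exists_outer_of_ne_circle h.1 x hx.1 hx.2
  obtain ⟨e, hag⟩ := h.exists_equiv hs t (tiedOutside_of_length_le (by simp))
  unfold stateSum
  rw [← sum_comp_symm q e, Finset.mul_sum]
  refine Finset.sum_congr rfl fun f _ => ?_
  rw [stateTerm_eq a q h.1, stateTerm_eq a q h.2.1]
  exact pull_insert_circle a hs (hag _ f) _

/-- The circle is a tie class of its own, and its colour is a free choice among `q + 1`. -/
theorem stateSum_untiedCircle (a : K) (q : ℕ) {D D' : MorseDiagram} (h : UntiedCircle D D') :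
    stateSum a q D' = (q + 1) * -(a ^ 2 + (a ^ 2)⁻¹) * stateSum a q D := by
  obtain ⟨u, v, l, r, h, hz⟩ := h
  obtain ⟨m, n, hs⟩ := h.strip
  obtain ⟨z, hz1, hz2⟩ := exists_circlePoint h.1
  have hout : ∀ p : D.Pt, ∃ p' : D'.Pt, outside u.length 0 2 p.1 p'.1 := fun p =>
    exists_outside h.symm p (by unfold Outer; simp; omega)
  obtain ⟨ι, hι, hR⟩ := exists_embedding_of_tiesAgree h.symm.2.2 fun p => by
    obtain ⟨p', hp'⟩ := hout p
    exact ⟨p, p', D.tied.refl _, hp'⟩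
  have hzι : ∀ x, ι x ≠ Quotient.mk _ z := by
    rintro ⟨p⟩ hp
    obtain ⟨p', hp'⟩ := hout p
    have ht := Quotient.exact ((hR p p' hp').symm.trans hp)
    have hl : p'.1.1 = u.length + 1 := by
      rcases hz z p' hz1 (D'.tied.symm ht) with h | h <;> rw [h]
    rcases hp' with ⟨h1, h2⟩ | ⟨k, x, -, h2⟩
    · rw [h2] at hl; omega
    · rw [h2] at hl; simp only at hl; omega
  let e : Option (Quotient D.tied) ≃ Quotient D'.tied :=
    Equiv.ofBijective (fun o => o.elim (Quotient.mk _ z) ι) (by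
      constructor
      · rintro (_ | x) (_ | y) hxy
        · rfl
        · exact absurd hxy.symm (hzι y)
        · exact absurd hxy (hzι x)
        · exact congrArg some (hι hxy)
      · rintro ⟨p'⟩
        by_cases hp : p'.1 = (u.length + 1, l) ∨ p'.1 = (u.length + 1, l + 1)
        · exact ⟨none, Quotient.sound (D'.tied.symm (hz2 p' hp))⟩
        · rw [not_or] at hp
          obtain ⟨p₀, h1, h2⟩ := exists_outer_of_ne_circle h.1 p' hp.1 hp.2
          obtain ⟨p, h3⟩ := exists_outside h p₀ h2
          exact ⟨some (Quotient.mk _ p), (hR p p₀ (outside_symm h3)).trans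
            (Quotient.sound (D'.tied.symm h1))⟩)
  have hterm : ∀ f' : Quotient D'.tied → Fin (q + 1), stateTerm a q D' f' =
      -(a ^ 2 + (a ^ 2)⁻¹) * stateTerm a q D (f' ∘ ι) := fun f' => by
    rw [stateTerm_eq a q h.1, stateTerm_eq a q h.2.1]
    refine pull_insert_circle a hs (agreeOutside_of_forall h hs fun p' p hp => ?_) _
    rw [colouring_point, colouring_point, ← hR p p' (outside_symm hp)]
    rfl
  unfold stateSum
  simp only [hterm]
  -- A colouring splits into the colour of the circle, the value at `none`, and a colouring of `D`;
  -- the term depends only on the latter.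
  rw [← Finset.mul_sum,
    Fintype.sum_equiv ((e.arrowCongr (Equiv.refl (Fin (q + 1)))).symm.trans
      (Equiv.piOptionEquivProd (β := fun _ => Fin (q + 1)))) (fun f' => stateTerm a q D (f' ∘ ι))
      (fun x => stateTerm a q D x.2) fun f' => rfl, Fintype.sum_prod_type]
  simp only [Finset.sum_const, Finset.card_univ, Fintype.card_fin, nsmul_eq_mul]
  push_cast
  ring

theorem stateSum_unknot (a : K) (q : ℕ) {D : MorseDiagram} (h : D.word = circle 0 0) :
    stateSum a q D = (q + 1) * -(a ^ 2 + (a ^ 2)⁻¹) := by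
  obtain ⟨z, hz1, hz2⟩ := exists_circlePoint (u := []) (v := []) (l := 0) (r := 0)
    (by simpa using h)
  have hcard : Fintype.card (Quotient D.tied) = 1 := by
    refine Fintype.card_eq_one_iff.2 ⟨Quotient.mk _ z, ?_⟩
    rintro ⟨p⟩
    refine Quotient.sound (hz2 p ?_)
    obtain ⟨⟨k, i⟩, hk, hi⟩ := p
    rw [h] at hk hi
    simp only [circle, List.length_cons, List.length_nil] at hk
    interval_cases k
    · simp [widthAt] at hi
    · have hi' : i < 2 := hi
      change ((1, i) : ℕ × ℕ) = (1, 0) ∨ ((1, i) : ℕ × ℕ) = (1, 1)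
      obtain rfl | rfl : i = 0 ∨ i = 1 := by omega
      · exact .inl rfl
      · exact .inr rfl
    · exact absurd hi (Nat.not_lt_zero _)
  unfold stateSum
  have hterm : ∀ f, stateTerm a q D f = -(a ^ 2 + (a ^ 2)⁻¹) := fun f => by
    rw [stateTerm_eq a q h, pull_circle a _ 0 0 _ _ (Nat.zero_le _), mul_one]
  simp only [hterm, Finset.sum_const, Finset.card_univ, Fintype.card_fun, hcard, Fintype.card_fin,
    pow_one, nsmul_eq_mul]
  push_cast
  ring

end

end TiedLink

namespace TiedLink

open MorseDiagram Polynomial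

/-! ### Existence and uniqueness of the bracket -/

section

/-- The field in which the state sums take their values. -/
abbrev StateField : Type := FractionRing (LaurentPolynomial ℤ)

/-- The variable `A` in the field of the state sums. -/
noncomputable def spin : StateField := algebraMap _ _ (LaurentPolynomial.T 1 : LaurentPolynomial ℤ)

/-- Characteristic zero makes the values `(q + 1) * circleValue` non-zero and pairwise different. -/
instance charZero_laurentPolynomial : CharZero (LaurentPolynomial ℤ) :=
  charZero_of_injective_ringHom (f := LaurentPolynomial.C) fun m n h => by
    simpa only [LaurentPolynomial.C_apply, if_true] using congrArg (fun p => p.coeff 0) h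

theorem algebraMap_T_mul (m n : ℤ) :
    algebraMap (LaurentPolynomial ℤ) StateField (.T m) *
        algebraMap (LaurentPolynomial ℤ) StateField (.T n) =
      algebraMap (LaurentPolynomial ℤ) StateField (.T (m + n)) := by
  rw [← map_mul, LaurentPolynomial.T_add]

theorem algebraMap_T_neg (n : ℤ) :
    algebraMap (LaurentPolynomial ℤ) StateField (.T (-n)) =
      (algebraMap (LaurentPolynomial ℤ) StateField (.T n))⁻¹ :=
  eq_inv_of_mul_eq_one_left (by
    rw [algebraMap_T_mul, neg_add_cancel, LaurentPolynomial.T_zero, map_one])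

theorem spin_ne_zero : spin ≠ 0 := fun h => by
  have := algebraMap_T_mul 1 (-1)
  rw [show algebraMap (LaurentPolynomial ℤ) StateField (.T 1) = 0 from h, zero_mul,
    add_neg_cancel, LaurentPolynomial.T_zero, map_one] at this
  exact zero_ne_one this

theorem spin_sq : spin ^ 2 = algebraMap (LaurentPolynomial ℤ) StateField (.T 2) := by
  rw [pow_two, spin, algebraMap_T_mul, one_add_one_eq_two]

/-- The value of a circle of a given colour. -/
noncomputable def circleValue : StateField := -(spin ^ 2 + (spin ^ 2)⁻¹)

theorem circleValue_ne_zero : circleValue ≠ 0 := by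
  have h : circleValue = algebraMap (LaurentPolynomial ℤ) StateField (-(.T 2 + .T (-2))) := by
    rw [circleValue, spin_sq, map_neg, map_add, algebraMap_T_neg]
  rw [h, Ne, FaithfulSMul.algebraMap_eq_zero_iff, neg_eq_zero]
  intro h0
  have := congrArg (fun p => p.coeff 2) h0
  simp [LaurentPolynomial.T_apply] at this

/-- The variables of the ring of coefficients in terms of the state sums. -/
noncomputable def stateHom : Coeff →+* (ℕ → StateField) :=
  RingHom.pi fun q => eval₂RingHom (algebraMap _ _) ((q + 1) * circleValue)

theorem stateHom_apply (p : Coeff) (q : ℕ) :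
    stateHom p q = eval₂ (algebraMap _ _) ((q + 1) * circleValue) p := rfl

theorem stateHom_A (n : ℤ) (q : ℕ) :
    stateHom (A n) q = algebraMap (LaurentPolynomial ℤ) StateField (.T n) := by
  rw [stateHom_apply, A, eval₂_C]

theorem stateHom_c (q : ℕ) : stateHom c q = (q + 1) * circleValue := by
  rw [stateHom_apply, c, eval₂_X]

/-- The value of the unknot. -/
noncomputable def unknotValue : ℕ → StateField := fun q => (q + 1) * circleValue

/-- All numbers of colours are treated at once, as sequences indexed by `q`; so the polynomial that
the reduction yields for a diagram does not depend on `q`. -/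
theorem isEvaluation_stateSum :
    IsEvaluation stateHom (fun D q => stateSum spin q D) unknotValue where
  isotopy D D' h := funext fun q => stateSum_isotopy spin_ne_zero q h
  unknot D h := funext fun q => stateSum_unknot spin q h
  untiedCircle D D' h := funext fun q => by
    rw [Pi.mul_apply, stateHom_c]
    exact stateSum_untiedCircle spin q h
  tiedCircle D D' h := funext fun q => by
    simp only [Pi.mul_apply, map_neg, map_add, Pi.neg_apply, Pi.add_apply, stateHom_A,
      algebraMap_T_neg 2, ← spin_sq]
    exact stateSum_tiedCircle spin q h
  reidemeister D D' h := funext fun q => stateSum_reidemeister spin_ne_zero q h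
  tiedSkein_true D E F h := funext fun q => by
    simp only [Pi.mul_apply, Pi.add_apply, stateHom_A, algebraMap_T_neg 1]
    exact stateSum_tiedSkein spin q h
  tiedSkein_false D E F h := funext fun q => by
    simp only [Pi.mul_apply, Pi.add_apply, stateHom_A, algebraMap_T_neg 1]
    exact (stateSum_tiedSkein spin q h).trans (add_comm _ _)
  skein D D' E F h := funext fun q => by
    simp only [Pi.mul_apply, Pi.add_apply, map_add, stateHom_A, algebraMap_T_neg 1]
    exact stateSum_skein spin q h

theorem unknotValue_apply_ne_zero (q : ℕ) : unknotValue q ≠ 0 :=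
  mul_ne_zero (by exact_mod_cast Nat.succ_ne_zero q) circleValue_ne_zero

/-- The unknot values are non-zero and cancel. A polynomial in `c` is then determined by its values
at the infinitely many points `(q + 1) * circleValue` of the field. -/
theorem stateHom_mul_unknotValue_injective :
    Function.Injective fun p : Coeff => stateHom p * unknotValue := by
  have key : ∀ p : Coeff, (∀ q, stateHom p q = 0) → p = 0 := by
    intro p hp
    refine map_injective (algebraMap _ StateField) (FaithfulSMul.algebraMap_injective _ _) ?_
    rw [Polynomial.map_zero]
    refine eq_zero_of_infinite_isRoot _ (Set.infinite_of_injective_forall_mem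
      (f := fun q : ℕ => ((q : StateField) + 1) * circleValue) (fun q q' h => ?_) fun q => ?_)
    · have := mul_right_cancel₀ circleValue_ne_zero h
      exact_mod_cast add_right_cancel this
    · change eval _ (p.map _) = 0
      rw [eval_map]
      exact hp q
  intro p p' h
  refine sub_eq_zero.1 (key _ fun q => ?_)
  have := mul_right_cancel₀ (unknotValue_apply_ne_zero q) (congrFun h q)
  rw [map_sub, Pi.sub_apply, sub_eq_zero]
  exact this

/-- The reduction attaches to each diagram a polynomial, and injectivity makes it the only one with
the given state sums. So isotopy invariance and all the rules pass from the state sums to the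
polynomials. -/
theorem exists_isBracket : ∃ B : Diagram → Coeff, IsBracket B := by
  have hS := isEvaluation_stateSum
  choose P hP using hS.exists_coeff
  have inj := stateHom_mul_unknotValue_injective
  have heq : ∀ {p p' : Coeff}, stateHom p * unknotValue = stateHom p' * unknotValue → p = p' :=
    fun h => inj h
  refine ⟨Quot.lift P fun D D' h => heq ?_, ?_⟩
  · rw [← hP, ← hP]
    exact hS.isotopy D D' h
  · refine ⟨fun D h => heq ?_, fun D D' h => heq ?_, fun D D' h => heq ?_, fun D D' h => heq ?_,
      fun D E F h => heq ?_, fun D E F h => heq ?_, fun D D' E F h => heq ?_⟩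
    · rw [map_one, one_mul]
      exact (hP D).symm.trans (hS.unknot D h)
    · rw [map_mul, mul_assoc]
      exact (hP D').symm.trans ((hS.untiedCircle D D' h).trans (congrArg _ (hP D)))
    · rw [map_mul, mul_assoc]
      exact (hP D').symm.trans ((hS.tiedCircle D D' h).trans (congrArg _ (hP D)))
    · exact (hP D).symm.trans ((hS.reidemeister D D' h).trans (hP D'))
    · rw [map_add, map_mul, map_mul, add_mul, mul_assoc, mul_assoc]
      exact (hP D).symm.trans ((hS.tiedSkein_true D E F h).trans
        (congrArg₂ (fun x y => stateHom (A 1) * x + stateHom (A (-1)) * y) (hP E) (hP F)))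
    · rw [map_add, map_mul, map_mul, add_mul, mul_assoc, mul_assoc]
      exact (hP D).symm.trans ((hS.tiedSkein_false D E F h).trans
        (congrArg₂ (fun x y => stateHom (A 1) * x + stateHom (A (-1)) * y) (hP F) (hP E)))
    · rw [map_mul, mul_assoc, map_add stateHom (Quot.lift P _ D.toDiagram),
        map_add stateHom (Quot.lift P _ E.toDiagram), add_mul, add_mul]
      exact (congrArg₂ (· + ·) (hP D) (hP D')).symm.trans ((hS.skein D D' E F h).trans
        (congrArg₂ (fun x y => stateHom (A 1 + A (-1)) * (x + y)) (hP E) (hP F)))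

/-- The pair of brackets is an evaluation along the diagonal of `Coeff × Coeff` with unknot value 1,
so its values lie on the diagonal. -/
theorem IsBracket.unique {B B' : Diagram → Coeff} (hB : IsBracket B) (hB' : IsBracket B') :
    B = B' := by
  have h : IsEvaluation ((RingHom.id Coeff).prod (RingHom.id Coeff))
      (fun D => (B D.toDiagram, B' D.toDiagram)) 1 :=
    { isotopy D D' h := by
        rw [show D.toDiagram = D'.toDiagram from Quot.sound h]
      unknot D h := Prod.ext (hB.unknot D h) (hB'.unknot D h)
      untiedCircle D D' h := Prod.ext (hB.untiedCircle D D' h) (hB'.untiedCircle D D' h)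
      tiedCircle D D' h := Prod.ext (hB.tiedCircle D D' h) (hB'.tiedCircle D D' h)
      reidemeister D D' h := Prod.ext (hB.reidemeister D D' h) (hB'.reidemeister D D' h)
      tiedSkein_true D E F h :=
        Prod.ext (hB.tiedSkein_true D E F h) (hB'.tiedSkein_true D E F h)
      tiedSkein_false D E F h :=
        Prod.ext (hB.tiedSkein_false D E F h) (hB'.tiedSkein_false D E F h)
      skein D D' E F h := Prod.ext (hB.skein D D' E F h) (hB'.skein D D' E F h) }
  funext D
  obtain ⟨D, rfl⟩ := Quot.exists_rep D
  obtain ⟨p, hp⟩ := h.exists_coeff D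
  exact (congrArg Prod.fst hp).trans (congrArg Prod.snd hp).symm

end

end TiedLink

theorem mainTheorem4 : ∃! B : TiedLink.Diagram → TiedLink.Coeff, TiedLink.IsBracket B := by
  obtain ⟨B, hB⟩ := TiedLink.exists_isBracket
  exact ⟨B, hB, fun B' hB' => hB'.unique hB⟩
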